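/- **Conventions.** Let $q\in\mathbb C$, $q\neq0$, not a root of unity ($q^k\ne1$ for $k\ge1$). Complex powers are principal: $q^{u}=e^{u\,\mathrm{Log}\,q}$, and likewise $\beta^{u}$. Put $(x;q)_n=\prod_{k=0}^{n-1}(1-xq^k)$, $(x_1,\dots,x_r;q)_n=\prod_i(x_i;q)_n$, $\begin{bmatrix}n\\m\end{bmatrix}_q=\frac{(q;q)_n}{(q;q)_m(q;q)_{n-m}}$, and $${}_r\phi_s\left(\begin{matrix}a_1,\dots,a_r\\ b_1,\dots,b_s\end{matrix};q;z\right)=\sum_{k\ge0}\frac{(a_1,\dots,a_r;q)_k}{(b_1,\dots,b_s;q)_k}\left((-1)^kq^{\binom k2}\right)^{1+s-r}\frac{z^k}{(q;q)_k},$$ written ${}_r\phi_s(a_1,\dots,a_r;b_1,\dots,b_s;z)$ below; all series below terminate. A dash denotes an empty list. Put $\epsilon_{n,m}=(-1)^m\begin{bmatrix}n\\m\end{bmatrix}_q q^{\binom m2}$ and $\kappa_{n,m}=q^{m(m-n)}\begin{bmatrix}n\\m\end{bmatrix}_q$. All parameters and the variables $\theta,\varphi,x,y$ are complex ($y$ stands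 for $q^{-x}$), $N,N_1\in\mathbb N$. Each formula holds for every $n\ge0$ such that no denominator vanishes in it or in the definitions of the polynomials of degree $\le n$ that it involves (quantities written with negative exponents, such as $a^{-n}$ or $x^{-1}$, count as denominators); for families depending on $N$ (and $N_1$) it is assumed that $n\le N$ (and $n\le N_1$). **Polynomials.** 1. Askey–Wilson: $P_n(a,b,c,d)=\frac{(ab,ac,ad;q)_n}{a^n}{}_4\phi_3(q^{-n},abcdq^{n-1},ae^{i\theta},ae^{-i\theta};ab,ac,ad;q)$. 2. $q$-Racah: $R_n(\alpha,\beta,\gamma,\delta)={}_4\phi_3(q^{-n},\alpha\beta q^{n+1},q^{-x},\gamma\delta q^{x+1};\alpha q,\beta\delta q,\gamma q;q)$. 3. Continuous dual $q$-Hahn: $P_n(a,b,c)=\frac{(ab,ac;q)_n}{a^n}{}_3\phi_2(q^{-n},ae^{i\theta},ae^{-i\theta};ab,ac;q)$. 4. Continuous $q$-Hahn: $P_n(a,b,c,d)=\frac{(abe^{2i\varphi},ac,ad;q)_n}{(ae^{i\varphi})^n}{}_4\phi_3(q^{-n},abcdq^{n-1},ae^{i(\theta+2\varphi)},ae^{-i\theta};abe^{2i\varphi},ac,ad;q)$.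 5. Big $q$-Jacobi: $P_n(x;a,b,c)={}_3\phi_2(q^{-n},abq^{n+1},x;aq,cq;q)$. 6. $q$-Hahn: $Q_n(y;\alpha,\beta,N)={}_3\phi_2(q^{-n},\alpha\beta q^{n+1},y;\alpha q,q^{-N};q)$. 7. Dual $q$-Hahn: $R_n(\gamma,\delta,N)={}_3\phi_2(q^{-n},q^{-x},\gamma\delta q^{x+1};\gamma q,q^{-N};q)$. 8. Al-Salam–Chihara: $Q_n(a,b)=\frac{(ab;q)_n}{a^n}{}_3\phi_2(q^{-n},ae^{i\theta},ae^{-i\theta};ab,0;q)$. 9. $q$-Meixner–Pollaczek: $P_n(a)=\frac{(a^2;q)_n}{(ae^{i\varphi})^n(q;q)_n}{}_3\phi_2(q^{-n},ae^{i(\theta+2\varphi)},ae^{-i\theta};a^2,0;q)$. 10. Continuous $q$-Jacobi: $P_n^{(\alpha,\beta)}=\frac{(q^{\alpha+1};q)_n}{(q;q)_n}{}_4\phi_3(q^{-n},q^{n+\alpha+\beta+1},q^{\frac\alpha2+\frac14}e^{i\theta},q^{\frac\alpha2+\frac14}e^{-i\theta};q^{\alpha+1},-q^{\frac{\alpha+\beta+1}2},-q^{\frac{\alpha+\beta+2}2};q)$.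 11. Rogers: $C_n(\beta)=\frac{(\beta^2;q)_n}{(q;q)_n}\beta^{-n/2}{}_4\phi_3(q^{-n},\beta^2q^n,\beta^{1/2}e^{i\theta},\beta^{1/2}e^{-i\theta};\beta q^{1/2},-\beta,-\beta q^{1/2};q)$. 12. Continuous $q$-Legendre: $P_n={}_4\phi_3(q^{-n},q^{n+1},q^{1/4}e^{i\theta},q^{1/4}e^{-i\theta};q,-q^{1/2},-q;q)$. 13. Big $q$-Laguerre: $P_n(x;a,b)={}_3\phi_2(q^{-n},0,x;aq,bq;q)$. 14. Little $q$-Jacobi: $p_n(x;a,b)={}_2\phi_1(q^{-n},abq^{n+1};aq;qx)$. 15. Little $q$-Legendre: $p_n(x)={}_2\phi_1(q^{-n},q^{n+1};q;qx)$. 16. $q$-Meixner: $M_n(y;b,c)={}_2\phi_1(q^{-n},y;bq;-q^{n+1}/c)$. 17. Quantum $q$-Krawtchouk: $K^{qtm}_n(y;p,N)={}_2\phi_1(q^{-n},y;q^{-N};pq^{n+1})$. 18. $q$-Krawtchouk: $K_n(y;p,N)={}_3\phi_2(q^{-n},y,-pq^n;q^{-N},0;q)$. 19. Affine $q$-Krawtchouk: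 $K^{aff}_n(y;p,N)={}_3\phi_2(q^{-n},0,y;pq,q^{-N};q)$. 20. Dual $q$-Krawtchouk: $K_n(c,N)={}_3\phi_2(q^{-n},q^{-x},cq^{x-N};q^{-N},0;q)$. 21. Continuous big $q$-Hermite: $H_n(a)=a^{-n}{}_3\phi_2(q^{-n},ae^{i\theta},ae^{-i\theta};0,0;q)$. 22. Continuous $q$-Laguerre: $P_n^{(\alpha)}=\frac{(q^{\alpha+1};q)_n}{(q;q)_n}{}_3\phi_2(q^{-n},q^{\frac\alpha2+\frac14}e^{i\theta},q^{\frac\alpha2+\frac14}e^{-i\theta};q^{\alpha+1},0;q)$. 23. Little $q$-Laguerre (Wall): $p_n(x;a)={}_2\phi_1(q^{-n},0;aq;qx)$. 24. $q$-Laguerre: $L_n^{(\alpha)}(x)=\frac{(q^{\alpha+1};q)_n}{(q;q)_n}{}_1\phi_1(q^{-n};q^{\alpha+1};-q^{n+\alpha+1}x)$. 25. Alternative $q$-Charlier: $K_n(x;a)={}_2\phi_1(q^{-n},-aq^n;0;qx)$. 26. $q$-Charlier: $C_n(y;a)={}_2\phi_1(q^{-n},y;0;-q^{n+1}/a)$.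 27. Al-Salam–Carlitz I: $U_n^{(a)}(x)=(-a)^nq^{\binom n2}{}_2\phi_1(q^{-n},x^{-1};0;qx/a)$. 28. Al-Salam–Carlitz II: $V_n^{(a)}(x)=(-a)^nq^{-\binom n2}{}_2\phi_0(q^{-n},x;-;q^n/a)$. 29. Continuous $q$-Hermite: $H_n=e^{in\theta}{}_2\phi_0(q^{-n},0;-;q^ne^{-2i\theta})$. 30. Stieltjes–Wigert: $S_n(x)=\frac1{(q;q)_n}{}_1\phi_1(q^{-n};0;-q^{n+1}x)$. 31. Discrete $q$-Hermite I: $h_n(x)=q^{\binom n2}{}_2\phi_1(q^{-n},x^{-1};0;-qx)$. 32. Discrete $q$-Hermite II: $\tilde h_n(x)=i^{-n}q^{-\binom n2}{}_2\phi_0(q^{-n},ix;-;-q^n)$. **A. Inversion.** For each family, $B_n=\sum_{m=0}^nI_m(n)P_m$ (where $P_m$ is the family's polynomial of degree $m$) with the following $B_n$ and $I_m(n)$. 1. $(ae^{i\theta},ae^{-i\theta};q)_n$: $\ \epsilon_{n,m}a^m\frac{(abq^m,acq^m,adq^m;q)_{n-m}}{(abcdq^{m-1};q)_m(abcdq^{2m};q)_{n-m}}$.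 2. $(q^{-x},\gamma\delta q^{x+1};q)_n$: $\ \epsilon_{n,m}\frac{(\alpha q,\beta\delta q,\gamma q;q)_n}{(\alpha\beta q^{m+1};q)_m(\alpha\beta q^{2m+2};q)_{n-m}}$. 3. $(ae^{i\theta},ae^{-i\theta};q)_n$: $\ \epsilon_{n,m}a^m(abq^m,acq^m;q)_{n-m}$. 4. $(ae^{i(\theta+2\varphi)},ae^{-i\theta};q)_n$: $\ \epsilon_{n,m}(ae^{i\varphi})^m\frac{(abe^{2i\varphi}q^m,acq^m,adq^m;q)_{n-m}}{(abcdq^{m-1};q)_m(abcdq^{2m};q)_{n-m}}$. 5. $(x;q)_n$: $\ \epsilon_{n,m}\frac{(aq,cq;q)_n}{(abq^{m+1};q)_m(abq^{2m+2};q)_{n-m}}$. 6. $(y;q)_n$: $\ \epsilon_{n,m}\frac{(q^{-N},\alpha q;q)_n}{(\alpha\beta q^{m+1};q)_m(\alpha\beta q^{2m+2};q)_{n-m}}$. 7. $(q^{-x},\gamma\delta q^{x+1};q)_n$: $\ \epsilon_{n,m}(\gamma q,q^{-N};q)_n$. 8. $(ae^{i\theta},ae^{-i\theta};q)_n$: $\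 \epsilon_{n,m}a^m(abq^m;q)_{n-m}$. 9. $(ae^{i(\theta+2\varphi)},ae^{-i\theta};q)_n$: $\ \epsilon_{n,m}(ae^{i\varphi})^m(a^2q^m;q)_{n-m}(q;q)_m$. 10. $(q^{\frac\alpha2+\frac14}e^{i\theta},q^{\frac\alpha2+\frac14}e^{-i\theta};q)_n$: $\ \epsilon_{n,m}(-q^{\frac{\alpha+\beta+1}2},-q^{\frac{\alpha+\beta+2}2};q)_n\frac{(q;q)_m(q^{\alpha+m+1};q)_{n-m}}{(q^{m+\alpha+\beta+1};q)_m(q^{2m+\alpha+\beta+2};q)_{n-m}}$. 11. $(\beta^{1/2}e^{i\theta},\beta^{1/2}e^{-i\theta};q)_n$: $\ \epsilon_{n,m}\beta^{m/2}\frac{(\beta q^{1/2},-\beta,-\beta q^{1/2};q)_n(q;q)_m}{(\beta^2q^m;q)_m(\beta^2;q)_m(\beta^2q^{2m+1};q)_{n-m}}$. 12. $(q^{1/4}e^{i\theta},q^{1/4}e^{-i\theta};q)_n$: $\ \epsilon_{n,m}\frac{(q,-q^{1/2},-q;q)_n}{(q^{m+1};q)_m(q^{2m+2};q)_{n-m}}$.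 13. $(x;q)_n$: $\ \epsilon_{n,m}(aq,bq;q)_n$. 14. $x^n$: $\ \epsilon_{n,m}\frac{(aq;q)_n}{(abq^{m+1};q)_m(abq^{2m+2};q)_{n-m}}$. 15. $x^n$: $\ \epsilon_{n,m}\frac{(q;q)_n}{(q^{m+1};q)_m(q^{2m+2};q)_{n-m}}$. 16. $(y;q)_n$: $\ \epsilon_{n,m}(-c)^n(bq;q)_nq^{-mn+m-n}$. 17. $(y;q)_n$: $\ \epsilon_{n,m}p^{-n}(q^{-N};q)_nq^{-mn+m-n}$. 18. $(y;q)_n$: $\ \epsilon_{n,m}\frac{(q^{-N};q)_n}{(-pq^m;q)_m(-pq^{2m+1};q)_{n-m}}$. 19. $(y;q)_n$: $\ \epsilon_{n,m}(pq,q^{-N};q)_n$. 20. $(q^{-x},cq^{x-N};q)_n$: $\ \epsilon_{n,m}(q^{-N};q)_n$. 21. $(ae^{i\theta},ae^{-i\theta};q)_n$: $\ \epsilon_{n,m}a^m$. 22. $(q^{\frac\alpha2+\frac14}e^{i\theta},q^{\frac\alpha2+\frac14}e^{-i\theta};q)_n$: $\ \epsilon_{n,m}(q;q)_m(q^{m+\alpha+1};q)_{n-m}$.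 23. $x^n$: $\ \epsilon_{n,m}(aq;q)_n$. 24. $x^n$: $\ \epsilon_{n,m}q^{-n(\alpha+m)-\binom n2+m-n}(q;q)_m(q^{\alpha+m+1};q)_{n-m}$. 25. $x^n$: $\ \epsilon_{n,m}\frac1{(-aq^m;q)_m(-aq^{2m+1};q)_{n-m}}$. 26. $(y;q)_n$: $\ \epsilon_{n,m}(-a)^nq^{-nm+m-n}$. 27. $x^n(x^{-1};q)_n$: $\ a^{n-m}\begin{bmatrix}n\\m\end{bmatrix}_q$. 28. $(x;q)_n$: $\ (-1)^na^{n-m}q^{\binom n2+m(m-n)}\begin{bmatrix}n\\m\end{bmatrix}_q$. 29. $e^{-2in\theta}$: $\ \epsilon_{n,m}(-1)^ne^{-im\theta}q^{\binom n2+m(1-n)}$. 30. $x^n$: $\ \epsilon_{n,m}(q;q)_mq^{-\binom n2-nm+m-n}$. 31. $x^n(x^{-1};q)_n$: $\ (-1)^{m+n}\begin{bmatrix}n\\m\end{bmatrix}_q$. 32. $(ix;q)_n$: $\ (-i)^mq^{\binom n2+m(m-n)}\begin{bmatrix}n\\m\end{bmatrix}_q$. **B. Connection.** In the following cases $P_n=\sum_{m=0}^nC_m(n)\,Q_m$,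 where $P_n$ and $Q_m$ belong to the same family (and, where $\theta$, $\varphi$ or $x$ occurs, are taken at the same point) with the parameters indicated. 1. Askey–Wilson, $(a,b,c,d)\to(a,\beta,\gamma,\delta)$: $\frac{a^{m-n}q^{m(m-n)}}{(q;q)_{n-m}}\frac{(ab,ac,ad,q;q)_n(abcdq^{n-1};q)_m}{(ab,ac,ad,q;q)_m(a\beta\gamma\delta q^{m-1};q)_m}\,{}_5\phi_4(q^{m-n},a\beta q^m,a\gamma q^m,a\delta q^m,abcdq^{n+m-1};abq^m,acq^m,adq^m,a\beta\gamma\delta q^{2m};q)$. 2. $q$-Racah, $(\alpha,\beta,\gamma,\delta)\to(a,b,c,d)$ with $\gamma\delta=cd$: $\kappa_{n,m}\frac{(\alpha\beta q^{n+1},aq,bdq,cq;q)_m}{(\alpha q,\beta\delta q,\gamma q,abq^{m+1};q)_m}\,{}_5\phi_4(q^{m-n},\alpha\beta q^{m+n+1},aq^{m+1},bdq^{m+1},cq^{m+1};\alpha q^{m+1},\beta\delta q^{m+1},abq^{2m+2},\gamma q^{m+1};q)$. 3. Continuous dual $q$-Hahn, $(a,b,c)\to(a,\beta,\gamma)$: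 $\kappa_{n,m}a^{m-n}(abq^m,acq^m;q)_{n-m}\,{}_3\phi_2(q^{m-n},a\beta q^m,a\gamma q^m;abq^m,acq^m;q)$. 4. Continuous $q$-Hahn, $(a,b,c,d)\to(a,\beta,\gamma,\delta)$: $\kappa_{n,m}(ae^{i\varphi})^{m-n}\frac{(abe^{2i\varphi},ac,ad;q)_n(abcdq^{n-1};q)_m}{(abe^{2i\varphi},ac,ad;q)_m(a\beta\gamma\delta q^{m-1};q)_m}\,{}_5\phi_4(q^{m-n},abcdq^{m+n-1},a\beta e^{2i\varphi}q^m,a\gamma q^m,a\delta q^m;abe^{2i\varphi}q^m,acq^m,adq^m,a\beta\gamma\delta q^{2m};q)$. 5. Big $q$-Jacobi, $(a,b,c)\to(\alpha,\beta,\gamma)$: $\kappa_{n,m}\frac{(abq^{n+1},\alpha q,\gamma q;q)_m}{(aq,cq,\alpha\beta q^{m+1};q)_m}\,{}_4\phi_3(q^{m-n},abq^{m+n+1},\alpha q^{m+1},\gamma q^{m+1};aq^{m+1},cq^{m+1},\alpha\beta q^{2m+2};q)$. 6. $q$-Hahn, $(\alpha,\beta,N)\to(\alpha_1,\beta_1,N_1)$: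 $\kappa_{n,m}\frac{(\alpha\beta q^{n+1},q^{-N_1},\alpha_1q;q)_m}{(\alpha q,q^{-N},\alpha_1\beta_1q^{m+1};q)_m}\,{}_4\phi_3(q^{m-n},\alpha\beta q^{n+m+1},q^{m-N_1},\alpha_1q^{m+1};\alpha q^{m+1},q^{m-N},\alpha_1\beta_1q^{2m+2};q)$. 7. Dual $q$-Hahn, $(\gamma,\delta,N)\to(\gamma_1,\delta_1,N_1)$ with $\gamma\delta=\gamma_1\delta_1$: $\kappa_{n,m}\frac{(\gamma_1q,q^{-N_1};q)_m}{(\gamma q,q^{-N};q)_m}\,{}_3\phi_2(q^{m-n},\gamma_1q^{m+1},q^{m-N_1};\gamma q^{m+1},q^{m-N};q)$. 8. Al-Salam–Chihara, $(a,b)\to(a,\beta)$: $\begin{bmatrix}n\\m\end{bmatrix}_q\beta^{n-m}(b/\beta;q)_{n-m}$. 9. Continuous $q$-Jacobi, $(\alpha,\beta)\to(\alpha,\beta_1)$, with $\nu=\alpha+\beta+1$, $\lambda=\alpha+\beta_1+1$: $\frac{q^{m(m-n)}(q^{\alpha+1};q)_n(q^{\nu+n},-q^{\lambda/2},-q^{(\lambda+1)/2};q)_m}{(q;q)_{n-m}(q^{\lambda+m};q)_m(q^{\alpha+1},-q^{\nu/2},-q^{(\nu+1)/2};q)_m}\,{}_5\phi_4(q^{m-n},q^{m+n+\nu},-q^{\frac\lambda2+m},-q^{\frac{\lambda+1}2+m},q^{\alpha+m+1};q^{\alpha+m+1},-q^{\frac\nu2+m},-q^{\frac{\nu+1}2+m},q^{2m+\lambda+1};q)$.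 10. Big $q$-Laguerre, $(a,b)\to(\alpha,\beta)$: $\kappa_{n,m}\frac{(\alpha q,\beta q;q)_m}{(aq,bq;q)_m}\,{}_3\phi_2(q^{m-n},\alpha q^{m+1},\beta q^{m+1};aq^{m+1},bq^{m+1};q)$. 11. Little $q$-Jacobi, $(a,b)\to(\alpha,\beta)$: $\kappa_{n,m}\frac{(abq^{n+1},\alpha q;q)_m}{(aq,\alpha\beta q^{m+1};q)_m}\,{}_3\phi_2(q^{m-n},abq^{m+n+1},\alpha q^{m+1};aq^{m+1},\alpha\beta q^{2m+2};q)$. 12. $q$-Meixner, $(b,c)\to(\beta,\gamma)$: $\begin{bmatrix}n\\m\end{bmatrix}_q\left(\frac\gamma c\right)^m\frac{(\beta q;q)_m}{(bq;q)_m}\,{}_2\phi_1(q^{m-n},\beta q^{m+1};bq^{m+1};\tfrac\gamma cq^{n-m})$. 13. Quantum $q$-Krawtchouk, $(p,N)\to(p_1,N_1)$: $\begin{bmatrix}n\\m\end{bmatrix}_q\left(\frac p{p_1}\right)^m\frac{(q^{-N_1};q)_m}{(q^{-N};q)_m}\,{}_2\phi_1(q^{m-n},q^{m-N_1};q^{m-N};\tfrac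 p{p_1}q^{n-m})$. 14. $q$-Krawtchouk, $(p,N)\to(p_1,N_1)$: $\kappa_{n,m}\frac{(-pq^n,q^{-N_1};q)_m}{(-p_1q^m,q^{-N};q)_m}\,{}_3\phi_2(q^{m-n},-pq^{m+n},q^{m-N_1};q^{m-N},-p_1q^{2m+1};q)$. 15. Little $q$-Laguerre, $a\to\alpha$: $\begin{bmatrix}n\\m\end{bmatrix}_q(\alpha q)^{n-m}\frac{(\alpha q;q)_m}{(aq;q)_n}\left(\frac a\alpha;q\right)_{n-m}$. 16. $q$-Laguerre, $\alpha\to\beta$: $\frac{q^{m(\alpha-\beta)}(q^{\alpha+m+1};q)_{n-m}}{(q;q)_{n-m}}\,{}_2\phi_1(q^{m-n},q^{\beta+m+1};q^{\alpha+m+1};q^{n-m+\alpha-\beta})$. 17. Alternative $q$-Charlier, $a\to\alpha$: $\begin{bmatrix}n\\m\end{bmatrix}_q\frac{(-aq^n;q)_m}{(-\alpha q^m;q)_n}\frac{1+\alpha q^{2m}}{1+\alpha q^{m+n}}\left(\frac\alpha aq^{m-n+1};q\right)_{n-m}(-aq^n)^{n-m}$. 18. $q$-Charlier, $a\to\alpha$: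 $\begin{bmatrix}n\\m\end{bmatrix}_q\left(\frac\alpha a;q\right)_{n-m}\left(\frac\alpha a\right)^m$. 19. Al-Salam–Carlitz I, $a\to\alpha$: $\begin{bmatrix}n\\m\end{bmatrix}_q(-a)^{n-m}q^{\binom n2+\binom m2+m-nm}\left(\frac\alpha aq^{m-n+1};q\right)_{n-m}$. 20. Al-Salam–Carlitz II, $a\to\alpha$: $\begin{bmatrix}n\\m\end{bmatrix}_q(-a)^{n-m}q^{\binom m2-\binom n2}\left(\frac\alpha a;q\right)_{n-m}$. -/

import Mathlib

/-! Basic hypergeometric series and the polynomial families of the q-Askey scheme. -/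

/-- The `q`-shifted factorial `(x; q)_n = ∏_{k < n} (1 - x q ^ k)`. -/
noncomputable def qPoch (x q : ℂ) (n : ℕ) : ℂ :=
  ∏ k ∈ Finset.range n, (1 - x * q ^ k)

/-- The product `(x_1, …, x_r; q)_n = (x_1; q)_n ⋯ (x_r; q)_n`. -/
noncomputable def qPochs (xs : List ℂ) (q : ℂ) (n : ℕ) : ℂ :=
  (xs.map fun x => qPoch x q n).prod

/-- The `q`-binomial coefficient (used for `m ≤ n`). -/
noncomputable def qBinom (q : ℂ) (n m : ℕ) : ℂ :=
  qPoch q q n / (qPoch q q m * qPoch q q (n - m))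

/-- The basic hypergeometric series `_rφ_s(as; bs; q; z)`, where `r` and `s` are the lengths of
the two lists. Wherever it is used below, one of the numerator parameters is `q ^ (-n)` with
`n : ℕ` and no `(b; q)_k` with `k ≤ n` vanishes, so the series terminates: all terms of index
`> n` are zero. -/
noncomputable def qHyp (as bs : List ℂ) (q z : ℂ) : ℂ :=
  ∑' k : ℕ, qPochs as q k / qPochs bs q k
    * ((-1) ^ k * q ^ (k.choose 2)) ^ (1 + (bs.length : ℤ) - (as.length : ℤ))
    * (z ^ k / qPoch q q k)

/-- `e^{iθ}`. The variable `θ` is complex, so `cos θ` takes every complex value. -/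
noncomputable def expI (θ : ℂ) : ℂ := Complex.exp (Complex.I * θ)

/-- Askey–Wilson polynomial, `x = cos θ`. -/
noncomputable def askeyWilson (q a b c d : ℂ) (n : ℕ) (θ : ℂ) : ℂ :=
  qPochs [a * b, a * c, a * d] q n / a ^ n
    * qHyp [q ^ (-(n : ℤ)), a * b * c * d * q ^ ((n : ℤ) - 1), a * expI θ, a * expI (-θ)]
        [a * b, a * c, a * d] q q

/-- `q`-Racah polynomial, a polynomial in `q ^ (-x) + γ δ q ^ (x + 1)`. -/
noncomputable def qRacah (q α β γ δ : ℂ) (n : ℕ) (x : ℂ) : ℂ :=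
  qHyp [q ^ (-(n : ℤ)), α * β * q ^ (n + 1), q ^ (-x), γ * δ * q ^ (x + 1)]
    [α * q, β * δ * q, γ * q] q q

/-- Continuous dual `q`-Hahn polynomial, `x = cos θ`. -/
noncomputable def contDualQHahn (q a b c : ℂ) (n : ℕ) (θ : ℂ) : ℂ :=
  qPochs [a * b, a * c] q n / a ^ n
    * qHyp [q ^ (-(n : ℤ)), a * expI θ, a * expI (-θ)] [a * b, a * c] q q

/-- Continuous `q`-Hahn polynomial, `x = cos (θ + φ)`. -/
noncomputable def contQHahn (q φ a b c d : ℂ) (n : ℕ) (θ : ℂ) : ℂ :=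
  qPochs [a * b * expI (2 * φ), a * c, a * d] q n / (a * expI φ) ^ n
    * qHyp [q ^ (-(n : ℤ)), a * b * c * d * q ^ ((n : ℤ) - 1), a * expI (θ + 2 * φ), a * expI (-θ)]
        [a * b * expI (2 * φ), a * c, a * d] q q

/-- Big `q`-Jacobi polynomial. -/
noncomputable def bigQJacobi (q a b c : ℂ) (n : ℕ) (x : ℂ) : ℂ :=
  qHyp [q ^ (-(n : ℤ)), a * b * q ^ (n + 1), x] [a * q, c * q] q q

/-- `q`-Hahn polynomial of degree `n ≤ N`, in the variable `y = q ^ (-x)`. -/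
noncomputable def qHahn (q α β : ℂ) (N n : ℕ) (y : ℂ) : ℂ :=
  qHyp [q ^ (-(n : ℤ)), α * β * q ^ (n + 1), y] [α * q, q ^ (-(N : ℤ))] q q

/-- Dual `q`-Hahn polynomial of degree `n ≤ N`, a polynomial in `q ^ (-x) + γ δ q ^ (x + 1)`. -/
noncomputable def dualQHahn (q γ δ : ℂ) (N n : ℕ) (x : ℂ) : ℂ :=
  qHyp [q ^ (-(n : ℤ)), q ^ (-x), γ * δ * q ^ (x + 1)] [γ * q, q ^ (-(N : ℤ))] q q

/-- Al-Salam–Chihara polynomial, `x = cos θ`. -/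
noncomputable def alSalamChihara (q a b : ℂ) (n : ℕ) (θ : ℂ) : ℂ :=
  qPoch (a * b) q n / a ^ n
    * qHyp [q ^ (-(n : ℤ)), a * expI θ, a * expI (-θ)] [a * b, 0] q q

/-- `q`-Meixner–Pollaczek polynomial, `x = cos (θ + φ)`. -/
noncomputable def qMeixnerPollaczek (q φ a : ℂ) (n : ℕ) (θ : ℂ) : ℂ :=
  qPoch (a ^ 2) q n / ((a * expI φ) ^ n * qPoch q q n)
    * qHyp [q ^ (-(n : ℤ)), a * expI (θ + 2 * φ), a * expI (-θ)] [a ^ 2, 0] q q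

/-- Continuous `q`-Jacobi polynomial, `x = cos θ`. -/
noncomputable def contQJacobi (q α β : ℂ) (n : ℕ) (θ : ℂ) : ℂ :=
  qPoch (q ^ (α + 1)) q n / qPoch q q n
    * qHyp [q ^ (-(n : ℤ)), q ^ (n + α + β + 1),
          q ^ (α / 2 + 1 / 4) * expI θ, q ^ (α / 2 + 1 / 4) * expI (-θ)]
        [q ^ (α + 1), -q ^ ((α + β + 1) / 2), -q ^ ((α + β + 2) / 2)] q q

/-- Continuous `q`-ultraspherical (Rogers) polynomial, `x = cos θ`. -/
noncomputable def rogers (q β : ℂ) (n : ℕ) (θ : ℂ) : ℂ :=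
  qPoch (β ^ 2) q n / qPoch q q n * β ^ (-(n : ℂ) / 2)
    * qHyp [q ^ (-(n : ℤ)), β ^ 2 * q ^ n,
          β ^ (1 / 2 : ℂ) * expI θ, β ^ (1 / 2 : ℂ) * expI (-θ)]
        [β * q ^ (1 / 2 : ℂ), -β, -(β * q ^ (1 / 2 : ℂ))] q q

/-- Continuous `q`-Legendre polynomial, `x = cos θ`. -/
noncomputable def contQLegendre (q : ℂ) (n : ℕ) (θ : ℂ) : ℂ :=
  qHyp [q ^ (-(n : ℤ)), q ^ (n + 1),
      q ^ (1 / 4 : ℂ) * expI θ, q ^ (1 / 4 : ℂ) * expI (-θ)]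
    [q, -q ^ (1 / 2 : ℂ), -q] q q

/-- Big `q`-Laguerre polynomial. -/
noncomputable def bigQLaguerre (q a b : ℂ) (n : ℕ) (x : ℂ) : ℂ :=
  qHyp [q ^ (-(n : ℤ)), 0, x] [a * q, b * q] q q

/-- Little `q`-Jacobi polynomial. -/
noncomputable def littleQJacobi (q a b : ℂ) (n : ℕ) (x : ℂ) : ℂ :=
  qHyp [q ^ (-(n : ℤ)), a * b * q ^ (n + 1)] [a * q] q (q * x)

/-- Little `q`-Legendre polynomial. -/
noncomputable def littleQLegendre (q : ℂ) (n : ℕ) (x : ℂ) : ℂ :=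
  qHyp [q ^ (-(n : ℤ)), q ^ (n + 1)] [q] q (q * x)

/-- `q`-Meixner polynomial, in the variable `y = q ^ (-x)`. -/
noncomputable def qMeixner (q b c : ℂ) (n : ℕ) (y : ℂ) : ℂ :=
  qHyp [q ^ (-(n : ℤ)), y] [b * q] q (-q ^ (n + 1) / c)

/-- Quantum `q`-Krawtchouk polynomial of degree `n ≤ N`, in the variable `y = q ^ (-x)`. -/
noncomputable def quantumQKrawtchouk (q p : ℂ) (N n : ℕ) (y : ℂ) : ℂ :=
  qHyp [q ^ (-(n : ℤ)), y] [q ^ (-(N : ℤ))] q (p * q ^ (n + 1))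

/-- `q`-Krawtchouk polynomial of degree `n ≤ N`, in the variable `y = q ^ (-x)`. -/
noncomputable def qKrawtchouk (q p : ℂ) (N n : ℕ) (y : ℂ) : ℂ :=
  qHyp [q ^ (-(n : ℤ)), y, -(p * q ^ n)] [q ^ (-(N : ℤ)), 0] q q

/-- Affine `q`-Krawtchouk polynomial of degree `n ≤ N`, in the variable `y = q ^ (-x)`. -/
noncomputable def affineQKrawtchouk (q p : ℂ) (N n : ℕ) (y : ℂ) : ℂ :=
  qHyp [q ^ (-(n : ℤ)), 0, y] [p * q, q ^ (-(N : ℤ))] q q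

/-- Dual `q`-Krawtchouk polynomial of degree `n ≤ N`, a polynomial in
`q ^ (-x) + c q ^ (x - N)`. -/
noncomputable def dualQKrawtchouk (q c : ℂ) (N n : ℕ) (x : ℂ) : ℂ :=
  qHyp [q ^ (-(n : ℤ)), q ^ (-x), c * q ^ (x - N)] [q ^ (-(N : ℤ)), 0] q q

/-- Continuous big `q`-Hermite polynomial, `x = cos θ`. -/
noncomputable def contBigQHermite (q a : ℂ) (n : ℕ) (θ : ℂ) : ℂ :=
  1 / a ^ n * qHyp [q ^ (-(n : ℤ)), a * expI θ, a * expI (-θ)] [0, 0] q q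

/-- Continuous `q`-Laguerre polynomial, `x = cos θ`. -/
noncomputable def contQLaguerre (q α : ℂ) (n : ℕ) (θ : ℂ) : ℂ :=
  qPoch (q ^ (α + 1)) q n / qPoch q q n
    * qHyp [q ^ (-(n : ℤ)), q ^ (α / 2 + 1 / 4) * expI θ, q ^ (α / 2 + 1 / 4) * expI (-θ)]
        [q ^ (α + 1), 0] q q

/-- Little `q`-Laguerre (Wall) polynomial. -/
noncomputable def littleQLaguerre (q a : ℂ) (n : ℕ) (x : ℂ) : ℂ :=
  qHyp [q ^ (-(n : ℤ)), 0] [a * q] q (q * x)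

/-- `q`-Laguerre polynomial. -/
noncomputable def qLaguerre (q α : ℂ) (n : ℕ) (x : ℂ) : ℂ :=
  qPoch (q ^ (α + 1)) q n / qPoch q q n
    * qHyp [q ^ (-(n : ℤ))] [q ^ (α + 1)] q (-q ^ (n + α + 1) * x)

/-- Alternative `q`-Charlier (also called `q`-Bessel) polynomial. -/
noncomputable def altQCharlier (q a : ℂ) (n : ℕ) (x : ℂ) : ℂ :=
  qHyp [q ^ (-(n : ℤ)), -(a * q ^ n)] [0] q (q * x)

/-- `q`-Charlier polynomial, in the variable `y = q ^ (-x)`. -/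
noncomputable def qCharlier (q a : ℂ) (n : ℕ) (y : ℂ) : ℂ :=
  qHyp [q ^ (-(n : ℤ)), y] [0] q (-q ^ (n + 1) / a)

/-- Al-Salam–Carlitz I polynomial (`x ≠ 0`). -/
noncomputable def alSalamCarlitzI (q a : ℂ) (n : ℕ) (x : ℂ) : ℂ :=
  (-a) ^ n * q ^ (n.choose 2) * qHyp [q ^ (-(n : ℤ)), x⁻¹] [0] q (q * x / a)

/-- Al-Salam–Carlitz II polynomial. -/
noncomputable def alSalamCarlitzII (q a : ℂ) (n : ℕ) (x : ℂ) : ℂ :=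
  (-a) ^ n / q ^ (n.choose 2) * qHyp [q ^ (-(n : ℤ)), x] [] q (q ^ n / a)

/-- Continuous `q`-Hermite polynomial, `x = cos θ`. -/
noncomputable def contQHermite (q : ℂ) (n : ℕ) (θ : ℂ) : ℂ :=
  expI (n * θ) * qHyp [q ^ (-(n : ℤ)), 0] [] q (q ^ n * expI (-2 * θ))

/-- Stieltjes–Wigert polynomial. -/
noncomputable def stieltjesWigert (q : ℂ) (n : ℕ) (x : ℂ) : ℂ :=
  1 / qPoch q q n * qHyp [q ^ (-(n : ℤ))] [0] q (-q ^ (n + 1) * x)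

/-- Discrete `q`-Hermite I polynomial (`x ≠ 0`). -/
noncomputable def discreteQHermiteI (q : ℂ) (n : ℕ) (x : ℂ) : ℂ :=
  q ^ (n.choose 2) * qHyp [q ^ (-(n : ℤ)), x⁻¹] [0] q (-q * x)

/-- Discrete `q`-Hermite II polynomial. -/
noncomputable def discreteQHermiteII (q : ℂ) (n : ℕ) (x : ℂ) : ℂ :=
  1 / (Complex.I ^ n * q ^ (n.choose 2)) * qHyp [q ^ (-(n : ℤ)), Complex.I * x] [] q (-q ^ n)

/-!
Every family of the `q`-Askey scheme is, up to a normalizing factor, of one of two shapes: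

* `∑ (q⁻ⁿ, A qⁿ; q)_k / (q; q)_k q ^ k u_k` (`qJacobiSum`), with `A = 0` if `A qⁿ` is absent;
* `∑ (q⁻ⁿ; q)_k / (q; q)_k q ^ (n k) u_k` (`qMeixnerSum`).

Here `u_k` does not depend on `n`: it is the quotient `B_k / D_k` of the basis element in which the
polynomial is expanded and a product of shifted factorials of the parameters. For fixed `A` such a
sum is the image of the sequence `u` under a lower triangular matrix, and the inverse matrix is
explicit (`qJacobiCoeff`, `qMeixnerCoeff`). That the product of the two matrices in one order is the
identity is an instance of the terminating `q`-Chu–Vandermonde sum (`sum_qChuVandermonde`),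
respectively of the finite `q`-binomial theorem (`sum_qPoch_neg_mul_pow`); the other order follows
since a one-sided inverse of a triangular matrix with non-zero diagonal is two-sided
(`triangular_inversion`). This gives the inversion formulas (`qJacobiSum_inversion`,
`qMeixnerSum_inversion`).

For the connection formulas, two members of a family share the numerators `B_k`. Inserting the
inversion formula of the second into the expansion of the first, and interchanging the two sums,
gives the connection coefficient as a single sum over `j = k - m`, in which the product of the two
matrix entries splits into a factor that depends on `n` and `m` only and the general term of a
basic hypergeometric series (`qJacobi_mul_qJacobiCoeff`, `qMeixner_mul_qMeixnerCoeff`). In the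
families whose coefficients are in closed form this series is again summed by the
`q`-Chu–Vandermonde or the `q`-binomial theorem.

What remains for each family is to identify `A`, `u` and the normalization (the lemmas `…_eq`) and
to compare elementary factors.
-/

/-! ### Shifted factorials -/

theorem qPoch_zero_right (x q : ℂ) : qPoch x q 0 = 1 := by simp [qPoch]

theorem qPoch_zero_left (q : ℂ) (n : ℕ) : qPoch 0 q n = 1 := by simp [qPoch]

theorem qPoch_succ (x q : ℂ) (n : ℕ) : qPoch x q (n + 1) = qPoch x q n * (1 - x * q ^ n) := by
  simp [qPoch, Finset.prod_range_succ]

theorem qPoch_add (x q : ℂ) (m j : ℕ) :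
    qPoch x q (m + j) = qPoch x q m * qPoch (x * q ^ m) q j := by
  simp only [qPoch, Finset.prod_range_add, pow_add, mul_assoc]

theorem qPoch_succ' (x q : ℂ) (n : ℕ) : qPoch x q (n + 1) = (1 - x) * qPoch (x * q) q n := by
  rw [add_comm, qPoch_add]
  simp [qPoch]

theorem qPoch_ne_zero_iff {x q : ℂ} {n : ℕ} : qPoch x q n ≠ 0 ↔ ∀ k < n, x * q ^ k ≠ 1 := by
  simp only [qPoch, Finset.prod_ne_zero_iff, Finset.mem_range, sub_ne_zero]
  exact forall₂_congr fun k _ => ne_comm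

theorem qPochs_nil (q : ℂ) (n : ℕ) : qPochs [] q n = 1 := by simp [qPochs]

theorem qPochs_cons (x : ℂ) (xs : List ℂ) (q : ℂ) (n : ℕ) :
    qPochs (x :: xs) q n = qPoch x q n * qPochs xs q n := by simp [qPochs]

theorem qPochs_add (xs : List ℂ) (q : ℂ) (m j : ℕ) :
    qPochs xs q (m + j) = qPochs xs q m * qPochs (xs.map (· * q ^ m)) q j := by
  induction xs with
  | nil => simp [qPochs_nil]
  | cons x xs ih => rw [List.map_cons, qPochs_cons, qPochs_cons, qPochs_cons, ih, qPoch_add]; ring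

theorem qPochs_split (xs : List ℂ) (q : ℂ) {m n : ℕ} (h : m ≤ n) :
    qPochs xs q n = qPochs xs q m * qPochs (xs.map (· * q ^ m)) q (n - m) := by
  rw [← qPochs_add, Nat.add_sub_cancel' h]

theorem qPoch_split (x q : ℂ) {m n : ℕ} (h : m ≤ n) :
    qPoch x q n = qPoch x q m * qPoch (x * q ^ m) q (n - m) := by
  rw [← qPoch_add, Nat.add_sub_cancel' h]

theorem qPochs_ne_zero_of_le {xs : List ℂ} {q : ℂ} {m n : ℕ} (h : qPochs xs q n ≠ 0)
    (hm : m ≤ n) : qPochs xs q m ≠ 0 := by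
  rw [qPochs_split xs q hm] at h
  exact left_ne_zero_of_mul h

theorem qPoch_ne_zero_of_le {x q : ℂ} {m n : ℕ} (h : qPoch x q n ≠ 0)
    (hm : m ≤ n) : qPoch x q m ≠ 0 := by
  rw [qPoch_split x q hm] at h
  exact left_ne_zero_of_mul h

section QSeries

variable {q : ℂ}

theorem qPoch_self_ne_zero (hq : ∀ k : ℕ, 0 < k → q ^ k ≠ 1) (n : ℕ) : qPoch q q n ≠ 0 :=
  qPoch_ne_zero_iff.2 fun k _ => by
    rw [← pow_succ']
    exact hq _ k.succ_pos

theorem qPoch_neg_eq_zero (hq0 : q ≠ 0) {n k : ℕ} (h : n < k) :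
    qPoch (q ^ (-(n : ℤ))) q k = 0 :=
  Finset.prod_eq_zero (Finset.mem_range.2 h) (by simp [hq0])

theorem qPoch_neg_ne_zero (hq0 : q ≠ 0) (hq : ∀ k : ℕ, 0 < k → q ^ k ≠ 1) {n N : ℕ}
    (h : n ≤ N) : qPoch (q ^ (-(N : ℤ))) q n ≠ 0 :=
  qPoch_ne_zero_iff.2 fun k hk heq => hq (N - k) (by omega) <| by
    rw [zpow_neg, zpow_natCast, inv_mul_eq_one₀ (pow_ne_zero _ hq0)] at heq
    exact mul_right_cancel₀ (pow_ne_zero k hq0)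
      (by rw [one_mul, ← pow_add, Nat.sub_add_cancel (by omega), heq])

/-! ### Terminating summation formulas -/

/-- `(q⁻ⁿ; q)_k` is a `q`-binomial coefficient up to elementary factors. -/
theorem qPoch_neg_eq (hq0 : q ≠ 0) (hq : ∀ k : ℕ, 0 < k → q ^ k ≠ 1) {n k : ℕ} (h : k ≤ n) :
    qPoch (q ^ (-(n : ℤ))) q k / qPoch q q k * q ^ (n * k)
      = (-1) ^ k * q ^ k.choose 2 * qBinom q n k := by
  induction k with
  | zero => simp [qPoch_zero_right, qBinom, qPoch_self_ne_zero hq]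
  | succ k ih =>
    have ih := ih (by omega)
    obtain ⟨i, rfl⟩ : ∃ i, n = k + 1 + i := ⟨_, (Nat.add_sub_cancel' h).symm⟩
    have e1 : k + 1 + i - k = i + 1 := by omega
    have e2 : k + 1 + i - (k + 1) = i := by omega
    have hi := qPoch_self_ne_zero hq i
    have hk := qPoch_self_ne_zero hq k
    have hi1 := qPoch_self_ne_zero hq (i + 1)
    have hk1 := qPoch_self_ne_zero hq (k + 1)
    rw [qBinom, e1] at ih
    rw [qBinom, e2]
    rw [qPoch_succ] at hi1 hk1 ⊢
    rw [qPoch_succ q q i] at ih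
    have hi2 := right_ne_zero_of_mul hi1
    have hk2 := right_ne_zero_of_mul hk1
    have e3 : (1 - q ^ (-((k + 1 + i : ℕ) : ℤ)) * q ^ k) * q ^ (k + 1 + i)
        = -q ^ k * (1 - q * q ^ i) := by
      rw [zpow_neg, zpow_natCast]
      field_simp
      ring
    rw [qPoch_succ q q k, Nat.choose_succ_succ' k 1, Nat.choose_one_right, pow_add q k, pow_succ,
      mul_add_one (k + 1 + i), pow_add q ((k + 1 + i) * k)]
    calc _ = qPoch (q ^ (-((k + 1 + i : ℕ) : ℤ))) q k / qPoch q q k * q ^ ((k + 1 + i) * k)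
          * ((1 - q ^ (-((k + 1 + i : ℕ) : ℤ)) * q ^ k) * q ^ (k + 1 + i)) / (1 - q * q ^ k) := by
          field_simp
      _ = _ := by
          rw [e3, ih]
          field_simp

/-- The difference equation of `n ↦ (q⁻ⁿ; q)_j / (q; q)_j`. -/
theorem qPoch_neg_succ_sub (hq0 : q ≠ 0) (hq : ∀ k : ℕ, 0 < k → q ^ k ≠ 1) (N j : ℕ) :
    qPoch (q ^ (-((N + 1 : ℕ) : ℤ))) q (j + 1) / qPoch q q (j + 1)
      = qPoch (q ^ (-(N : ℤ))) q (j + 1) / qPoch q q (j + 1)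
        - (q ^ (N + 1))⁻¹ * (qPoch (q ^ (-(N : ℤ))) q j / qPoch q q j) := by
  have h1 := qPoch_self_ne_zero hq (j + 1)
  have e : q ^ (-((N + 1 : ℕ) : ℤ)) * q = q ^ (-(N : ℤ)) := by
    rw [← zpow_add_one₀ hq0]
    congr 1
    push_cast
    ring
  have e2 : q ^ (-((N + 1 : ℕ) : ℤ)) = (q ^ (N + 1))⁻¹ := by rw [zpow_neg, zpow_natCast]
  have e3 : q ^ (-(N : ℤ)) = (q ^ N)⁻¹ := by rw [zpow_neg, zpow_natCast]
  rw [qPoch_succ' (q ^ (-((N + 1 : ℕ) : ℤ))), e, e2, qPoch_succ (q ^ (-(N : ℤ)))]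
  rw [qPoch_succ] at h1 ⊢
  have h2 := left_ne_zero_of_mul h1
  have h3 := right_ne_zero_of_mul h1
  rw [e3]
  field_simp
  ring

/-- A terminating `₁φ₀`: the finite `q`-binomial theorem. -/
theorem sum_qPoch_neg_mul_pow (hq0 : q ≠ 0) (hq : ∀ k : ℕ, 0 < k → q ^ k ≠ 1) (N : ℕ) (z : ℂ) :
    ∑ j ∈ Finset.range (N + 1), qPoch (q ^ (-(N : ℤ))) q j / qPoch q q j * z ^ j
      = qPoch (z * q ^ (-(N : ℤ))) q N := by
  induction N with
  | zero => simp [qPoch_zero_right]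
  | succ N ih =>
    have e : z * q ^ (-((N + 1 : ℕ) : ℤ)) * q = z * q ^ (-(N : ℤ)) := by
      rw [mul_assoc, ← zpow_add_one₀ hq0]
      congr 2
      push_cast
      ring
    have e2 : q ^ (-((N + 1 : ℕ) : ℤ)) = (q ^ (N + 1))⁻¹ := by rw [zpow_neg, zpow_natCast]
    rw [qPoch_succ', e, ← ih, Finset.sum_range_succ', e2]
    have h : ∑ j ∈ Finset.range (N + 1),
          qPoch (q ^ (-(N : ℤ))) q (j + 1) / qPoch q q (j + 1) * z ^ (j + 1) + 1
        = ∑ j ∈ Finset.range (N + 1), qPoch (q ^ (-(N : ℤ))) q j / qPoch q q j * z ^ j := by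
      have := Finset.sum_range_succ'
        (fun j => qPoch (q ^ (-(N : ℤ))) q j / qPoch q q j * z ^ j) (N + 1)
      rw [Finset.sum_range_succ, qPoch_neg_eq_zero hq0 N.lt_succ_self] at this
      simpa [qPoch_zero_right] using this.symm
    simp only [← e2, qPoch_neg_succ_sub hq0 hq, sub_mul, Finset.sum_sub_distrib, pow_zero,
      qPoch_zero_right]
    rw [← h, div_one, mul_one, sub_add_eq_add_sub, h, one_mul, Finset.mul_sum]
    congr 1
    exact Finset.sum_congr rfl fun j _ => by ring

/-- The `q`-Chu–Vandermonde sum `₂φ₁(q⁻ᴺ, B; C; q, q)`, with the numerator written as a product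
so that `B = 0` is allowed. The induction on `N` uses the difference equation above, which turns
the sum for `N + 1` into the sums for `N` with parameters `B, C` and `B q, C q`. -/
theorem sum_qChuVandermonde (hq0 : q ≠ 0) (hq : ∀ k : ℕ, 0 < k → q ^ k ≠ 1) (N : ℕ) (B C : ℂ)
    (hC : qPoch C q N ≠ 0) :
    ∑ j ∈ Finset.range (N + 1),
        qPoch (q ^ (-(N : ℤ))) q j / qPoch q q j * (qPoch B q j / qPoch C q j * q ^ j)
      = (∏ i ∈ Finset.range N, (B - C * q ^ i)) / qPoch C q N := by
  induction N generalizing B C with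
  | zero => simp [qPoch_zero_right]
  | succ N ih =>
    have hC1 : qPoch C q N ≠ 0 := qPoch_ne_zero_of_le hC N.le_succ
    have hC2 := hC
    rw [qPoch_succ'] at hC2
    have hC3 := right_ne_zero_of_mul hC2
    have hC4 := left_ne_zero_of_mul hC2
    have hC5 := hC
    rw [qPoch_succ] at hC5
    have hC6 := right_ne_zero_of_mul hC5
    have ih1 := ih B C hC1
    have ih2 := ih (B * q) (C * q) hC3
    have h : ∑ j ∈ Finset.range (N + 1), qPoch (q ^ (-(N : ℤ))) q (j + 1) / qPoch q q (j + 1)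
            * (qPoch B q (j + 1) / qPoch C q (j + 1) * q ^ (j + 1)) + 1
        = (∏ i ∈ Finset.range N, (B - C * q ^ i)) / qPoch C q N := by
      have := Finset.sum_range_succ' (fun j => qPoch (q ^ (-(N : ℤ))) q j / qPoch q q j
        * (qPoch B q j / qPoch C q j * q ^ j)) (N + 1)
      rw [Finset.sum_range_succ, qPoch_neg_eq_zero hq0 N.lt_succ_self, ih1] at this
      simpa [qPoch_zero_right] using this.symm
    have h' : ∑ j ∈ Finset.range (N + 1),
          (q ^ (N + 1))⁻¹ * (qPoch (q ^ (-(N : ℤ))) q j / qPoch q q j)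
            * (qPoch B q (j + 1) / qPoch C q (j + 1) * q ^ (j + 1))
        = (q ^ N)⁻¹ * ((1 - B) / (1 - C))
          * ((∏ i ∈ Finset.range N, (B * q - C * q * q ^ i)) / qPoch (C * q) q N) := by
      rw [← ih2, Finset.mul_sum]
      refine Finset.sum_congr rfl fun j _ => ?_
      rw [qPoch_succ', qPoch_succ' C, mul_div_mul_comm]
      field_simp
      ring
    have hp : ∏ i ∈ Finset.range N, (B * q - C * q * q ^ i)
        = q ^ N * ∏ i ∈ Finset.range N, (B - C * q ^ i) := by
      rw [← Finset.card_range N, ← Finset.prod_const, Finset.card_range, ← Finset.prod_mul_distrib]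
      exact Finset.prod_congr rfl fun i _ => by ring
    rw [Finset.sum_range_succ']
    simp only [qPoch_neg_succ_sub hq0 hq, sub_mul, Finset.sum_sub_distrib, pow_zero,
      qPoch_zero_right, div_one, mul_one]
    rw [sub_add_eq_add_sub, h, h', hp, Finset.prod_range_succ]
    have hs : qPoch C q N * (1 - C * q ^ N) = (1 - C) * qPoch (C * q) q N := by
      rw [← qPoch_succ, qPoch_succ']
    rw [qPoch_succ]
    calc _ = (∏ i ∈ Finset.range N, (B - C * q ^ i)) * (1 / qPoch C q N
            - (1 - B) / ((1 - C) * qPoch (C * q) q N)) := by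
          field_simp
      _ = _ := by
          rw [← hs]
          field_simp
          ring

/-! ### Inverse pairs of triangular matrices -/

/-- The sum `∑ (q⁻ⁿ, A qⁿ; q)_k / (q; q)_k q ^ k u_k`, in which the polynomials whose series has
argument proportional to `q` are expressed (with `A = 0` if `A qⁿ` is absent). -/
noncomputable def qJacobiSum (q A : ℂ) (u : ℕ → ℂ) (n : ℕ) : ℂ :=
  ∑ k ∈ Finset.range (n + 1),
    qPoch (q ^ (-(n : ℤ))) q k / qPoch q q k * (qPoch (A * q ^ n) q k * q ^ k * u k)

/-- The sum `∑ (q⁻ⁿ; q)_k / (q; q)_k q ^ (n k) u_k`, in which the polynomials whose series has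
argument proportional to `q ^ n` are expressed. -/
noncomputable def qMeixnerSum (q : ℂ) (u : ℕ → ℂ) (n : ℕ) : ℂ :=
  ∑ k ∈ Finset.range (n + 1),
    qPoch (q ^ (-(n : ℤ))) q k / qPoch q q k * ((q ^ n) ^ k * u k)

/-- The entries of the inverse of the triangular matrix that defines `qJacobiSum`. -/
noncomputable def qJacobiCoeff (q A : ℂ) (n m : ℕ) : ℂ :=
  (-1) ^ m * qBinom q n m * q ^ m.choose 2
    / (qPoch (A * q ^ m) q m * qPoch (A * q ^ (2 * m + 1)) q (n - m))

/-- The entries of the inverse of the triangular matrix that defines `qMeixnerSum`. -/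
noncomputable def qMeixnerCoeff (q : ℂ) (n m : ℕ) : ℂ :=
  (-1) ^ m * qBinom q n m * q ^ (((m.choose 2 : ℕ) : ℤ) - m * n + m)

/-- Interchange of the order of summation over a triangle. -/
theorem sum_triangle_comm (n : ℕ) (f : ℕ → ℕ → ℂ) :
    ∑ k ∈ Finset.range (n + 1), ∑ m ∈ Finset.range (k + 1), f k m
      = ∑ m ∈ Finset.range (n + 1), ∑ j ∈ Finset.range (n - m + 1), f (m + j) m := by
  have h := Finset.sum_range_diag_flip (n + 1) fun m j => f (m + j) m
  calc _ = ∑ k ∈ Finset.range (n + 1), ∑ m ∈ Finset.range (k + 1), f (m + (k - m)) m :=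
        Finset.sum_congr rfl fun k _ => Finset.sum_congr rfl fun m hm => by
          rw [Nat.add_sub_cancel' (Nat.lt_succ_iff.1 (Finset.mem_range.1 hm))]
    _ = _ := by
        rw [h]
        exact Finset.sum_congr rfl fun m hm => by
          rw [Nat.sub_add_comm (Nat.lt_succ_iff.1 (Finset.mem_range.1 hm))]

/-- A one-sided inverse of a lower triangular matrix `L` with non-zero diagonal is two-sided. -/
theorem triangular_inversion {L U : ℕ → ℕ → ℂ} {N : ℕ} (hL : ∀ n ≤ N, L n n ≠ 0)
    (hLU : ∀ n ≤ N, ∀ m ≤ n, ∑ j ∈ Finset.range (n - m + 1), L n (m + j) * U (m + j) m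
      = if m = n then 1 else 0) (u : ℕ → ℂ) {n : ℕ} (hn : n ≤ N) :
    u n = ∑ m ∈ Finset.range (n + 1), U n m * ∑ k ∈ Finset.range (m + 1), L m k * u k := by
  set S : ℕ → ℂ := fun m => ∑ k ∈ Finset.range (m + 1), L m k * u k with hS
  -- Both `u` and `v` are mapped by `L` to `S`.
  set v : ℕ → ℂ := fun n => ∑ m ∈ Finset.range (n + 1), U n m * S m with hv
  have key : ∀ n ≤ N, ∑ k ∈ Finset.range (n + 1), L n k * v k = S n := fun n hn => by
    simp only [hv, Finset.mul_sum]
    rw [sum_triangle_comm n fun k m => L n k * (U k m * S m)]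
    calc _ = ∑ m ∈ Finset.range (n + 1), (if m = n then 1 else 0) * S m :=
          Finset.sum_congr rfl fun m hm => by
            rw [← hLU n hn m (Nat.lt_succ_iff.1 (Finset.mem_range.1 hm)), Finset.sum_mul]
            exact Finset.sum_congr rfl fun j _ => by ring
      _ = _ := by simp
  change u n = v n
  induction n using Nat.strong_induction_on with
  | _ n ih =>
    have h := key n hn
    rw [hS] at h
    simp only [Finset.sum_range_succ _ n] at h
    rw [Finset.sum_congr rfl fun k hk =>
      by rw [← ih k (Finset.mem_range.1 hk) ((Finset.mem_range.1 hk).le.trans hn)]] at h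
    exact (mul_left_cancel₀ (hL n hn) (add_left_cancel h)).symm

theorem zpow_neg_mul_pow (hq0 : q ≠ 0) (N m : ℕ) :
    q ^ (-(N : ℤ)) * q ^ m = q ^ ((m : ℤ) - N) := by
  rw [← zpow_natCast q m, ← zpow_add₀ hq0]
  congr 1
  ring

theorem zpow_sub_eq_zpow_neg {m n : ℕ} (h : m ≤ n) :
    q ^ ((m : ℤ) - n) = q ^ (-((n - m : ℕ) : ℤ)) := by
  rw [Nat.cast_sub h, neg_sub]

theorem pow_choose_two_mul_self (q : ℂ) (m : ℕ) :
    q ^ m.choose 2 * q ^ m.choose 2 * q ^ m = q ^ (m * m) := by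
  rw [← pow_add, ← pow_add]
  congr 1
  have h := Nat.choose_two_right m
  have h2 : 2 * (m * (m - 1) / 2) = m * (m - 1) :=
    Nat.mul_div_cancel' (Nat.even_mul_pred_self m).two_dvd
  rw [← h, Nat.mul_sub, mul_one] at h2
  have := Nat.le_mul_self m
  omega

theorem zpow_mul_sub_eq (hq0 : q ≠ 0) (n m : ℕ) :
    q ^ ((m : ℤ) * (m - n)) = q ^ (m * m) / q ^ (n * m) := by
  rw [← zpow_natCast q (m * m), ← zpow_natCast q (n * m), ← zpow_sub₀ hq0]
  congr 1
  push_cast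
  ring

theorem neg_one_pow_mul_self (m : ℕ) : (-1 : ℂ) ^ m * (-1) ^ m = 1 := by
  rw [← mul_pow]; simp

theorem qBinom_eq (hq0 : q ≠ 0) (hq : ∀ k : ℕ, 0 < k → q ^ k ≠ 1) {m n : ℕ} (hm : m ≤ n) :
    qBinom q n m = (-1) ^ m
      * (qPoch (q ^ (-(n : ℤ))) q m / qPoch q q m * q ^ (n * m) / q ^ m.choose 2) := by
  rw [qPoch_neg_eq hq0 hq hm, mul_right_comm, mul_div_cancel_right₀ _
    (pow_ne_zero _ hq0)]
  linear_combination -qBinom q n m * neg_one_pow_mul_self m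

theorem qBinom_add (q : ℂ) (m j : ℕ) :
    qBinom q (m + j) m = qPoch q q (m + j) / (qPoch q q m * qPoch q q j) := by
  rw [qBinom, Nat.add_sub_cancel_left]

/-- The product of an entry of the matrix of `qJacobiSum` for `A` with an entry of the inverse of
that for `A'`. -/
theorem qJacobi_mul_qJacobiCoeff (hq0 : q ≠ 0) (hq : ∀ k : ℕ, 0 < k → q ^ k ≠ 1) (A A' : ℂ)
    {n m : ℕ} (j : ℕ) (hm : m ≤ n) :
    qPoch (q ^ (-(n : ℤ))) q (m + j) / qPoch q q (m + j)
        * (qPoch (A * q ^ n) q (m + j) * q ^ (m + j)) * qJacobiCoeff q A' (m + j) m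
      = q ^ ((m : ℤ) * (m - n)) * qBinom q n m
        * (qPoch (A * q ^ n) q m / qPoch (A' * q ^ m) q m)
        * (qPoch (q ^ ((m : ℤ) - n)) q j / qPoch q q j
          * (qPoch (A * q ^ (n + m)) q j / qPoch (A' * q ^ (2 * m + 1)) q j * q ^ j)) := by
  have h1 := qPoch_self_ne_zero hq (m + j)
  rw [qJacobiCoeff, qBinom_add, qBinom_eq hq0 hq hm, zpow_mul_sub_eq hq0, ← pow_choose_two_mul_self,
    qPoch_add (q ^ (-(n : ℤ))), qPoch_add (A * q ^ n), zpow_neg_mul_pow hq0,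
    Nat.add_sub_cancel_left, mul_assoc A, ← pow_add q n m, pow_add q m j]
  field_simp

/-- The product of an entry of the matrix of `qMeixnerSum` with an entry of its inverse. -/
theorem qMeixner_mul_qMeixnerCoeff (hq0 : q ≠ 0) (hq : ∀ k : ℕ, 0 < k → q ^ k ≠ 1)
    {n m : ℕ} (j : ℕ) (hm : m ≤ n) :
    qPoch (q ^ (-(n : ℤ))) q (m + j) / qPoch q q (m + j) * (q ^ n) ^ (m + j)
        * qMeixnerCoeff q (m + j) m
      = qBinom q n m
        * (qPoch (q ^ ((m : ℤ) - n)) q j / qPoch q q j * (q ^ (n - m)) ^ j) := by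
  have h1 := qPoch_self_ne_zero hq (m + j)
  have h4 : q ^ (((m.choose 2 : ℕ) : ℤ) - m * ((m + j : ℕ) : ℤ) + m)
      = q ^ m.choose 2 * q ^ m / (q ^ (m * m) * q ^ (m * j)) := by
    rw [← pow_add, ← pow_add, ← mul_add, ← zpow_natCast, ← zpow_natCast, ← zpow_sub₀ hq0]
    congr 1
    push_cast
    ring
  have h5 : (q ^ n) ^ (m + j) = q ^ (n * m) * (q ^ (n - m)) ^ j * q ^ (m * j) := by
    rw [← pow_mul, ← pow_mul, ← pow_add, ← pow_add]
    congr 1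
    obtain ⟨i, rfl⟩ : ∃ i, n = m + i := ⟨_, (Nat.add_sub_cancel' hm).symm⟩
    rw [Nat.add_sub_cancel_left]
    ring
  rw [qMeixnerCoeff, qBinom_add, qBinom_eq hq0 hq hm, h4, h5, ← pow_choose_two_mul_self,
    qPoch_add (q ^ (-(n : ℤ))), zpow_neg_mul_pow hq0]
  field_simp

theorem qPoch_neg_self_ne_zero (hq0 : q ≠ 0) (hq : ∀ k : ℕ, 0 < k → q ^ k ≠ 1) (n : ℕ) :
    qPoch (q ^ (-(n : ℤ))) q n / qPoch q q n ≠ 0 :=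
  div_ne_zero (qPoch_neg_ne_zero hq0 hq le_rfl) (qPoch_self_ne_zero hq n)

theorem qPoch_mul_pow_ne_zero {A : ℂ} {i l N : ℕ} (hA : ∀ k : ℕ, 1 ≤ k → k < N → A * q ^ k ≠ 1)
    (h : l = 0 ∨ 1 ≤ i ∧ i + l ≤ N) : qPoch (A * q ^ i) q l ≠ 0 :=
  qPoch_ne_zero_iff.2 fun k hk => by
    rw [mul_assoc, ← pow_add]
    exact hA _ (by omega) (by omega)

/-- Inversion of `qJacobiSum`. One of the two matrix products is the instance
`₂φ₁(q^(m-n), A q^(n+m); A q^(2m+1); q, q)` of the `q`-Chu–Vandermonde sum. -/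
theorem qJacobiSum_inversion (hq0 : q ≠ 0) (hq : ∀ k : ℕ, 0 < k → q ^ k ≠ 1) {A : ℂ} {N : ℕ}
    (hA : ∀ k : ℕ, 1 ≤ k → k < 2 * N → A * q ^ k ≠ 1) (u : ℕ → ℂ) {n : ℕ} (hn : n ≤ N) :
    u n = ∑ m ∈ Finset.range (n + 1), qJacobiCoeff q A n m * qJacobiSum q A u m := by
  have h := triangular_inversion (N := N) (U := qJacobiCoeff q A)
    (L := fun n k => qPoch (q ^ (-(n : ℤ))) q k / qPoch q q k * (qPoch (A * q ^ n) q k * q ^ k))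
    (fun n hn => mul_ne_zero (qPoch_neg_self_ne_zero hq0 hq n)
      (mul_ne_zero (qPoch_mul_pow_ne_zero hA (by omega)) (pow_ne_zero _ hq0)))
    (fun n hn m hm => ?_) u hn
  · rw [h]
    simp only [qJacobiSum, mul_assoc]
  simp only [qJacobi_mul_qJacobiCoeff hq0 hq A A _ hm]
  rw [← Finset.mul_sum, zpow_sub_eq_zpow_neg hm, sum_qChuVandermonde hq0 hq (n - m)]
  · split_ifs with hmn
    · subst hmn
      have h1 : qPoch (A * q ^ m) q m ≠ 0 := qPoch_mul_pow_ne_zero hA (by omega)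
      have h2 := qPoch_self_ne_zero hq m
      simp [qBinom, qPoch_zero_right, h1, h2]
    · rw [Finset.prod_eq_zero (i := n - m - 1) (Finset.mem_range.2 (by omega)), zero_div, mul_zero]
      rw [mul_assoc, ← pow_add, show 2 * m + 1 + (n - m - 1) = n + m by omega, sub_self]
  · exact qPoch_mul_pow_ne_zero hA (by omega)

/-- Inversion of `qMeixnerSum`; the matrix product is an instance of the `q`-binomial theorem. -/
theorem qMeixnerSum_inversion (hq0 : q ≠ 0) (hq : ∀ k : ℕ, 0 < k → q ^ k ≠ 1) (u : ℕ → ℂ)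
    (n : ℕ) :
    u n = ∑ m ∈ Finset.range (n + 1), qMeixnerCoeff q n m * qMeixnerSum q u m := by
  have h := triangular_inversion (N := n) (U := qMeixnerCoeff q)
    (L := fun n k => qPoch (q ^ (-(n : ℤ))) q k / qPoch q q k * (q ^ n) ^ k)
    (fun n hn => mul_ne_zero (qPoch_neg_self_ne_zero hq0 hq n)
      (pow_ne_zero _ (pow_ne_zero _ hq0)))
    (fun n hn m hm => ?_) u le_rfl
  · rw [h]
    simp only [qMeixnerSum, mul_assoc]
  simp only [qMeixner_mul_qMeixnerCoeff hq0 hq _ hm]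
  rw [← Finset.mul_sum, zpow_sub_eq_zpow_neg hm, sum_qPoch_neg_mul_pow hq0 hq (n - m), zpow_neg,
    zpow_natCast, mul_inv_cancel₀ (pow_ne_zero _ hq0)]
  split_ifs with hmn
  · subst hmn
    have h2 := qPoch_self_ne_zero hq m
    simp [qBinom, qPoch_zero_right, h2]
  · rw [show n - m = n - m - 1 + 1 by omega, qPoch_succ']
    simp

/-- Connection of two `qJacobiSum`s whose coefficient sequences have termwise ratio `r`. -/
theorem qJacobiSum_connection (hq0 : q ≠ 0) (hq : ∀ k : ℕ, 0 < k → q ^ k ≠ 1) (A : ℂ) {A' : ℂ}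
    {n : ℕ} (hA' : ∀ k : ℕ, 1 ≤ k → k < 2 * n → A' * q ^ k ≠ 1) {u v r : ℕ → ℂ}
    (huv : ∀ k ≤ n, u k = r k * v k) :
    qJacobiSum q A u n = ∑ m ∈ Finset.range (n + 1),
      (q ^ ((m : ℤ) * (m - n)) * qBinom q n m
          * (qPoch (A * q ^ n) q m / qPoch (A' * q ^ m) q m)
        * ∑ j ∈ Finset.range (n - m + 1), qPoch (q ^ ((m : ℤ) - n)) q j / qPoch q q j
          * (qPoch (A * q ^ (n + m)) q j / qPoch (A' * q ^ (2 * m + 1)) q j * q ^ j * r (m + j)))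
      * qJacobiSum q A' v m := by
  calc _ = ∑ k ∈ Finset.range (n + 1), ∑ m ∈ Finset.range (k + 1),
          qPoch (q ^ (-(n : ℤ))) q k / qPoch q q k * (qPoch (A * q ^ n) q k * q ^ k)
            * qJacobiCoeff q A' k m * r k * qJacobiSum q A' v m := by
        rw [qJacobiSum]
        refine Finset.sum_congr rfl fun k hk => ?_
        have hk := Nat.lt_succ_iff.1 (Finset.mem_range.1 hk)
        rw [huv k hk, qJacobiSum_inversion hq0 hq hA' v hk, Finset.mul_sum, Finset.mul_sum,
          Finset.mul_sum]
        exact Finset.sum_congr rfl fun m _ => by ring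
    _ = _ := by
        rw [sum_triangle_comm]
        refine Finset.sum_congr rfl fun m hm => ?_
        rw [← Finset.sum_mul, Finset.mul_sum]
        congr 1
        refine Finset.sum_congr rfl fun j _ => ?_
        rw [qJacobi_mul_qJacobiCoeff hq0 hq A A' j (Nat.lt_succ_iff.1 (Finset.mem_range.1 hm))]
        ring

/-- Connection of two `qMeixnerSum`s whose coefficient sequences have termwise ratio `r`. -/
theorem qMeixnerSum_connection (hq0 : q ≠ 0) (hq : ∀ k : ℕ, 0 < k → q ^ k ≠ 1)
    {n : ℕ} {u v r : ℕ → ℂ} (huv : ∀ k ≤ n, u k = r k * v k) :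
    qMeixnerSum q u n = ∑ m ∈ Finset.range (n + 1),
      (qBinom q n m * ∑ j ∈ Finset.range (n - m + 1),
        qPoch (q ^ ((m : ℤ) - n)) q j / qPoch q q j * ((q ^ (n - m)) ^ j * r (m + j)))
      * qMeixnerSum q v m := by
  calc _ = ∑ k ∈ Finset.range (n + 1), ∑ m ∈ Finset.range (k + 1),
          qPoch (q ^ (-(n : ℤ))) q k / qPoch q q k * (q ^ n) ^ k
            * qMeixnerCoeff q k m * r k * qMeixnerSum q v m := by
        rw [qMeixnerSum]
        refine Finset.sum_congr rfl fun k hk => ?_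
        have hk := Nat.lt_succ_iff.1 (Finset.mem_range.1 hk)
        rw [huv k hk, qMeixnerSum_inversion hq0 hq v k, Finset.mul_sum, Finset.mul_sum,
          Finset.mul_sum]
        exact Finset.sum_congr rfl fun m _ => by ring
    _ = _ := by
        rw [sum_triangle_comm]
        refine Finset.sum_congr rfl fun m hm => ?_
        rw [← Finset.sum_mul, Finset.mul_sum]
        congr 1
        refine Finset.sum_congr rfl fun j _ => ?_
        rw [qMeixner_mul_qMeixnerCoeff hq0 hq j (Nat.lt_succ_iff.1 (Finset.mem_range.1 hm))]
        ring

/-! ### Terminating basic hypergeometric series -/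

/-- A series with numerator parameter `q⁻ⁿ` terminates after the term of index `n`. -/
theorem qHyp_eq_sum (hq0 : q ≠ 0) (n : ℕ) (as bs : List ℂ) (z : ℂ) :
    qHyp (q ^ (-(n : ℤ)) :: as) bs q z = ∑ k ∈ Finset.range (n + 1),
      qPoch (q ^ (-(n : ℤ))) q k / qPoch q q k * (qPochs as q k / qPochs bs q k
        * ((-1) ^ k * q ^ k.choose 2) ^ ((bs.length : ℤ) - as.length) * z ^ k) := by
  rw [qHyp, tsum_eq_sum (s := Finset.range (n + 1))]
  · refine Finset.sum_congr rfl fun k _ => ?_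
    rw [qPochs_cons, List.length_cons, Nat.cast_succ, add_comm (as.length : ℤ) 1,
      add_sub_add_left_eq_sub]
    ring
  · intro k hk
    rw [qPochs_cons, qPoch_neg_eq_zero hq0 (by simpa using hk)]
    simp

theorem qHyp_congr {as as' bs bs' : List ℂ} {z : ℂ} (ha : as.length = as'.length)
    (hb : bs.length = bs'.length)
    (h : ∀ k, qPochs as q k / qPochs bs q k = qPochs as' q k / qPochs bs' q k) :
    qHyp as bs q z = qHyp as' bs' q z := by
  simp only [qHyp, ha, hb, h]

theorem qHyp_eq_qJacobiSum (hq0 : q ≠ 0) (A : ℂ) {n : ℕ} {as bs : List ℂ} {z : ℂ} {u : ℕ → ℂ}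
    (h : ∀ k, qPochs as q k / qPochs bs q k
        * ((-1) ^ k * q ^ k.choose 2) ^ ((bs.length : ℤ) - as.length) * z ^ k
      = qPoch (A * q ^ n) q k * q ^ k * u k) :
    qHyp (q ^ (-(n : ℤ)) :: as) bs q z = qJacobiSum q A u n := by
  rw [qHyp_eq_sum hq0, qJacobiSum]
  simp only [h]

theorem qHyp_eq_qMeixnerSum (hq0 : q ≠ 0) {n : ℕ} {as bs : List ℂ} {z : ℂ} {u : ℕ → ℂ}
    (h : ∀ k, qPochs as q k / qPochs bs q k
        * ((-1) ^ k * q ^ k.choose 2) ^ ((bs.length : ℤ) - as.length) * z ^ k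
      = (q ^ n) ^ k * u k) :
    qHyp (q ^ (-(n : ℤ)) :: as) bs q z = qMeixnerSum q u n := by
  rw [qHyp_eq_sum hq0, qMeixnerSum]
  simp only [h]

/-- The connection coefficients as basic hypergeometric series, for two sums with a common
numerator `B_k` and denominators given by the parameter lists `bs` and `bs'`. -/
theorem qJacobiSum_connection_qHyp (hq0 : q ≠ 0) (hq : ∀ k : ℕ, 0 < k → q ^ k ≠ 1) (A : ℂ)
    {A' : ℂ} {n : ℕ} (hA' : ∀ k : ℕ, 1 ≤ k → k < 2 * n → A' * q ^ k ≠ 1) (B : ℕ → ℂ)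
    (bs : List ℂ) {bs' : List ℂ} (hlen : bs.length = bs'.length) (hbs' : qPochs bs' q n ≠ 0) :
    qJacobiSum q A (fun k => B k / qPochs bs q k) n = ∑ m ∈ Finset.range (n + 1),
      (q ^ ((m : ℤ) * (m - n)) * qBinom q n m
          * (qPoch (A * q ^ n) q m * qPochs bs' q m / (qPoch (A' * q ^ m) q m * qPochs bs q m))
        * qHyp (q ^ ((m : ℤ) - n) :: A * q ^ (n + m) :: bs'.map (· * q ^ m))
            (A' * q ^ (2 * m + 1) :: bs.map (· * q ^ m)) q q)
      * qJacobiSum q A' (fun k => B k / qPochs bs' q k) m := by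
  rw [qJacobiSum_connection hq0 hq A hA' (r := fun k => qPochs bs' q k / qPochs bs q k)
    (v := fun k => B k / qPochs bs' q k) fun k hk => by
      have := qPochs_ne_zero_of_le hbs' hk
      field_simp]
  refine Finset.sum_congr rfl fun m hm => ?_
  rw [zpow_sub_eq_zpow_neg (Nat.lt_succ_iff.1 (Finset.mem_range.1 hm)), qHyp_eq_sum hq0,
    Finset.mul_sum, Finset.mul_sum]
  congr 1
  refine Finset.sum_congr rfl fun j _ => ?_
  simp only [qPochs_add, qPochs_cons, List.length_cons, List.length_map, hlen, sub_self,
    zpow_zero]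
  ring

theorem zero_mul_pow_ne_one (q : ℂ) (n : ℕ) : ∀ k : ℕ, 1 ≤ k → k < 2 * n → 0 * q ^ k ≠ 1 := by
  simp

/-- `qJacobiSum_connection_qHyp` in the degenerate case `A = A' = 0`. -/
theorem qJacobiSum_zero_connection_qHyp (hq0 : q ≠ 0) (hq : ∀ k : ℕ, 0 < k → q ^ k ≠ 1) (n : ℕ)
    (B : ℕ → ℂ) (bs : List ℂ) {bs' : List ℂ} (hlen : bs.length = bs'.length)
    (hbs' : qPochs bs' q n ≠ 0) :
    qJacobiSum q 0 (fun k => B k / qPochs bs q k) n = ∑ m ∈ Finset.range (n + 1),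
      (q ^ ((m : ℤ) * (m - n)) * qBinom q n m * (qPochs bs' q m / qPochs bs q m)
        * qHyp (q ^ ((m : ℤ) - n) :: bs'.map (· * q ^ m)) (bs.map (· * q ^ m)) q q)
      * qJacobiSum q 0 (fun k => B k / qPochs bs' q k) m := by
  rw [qJacobiSum_connection_qHyp hq0 hq 0 (zero_mul_pow_ne_one q n) B bs hlen hbs']
  refine Finset.sum_congr rfl fun m hm => ?_
  simp only [zpow_sub_eq_zpow_neg (q := q) (Nat.lt_succ_iff.1 (Finset.mem_range.1 hm)),
    qHyp_eq_sum hq0, zero_mul, qPochs_cons, qPoch_zero_left, one_mul, List.length_cons,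
    List.length_map, hlen, sub_self]

/-- The analogue of `qJacobiSum_connection_qHyp` for `qMeixnerSum`; the quotient of the scaling
constants `ζ` and `ζ'` moves into the argument of the series. -/
theorem qMeixnerSum_connection_qHyp (hq0 : q ≠ 0) (hq : ∀ k : ℕ, 0 < k → q ^ k ≠ 1) (n : ℕ)
    (B : ℕ → ℂ) (ζ : ℂ) {ζ' : ℂ} (hζ' : ζ' ≠ 0)
    (bs : List ℂ) {bs' : List ℂ} (hlen : bs.length = bs'.length) (hbs' : qPochs bs' q n ≠ 0) :
    qMeixnerSum q (fun k => ζ ^ k * B k / qPochs bs q k) n = ∑ m ∈ Finset.range (n + 1),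
      (qBinom q n m * ((ζ / ζ') ^ m * (qPochs bs' q m / qPochs bs q m))
        * qHyp (q ^ ((m : ℤ) - n) :: bs'.map (· * q ^ m)) (bs.map (· * q ^ m)) q
            (ζ / ζ' * q ^ (n - m)))
      * qMeixnerSum q (fun k => ζ' ^ k * B k / qPochs bs' q k) m := by
  rw [qMeixnerSum_connection hq0 hq (r := fun k => (ζ / ζ') ^ k * (qPochs bs' q k / qPochs bs q k))
    (v := fun k => ζ' ^ k * B k / qPochs bs' q k) fun k hk => by
      have := qPochs_ne_zero_of_le hbs' hk
      rw [div_pow]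
      field_simp]
  refine Finset.sum_congr rfl fun m hm => ?_
  rw [zpow_sub_eq_zpow_neg (Nat.lt_succ_iff.1 (Finset.mem_range.1 hm)), qHyp_eq_sum hq0,
    Finset.mul_sum, Finset.mul_sum]
  congr 1
  refine Finset.sum_congr rfl fun j _ => ?_
  simp only [qPochs_add, List.length_map, hlen, sub_self, zpow_zero, mul_pow, pow_add]
  ring

/-! ### The polynomial families as terminating sums -/

theorem mul_zpow_sub_one (hq0 : q ≠ 0) (A : ℂ) (n : ℕ) :
    A * q ^ ((n : ℤ) - 1) = A / q * q ^ n := by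
  rw [zpow_sub_one₀ hq0, zpow_natCast]
  ring

theorem cpow_add_natCast (hq0 : q ≠ 0) (u : ℂ) (n : ℕ) : q ^ (u + n) = q ^ u * q ^ n := by
  rw [Complex.cpow_add _ _ hq0, Complex.cpow_natCast]

/-! In the lemmas `…_eq` the factor in front of the sum is the normalization of the family (`1` if
there is none). -/

theorem askeyWilson_eq (hq0 : q ≠ 0) (a b c d θ : ℂ) (n : ℕ) :
    askeyWilson q a b c d n θ = qPochs [a * b, a * c, a * d] q n / a ^ n
      * qJacobiSum q (a * b * c * d / q) (fun k => qPochs [a * expI θ, a * expI (-θ)] q k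
        / qPochs [a * b, a * c, a * d] q k) n := by
  rw [askeyWilson, qHyp_eq_qJacobiSum hq0]
  intro k
  rw [mul_zpow_sub_one hq0, qPochs_cons]
  simp
  ring

theorem qRacah_eq (hq0 : q ≠ 0) (α β γ δ x : ℂ) (n : ℕ) :
    qRacah q α β γ δ n x = 1
      * qJacobiSum q (α * β * q) (fun k => qPochs [q ^ (-x), γ * δ * q ^ (x + 1)] q k
        / qPochs [α * q, β * δ * q, γ * q] q k) n := by
  rw [one_mul, qRacah, qHyp_eq_qJacobiSum hq0]
  intro k
  rw [pow_succ', ← mul_assoc, qPochs_cons]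
  simp
  ring

theorem contDualQHahn_eq (hq0 : q ≠ 0) (a b c θ : ℂ) (n : ℕ) :
    contDualQHahn q a b c n θ = qPochs [a * b, a * c] q n / a ^ n
      * qJacobiSum q 0 (fun k => qPochs [a * expI θ, a * expI (-θ)] q k
        / qPochs [a * b, a * c] q k) n := by
  rw [contDualQHahn, qHyp_eq_qJacobiSum hq0]
  intro k
  simp [qPoch_zero_left]
  ring

theorem contQHahn_eq (hq0 : q ≠ 0) (φ a b c d θ : ℂ) (n : ℕ) :
    contQHahn q φ a b c d n θ = qPochs [a * b * expI (2 * φ), a * c, a * d] q n / (a * expI φ) ^ n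
      * qJacobiSum q (a * b * c * d / q)
        (fun k => qPochs [a * expI (θ + 2 * φ), a * expI (-θ)] q k
          / qPochs [a * b * expI (2 * φ), a * c, a * d] q k) n := by
  rw [contQHahn, qHyp_eq_qJacobiSum hq0]
  intro k
  rw [mul_zpow_sub_one hq0, qPochs_cons]
  simp
  ring

theorem bigQJacobi_eq (hq0 : q ≠ 0) (a b c x : ℂ) (n : ℕ) :
    bigQJacobi q a b c n x = 1
      * qJacobiSum q (a * b * q) (fun k => qPoch x q k / qPochs [a * q, c * q] q k) n := by
  rw [one_mul, bigQJacobi, qHyp_eq_qJacobiSum hq0]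
  intro k
  rw [pow_succ', ← mul_assoc, qPochs_cons]
  simp [qPochs_cons x, qPochs_nil]
  ring

theorem qHahn_eq (hq0 : q ≠ 0) (α β y : ℂ) (N n : ℕ) :
    qHahn q α β N n y = 1
      * qJacobiSum q (α * β * q) (fun k => qPoch y q k / qPochs [α * q, q ^ (-(N : ℤ))] q k) n := by
  rw [one_mul, qHahn, qHyp_eq_qJacobiSum hq0]
  intro k
  rw [pow_succ', ← mul_assoc, qPochs_cons]
  simp [qPochs_cons y, qPochs_nil]
  ring

theorem dualQHahn_eq (hq0 : q ≠ 0) (γ δ x : ℂ) (N n : ℕ) :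
    dualQHahn q γ δ N n x = 1
      * qJacobiSum q 0 (fun k => qPochs [q ^ (-x), γ * δ * q ^ (x + 1)] q k
        / qPochs [γ * q, q ^ (-(N : ℤ))] q k) n := by
  rw [one_mul, dualQHahn, qHyp_eq_qJacobiSum hq0]
  intro k
  simp [qPoch_zero_left]
  ring

theorem alSalamChihara_eq (hq0 : q ≠ 0) (a b θ : ℂ) (n : ℕ) :
    alSalamChihara q a b n θ = qPoch (a * b) q n / a ^ n
      * qJacobiSum q 0 (fun k => qPochs [a * expI θ, a * expI (-θ)] q k
        / qPochs [a * b] q k) n := by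
  rw [alSalamChihara, qHyp_eq_qJacobiSum hq0]
  intro k
  simp [qPoch_zero_left, qPochs_cons, qPochs_nil]
  ring

theorem qMeixnerPollaczek_eq (hq0 : q ≠ 0) (φ a θ : ℂ) (n : ℕ) :
    qMeixnerPollaczek q φ a n θ = qPoch (a ^ 2) q n / ((a * expI φ) ^ n * qPoch q q n)
      * qJacobiSum q 0 (fun k => qPochs [a * expI (θ + 2 * φ), a * expI (-θ)] q k
        / qPochs [a ^ 2] q k) n := by
  rw [qMeixnerPollaczek, qHyp_eq_qJacobiSum hq0]
  intro k
  simp [qPoch_zero_left, qPochs_cons, qPochs_nil]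
  ring

theorem contQJacobi_eq (hq0 : q ≠ 0) (α β θ : ℂ) (n : ℕ) :
    contQJacobi q α β n θ = qPoch (q ^ (α + 1)) q n / qPoch q q n
      * qJacobiSum q (q ^ (α + β + 1))
        (fun k => qPochs [q ^ (α / 2 + 1 / 4) * expI θ, q ^ (α / 2 + 1 / 4) * expI (-θ)] q k
          / qPochs [q ^ (α + 1), -q ^ ((α + β + 1) / 2), -q ^ ((α + β + 2) / 2)] q k) n := by
  rw [contQJacobi, qHyp_eq_qJacobiSum hq0]
  intro k
  rw [qPochs_cons, show (n : ℂ) + α + β + 1 = α + β + 1 + n by ring, cpow_add_natCast hq0]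
  simp
  ring

theorem rogers_eq (hq0 : q ≠ 0) (β θ : ℂ) (n : ℕ) :
    rogers q β n θ = qPoch (β ^ 2) q n / qPoch q q n * β ^ (-(n : ℂ) / 2)
      * qJacobiSum q (β ^ 2)
        (fun k => qPochs [β ^ (1 / 2 : ℂ) * expI θ, β ^ (1 / 2 : ℂ) * expI (-θ)] q k
          / qPochs [β * q ^ (1 / 2 : ℂ), -β, -(β * q ^ (1 / 2 : ℂ))] q k) n := by
  rw [rogers, qHyp_eq_qJacobiSum hq0]
  intro k
  rw [qPochs_cons]
  simp
  ring

theorem contQLegendre_eq (hq0 : q ≠ 0) (θ : ℂ) (n : ℕ) :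
    contQLegendre q n θ = 1 * qJacobiSum q q
        (fun k => qPochs [q ^ (1 / 4 : ℂ) * expI θ, q ^ (1 / 4 : ℂ) * expI (-θ)] q k
          / qPochs [q, -q ^ (1 / 2 : ℂ), -q] q k) n := by
  rw [one_mul, contQLegendre, qHyp_eq_qJacobiSum hq0]
  intro k
  rw [pow_succ', qPochs_cons]
  simp
  ring

theorem bigQLaguerre_eq (hq0 : q ≠ 0) (a b x : ℂ) (n : ℕ) :
    bigQLaguerre q a b n x = 1
      * qJacobiSum q 0 (fun k => qPoch x q k / qPochs [a * q, b * q] q k) n := by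
  rw [one_mul, bigQLaguerre, qHyp_eq_qJacobiSum hq0]
  intro k
  simp [qPoch_zero_left, qPochs_cons, qPochs_nil]
  ring

theorem littleQJacobi_eq (hq0 : q ≠ 0) (a b x : ℂ) (n : ℕ) :
    littleQJacobi q a b n x = 1
      * qJacobiSum q (a * b * q) (fun k => x ^ k / qPochs [a * q] q k) n := by
  rw [one_mul, littleQJacobi, qHyp_eq_qJacobiSum hq0]
  intro k
  rw [pow_succ', ← mul_assoc, qPochs_cons]
  simp [qPochs_nil, mul_pow]
  ring

theorem littleQLegendre_eq (hq0 : q ≠ 0) (x : ℂ) (n : ℕ) :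
    littleQLegendre q n x = 1 * qJacobiSum q q (fun k => x ^ k / qPochs [q] q k) n := by
  rw [one_mul, littleQLegendre, qHyp_eq_qJacobiSum hq0]
  intro k
  rw [pow_succ', qPochs_cons]
  simp [qPochs_nil, mul_pow]
  ring

theorem qMeixner_eq (hq0 : q ≠ 0) (b c y : ℂ) (n : ℕ) :
    qMeixner q b c n y = 1
      * qMeixnerSum q (fun k => (-(q / c)) ^ k * qPoch y q k / qPochs [b * q] q k) n := by
  rw [one_mul, qMeixner, qHyp_eq_qMeixnerSum hq0]
  intro k
  rw [show -q ^ (n + 1) / c = q ^ n * -(q / c) by ring]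
  simp [qPochs_cons, qPochs_nil]
  ring

theorem quantumQKrawtchouk_eq (hq0 : q ≠ 0) (p y : ℂ) (N n : ℕ) :
    quantumQKrawtchouk q p N n y = 1
      * qMeixnerSum q (fun k => (p * q) ^ k * qPoch y q k / qPochs [q ^ (-(N : ℤ))] q k) n := by
  rw [one_mul, quantumQKrawtchouk, qHyp_eq_qMeixnerSum hq0]
  intro k
  rw [show p * q ^ (n + 1) = q ^ n * (p * q) by ring, mul_pow (q ^ n)]
  simp [qPochs_cons, qPochs_nil]
  ring

theorem qKrawtchouk_eq (hq0 : q ≠ 0) (p y : ℂ) (N n : ℕ) :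
    qKrawtchouk q p N n y = 1
      * qJacobiSum q (-p) (fun k => qPoch y q k / qPochs [q ^ (-(N : ℤ))] q k) n := by
  rw [one_mul, qKrawtchouk, qHyp_eq_qJacobiSum hq0]
  intro k
  simp [qPochs_cons, qPochs_nil, qPoch_zero_left]
  ring

theorem affineQKrawtchouk_eq (hq0 : q ≠ 0) (p y : ℂ) (N n : ℕ) :
    affineQKrawtchouk q p N n y = 1
      * qJacobiSum q 0 (fun k => qPoch y q k / qPochs [p * q, q ^ (-(N : ℤ))] q k) n := by
  rw [one_mul, affineQKrawtchouk, qHyp_eq_qJacobiSum hq0]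
  intro k
  simp [qPochs_cons, qPochs_nil, qPoch_zero_left]
  ring

theorem dualQKrawtchouk_eq (hq0 : q ≠ 0) (c x : ℂ) (N n : ℕ) :
    dualQKrawtchouk q c N n x = 1
      * qJacobiSum q 0 (fun k => qPochs [q ^ (-x), c * q ^ (x - N)] q k
        / qPochs [q ^ (-(N : ℤ))] q k) n := by
  rw [one_mul, dualQKrawtchouk, qHyp_eq_qJacobiSum hq0]
  intro k
  simp [qPochs_cons, qPochs_nil, qPoch_zero_left]
  ring

theorem contBigQHermite_eq (hq0 : q ≠ 0) (a θ : ℂ) (n : ℕ) :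
    contBigQHermite q a n θ = 1 / a ^ n
      * qJacobiSum q 0 (fun k => qPochs [a * expI θ, a * expI (-θ)] q k / qPochs [] q k) n := by
  rw [contBigQHermite, qHyp_eq_qJacobiSum hq0]
  intro k
  simp [qPochs_cons, qPochs_nil, qPoch_zero_left]
  ring

theorem contQLaguerre_eq (hq0 : q ≠ 0) (α θ : ℂ) (n : ℕ) :
    contQLaguerre q α n θ = qPoch (q ^ (α + 1)) q n / qPoch q q n
      * qJacobiSum q 0
        (fun k => qPochs [q ^ (α / 2 + 1 / 4) * expI θ, q ^ (α / 2 + 1 / 4) * expI (-θ)] q k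
          / qPochs [q ^ (α + 1)] q k) n := by
  rw [contQLaguerre, qHyp_eq_qJacobiSum hq0]
  intro k
  simp [qPochs_cons, qPochs_nil, qPoch_zero_left]
  ring

theorem littleQLaguerre_eq (hq0 : q ≠ 0) (a x : ℂ) (n : ℕ) :
    littleQLaguerre q a n x = 1
      * qJacobiSum q 0 (fun k => x ^ k / qPochs [a * q] q k) n := by
  rw [one_mul, littleQLaguerre, qHyp_eq_qJacobiSum hq0]
  intro k
  simp [qPochs_cons, qPochs_nil, qPoch_zero_left, mul_pow]
  ring

theorem qLaguerre_eq (hq0 : q ≠ 0) (α x : ℂ) (n : ℕ) :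
    qLaguerre q α n x = qPoch (q ^ (α + 1)) q n / qPoch q q n
      * qMeixnerSum q (fun k => (q ^ (α + 1)) ^ k * (q ^ k.choose 2 * x ^ k)
        / qPochs [q ^ (α + 1)] q k) n := by
  rw [qLaguerre, qHyp_eq_qMeixnerSum hq0]
  intro k
  rw [show (n : ℂ) + α + 1 = α + 1 + n by ring, cpow_add_natCast hq0,
    show -(q ^ (α + 1) * q ^ n) * x = -1 * (q ^ n * (q ^ (α + 1) * x)) by ring, mul_pow (-1)]
  simp only [qPochs_cons, qPochs_nil, List.length_cons, List.length_nil, Nat.cast_zero, zero_add,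
    Nat.cast_one, sub_zero, zpow_one, mul_pow (q ^ n), mul_pow _ x]
  linear_combination ((qPoch (q ^ (α + 1)) q k)⁻¹ * q ^ k.choose 2
    * ((q ^ n) ^ k * ((q ^ (α + 1)) ^ k * x ^ k))) * neg_one_pow_mul_self k

theorem altQCharlier_eq (hq0 : q ≠ 0) (a x : ℂ) (n : ℕ) :
    altQCharlier q a n x = 1
      * qJacobiSum q (-a) (fun k => x ^ k / qPochs [] q k) n := by
  rw [one_mul, altQCharlier, qHyp_eq_qJacobiSum hq0]
  intro k
  simp [qPochs_cons, qPochs_nil, qPoch_zero_left, mul_pow]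
  ring

theorem qCharlier_eq (hq0 : q ≠ 0) (a y : ℂ) (n : ℕ) :
    qCharlier q a n y = 1
      * qMeixnerSum q (fun k => (-(q / a)) ^ k * qPoch y q k / qPochs [] q k) n := by
  rw [one_mul, qCharlier, qHyp_eq_qMeixnerSum hq0]
  intro k
  rw [show -q ^ (n + 1) / a = q ^ n * -(q / a) by ring]
  simp [qPochs_cons, qPochs_nil, qPoch_zero_left]
  ring

theorem alSalamCarlitzI_eq (hq0 : q ≠ 0) (a x : ℂ) (n : ℕ) :
    alSalamCarlitzI q a n x = (-a) ^ n * q ^ n.choose 2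
      * qJacobiSum q 0 (fun k => a⁻¹ ^ k * (x ^ k * qPoch x⁻¹ q k)) n := by
  rw [alSalamCarlitzI, qHyp_eq_qJacobiSum hq0]
  intro k
  simp [qPochs_cons, qPochs_nil, qPoch_zero_left, mul_pow, div_pow]
  ring

theorem alSalamCarlitzII_eq (hq0 : q ≠ 0) (a x : ℂ) (n : ℕ) :
    alSalamCarlitzII q a n x = (-a) ^ n / q ^ n.choose 2
      * qMeixnerSum q (fun k => (-a⁻¹) ^ k / q ^ k.choose 2 * qPoch x q k) n := by
  rw [alSalamCarlitzII, qHyp_eq_qMeixnerSum hq0]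
  intro k
  rw [show -a⁻¹ = (-1) * a⁻¹ by ring, mul_pow (-1)]
  simp [qPochs_cons, qPochs_nil, div_pow]
  rw [← inv_pow (-1 : ℂ)]
  norm_num
  ring

theorem contQHermite_eq (hq0 : q ≠ 0) (θ : ℂ) (n : ℕ) :
    contQHermite q n θ = expI (n * θ)
      * qMeixnerSum q (fun k => (-1) ^ k / q ^ k.choose 2 * expI (-2 * θ) ^ k) n := by
  rw [contQHermite, qHyp_eq_qMeixnerSum hq0]
  intro k
  simp [qPochs_cons, qPochs_nil, qPoch_zero_left, mul_pow]
  rw [← inv_pow (-1 : ℂ)]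
  norm_num
  ring

theorem stieltjesWigert_eq (hq0 : q ≠ 0) (x : ℂ) (n : ℕ) :
    stieltjesWigert q n x = 1 / qPoch q q n
      * qMeixnerSum q (fun k => q ^ k.choose 2 * q ^ k * x ^ k) n := by
  rw [stieltjesWigert, qHyp_eq_qMeixnerSum hq0]
  intro k
  rw [show -q ^ (n + 1) * x = -1 * (q ^ n * (q * x)) by ring, mul_pow (-1)]
  simp only [qPochs_cons, qPochs_nil, List.length_cons, List.length_nil, Nat.cast_zero, zero_add,
    Nat.cast_one, sub_zero, zpow_one, mul_pow (q ^ n), mul_pow _ x, qPoch_zero_left]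
  linear_combination (q ^ k.choose 2 * ((q ^ n) ^ k * (q ^ k * x ^ k))) * neg_one_pow_mul_self k

theorem discreteQHermiteI_eq (hq0 : q ≠ 0) (x : ℂ) (n : ℕ) :
    discreteQHermiteI q n x = q ^ n.choose 2
      * qJacobiSum q 0 (fun k => (-1) ^ k * (x ^ k * qPoch x⁻¹ q k)) n := by
  rw [discreteQHermiteI, qHyp_eq_qJacobiSum hq0]
  intro k
  rw [show -q * x = q * (-1 * x) by ring]
  simp only [mul_pow]
  simp [qPochs_cons, qPochs_nil, qPoch_zero_left]
  ring

theorem discreteQHermiteII_eq (hq0 : q ≠ 0) (x : ℂ) (n : ℕ) :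
    discreteQHermiteII q n x = 1 / (Complex.I ^ n * q ^ n.choose 2)
      * qMeixnerSum q (fun k => 1 / q ^ k.choose 2 * qPoch (Complex.I * x) q k) n := by
  rw [discreteQHermiteII, qHyp_eq_qMeixnerSum hq0]
  intro k
  rw [show -q ^ n = (-1) * q ^ n by ring, mul_pow (-1)]
  have h := neg_one_pow_mul_self k
  simp [qPochs_cons, qPochs_nil]
  field_simp

/-! ### Inversion formulas -/

/-- The inversion formula for a family `P` expressed through `qJacobiSum`. -/
theorem inversion_of_eq_qJacobiSum (hq0 : q ≠ 0) (hq : ∀ k : ℕ, 0 < k → q ^ k ≠ 1) {A : ℂ} {n : ℕ}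
    (hA : ∀ k : ℕ, 1 ≤ k → k < 2 * n → A * q ^ k ≠ 1) {B P w coef : ℕ → ℂ} {bs : List ℂ}
    (hP : ∀ m, P m = w m * qJacobiSum q A (fun k => B k / qPochs bs q k) m)
    (hbs : qPochs bs q n ≠ 0)
    (hc : ∀ m ≤ n, coef m * w m = qPochs bs q n * qJacobiCoeff q A n m) :
    B n = ∑ m ∈ Finset.range (n + 1), coef m * P m := by
  rw [← mul_div_cancel₀ (B n) hbs,
    qJacobiSum_inversion hq0 hq hA (fun k => B k / qPochs bs q k) le_rfl, Finset.mul_sum]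
  refine Finset.sum_congr rfl fun m hm => ?_
  rw [hP, ← mul_assoc, ← mul_assoc, hc m (Nat.lt_succ_iff.1 (Finset.mem_range.1 hm))]

/-- The inversion formula for a family `P` expressed through `qJacobiSum` with `A = 0`, for an
arbitrary coefficient sequence `u`. -/
theorem inversion_of_eq_qJacobiSum_zero (hq0 : q ≠ 0) (hq : ∀ k : ℕ, 0 < k → q ^ k ≠ 1) {n : ℕ}
    {u P w coef : ℕ → ℂ} {X : ℂ} (Y : ℂ) (hP : ∀ m, P m = w m * qJacobiSum q 0 u m)
    (hX : X = Y * u n) (hc : ∀ m ≤ n, coef m * w m = Y * qJacobiCoeff q 0 n m) :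
    X = ∑ m ∈ Finset.range (n + 1), coef m * P m := by
  rw [hX, qJacobiSum_inversion hq0 hq (zero_mul_pow_ne_one q n) u le_rfl, Finset.mul_sum]
  refine Finset.sum_congr rfl fun m hm => ?_
  rw [hP, ← mul_assoc, ← mul_assoc, hc m (Nat.lt_succ_iff.1 (Finset.mem_range.1 hm))]

/-- The inversion formula for a family `P` expressed through `qMeixnerSum`. -/
theorem inversion_of_eq_qMeixnerSum (hq0 : q ≠ 0) (hq : ∀ k : ℕ, 0 < k → q ^ k ≠ 1) {n : ℕ}
    {u P w coef : ℕ → ℂ} {X : ℂ} (Y : ℂ) (hP : ∀ m, P m = w m * qMeixnerSum q u m)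
    (hX : X = Y * u n) (hc : ∀ m ≤ n, coef m * w m = Y * qMeixnerCoeff q n m) :
    X = ∑ m ∈ Finset.range (n + 1), coef m * P m := by
  rw [hX, qMeixnerSum_inversion hq0 hq u n, Finset.mul_sum]
  refine Finset.sum_congr rfl fun m hm => ?_
  rw [hP, ← mul_assoc, ← mul_assoc, hc m (Nat.lt_succ_iff.1 (Finset.mem_range.1 hm))]

theorem qJacobiCoeff_zero (q : ℂ) (n m : ℕ) :
    qJacobiCoeff q 0 n m = (-1) ^ m * qBinom q n m * q ^ m.choose 2 := by
  simp [qJacobiCoeff, qPoch_zero_left]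

theorem qJacobiCoeff_mul_self (q A : ℂ) (n m : ℕ) :
    qJacobiCoeff q (A * q) n m = (-1) ^ m * qBinom q n m * q ^ m.choose 2
      / (qPoch (A * q ^ (m + 1)) q m * qPoch (A * q ^ (2 * m + 2)) q (n - m)) := by
  rw [qJacobiCoeff, mul_assoc A, mul_assoc A, ← pow_succ', ← pow_succ']

theorem qJacobiCoeff_div_self (hq0 : q ≠ 0) (A : ℂ) (n m : ℕ) :
    qJacobiCoeff q (A / q) n m = (-1) ^ m * qBinom q n m * q ^ m.choose 2
      / (qPoch (A * q ^ ((m : ℤ) - 1)) q m * qPoch (A * q ^ (2 * m)) q (n - m)) := by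
  rw [qJacobiCoeff, mul_zpow_sub_one hq0, pow_succ', ← mul_assoc (A / q), div_mul_cancel₀ _ hq0]

theorem div_mul_pow_ne_one (hq0 : q ≠ 0) {A : ℂ} {n : ℕ}
    (h : ∀ k : ℕ, k + 1 < 2 * n → A * q ^ k ≠ 1) (k : ℕ) (h1 : 1 ≤ k) (hk : k < 2 * n) :
    A / q * q ^ k ≠ 1 := by
  obtain ⟨k, rfl⟩ : ∃ i, k = i + 1 := ⟨_, (Nat.sub_add_cancel h1).symm⟩
  rw [pow_succ', ← mul_assoc, div_mul_cancel₀ _ hq0]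
  exact h k hk

theorem mul_mul_pow_ne_one {A : ℂ} {n : ℕ}
    (h : ∀ k : ℕ, 2 ≤ k → k ≤ 2 * n → A * q ^ k ≠ 1) (k : ℕ) (h1 : 1 ≤ k) (hk : k < 2 * n) :
    A * q * q ^ k ≠ 1 := by
  rw [mul_assoc, ← pow_succ']
  exact h (k + 1) (by omega) (by omega)

theorem self_mul_pow_ne_one (hq : ∀ k : ℕ, 0 < k → q ^ k ≠ 1) (k : ℕ) : q * q ^ k ≠ 1 := by
  rw [← pow_succ']
  exact hq _ k.succ_pos

theorem expI_ne_zero (θ : ℂ) : expI θ ≠ 0 := Complex.exp_ne_zero _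

theorem expI_nat_mul (n : ℕ) (θ : ℂ) : expI (n * θ) = expI θ ^ n := by
  rw [expI, expI, ← Complex.exp_nat_mul]
  congr 1
  ring

theorem expI_mul_expI_neg (θ : ℂ) : expI θ * expI (-θ) = 1 := by
  rw [expI, expI, ← Complex.exp_add, ← Complex.exp_zero]
  congr 1
  ring

theorem askeyWilson_inversion (hq0 : q ≠ 0) (hq : ∀ k : ℕ, 0 < k → q ^ k ≠ 1) (a b c d θ : ℂ)
    (n : ℕ) (ha : a ≠ 0) (hD : qPochs [a * b, a * c, a * d] q n ≠ 0)
    (hA : ∀ k : ℕ, k + 1 < 2 * n → a * b * c * d * q ^ k ≠ 1) :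
    qPochs [a * expI θ, a * expI (-θ)] q n = ∑ m ∈ Finset.range (n + 1),
        (qBinom q n m * q ^ (m.choose 2) * (-a) ^ m
          * (qPochs [a * b * q ^ m, a * c * q ^ m, a * d * q ^ m] q (n - m)
            / (qPoch (a * b * c * d * q ^ ((m : ℤ) - 1)) q m
              * qPoch (a * b * c * d * q ^ (2 * m)) q (n - m))))
        * askeyWilson q a b c d m θ := by
  refine inversion_of_eq_qJacobiSum hq0 hq (div_mul_pow_ne_one hq0 hA)
    (askeyWilson_eq hq0 a b c d θ) hD fun m hm => ?_
  rw [qPochs_split _ q hm, qJacobiCoeff_div_self hq0, neg_pow a]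
  simp only [List.map_cons, List.map_nil]
  field_simp

theorem qRacah_inversion (hq0 : q ≠ 0) (hq : ∀ k : ℕ, 0 < k → q ^ k ≠ 1) (α β γ δ x : ℂ) (n : ℕ)
    (hD : qPochs [α * q, β * δ * q, γ * q] q n ≠ 0)
    (hA : ∀ k : ℕ, 2 ≤ k → k ≤ 2 * n → α * β * q ^ k ≠ 1) :
    qPochs [q ^ (-x), γ * δ * q ^ (x + 1)] q n = ∑ m ∈ Finset.range (n + 1),
        ((-1) ^ m * qBinom q n m * q ^ (m.choose 2)
          * (qPochs [α * q, β * δ * q, γ * q] q n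
            / (qPoch (α * β * q ^ (m + 1)) q m * qPoch (α * β * q ^ (2 * m + 2)) q (n - m))))
        * qRacah q α β γ δ m x := by
  refine inversion_of_eq_qJacobiSum hq0 hq (mul_mul_pow_ne_one hA)
    (qRacah_eq hq0 α β γ δ x) hD fun m hm => ?_
  rw [qJacobiCoeff_mul_self]
  ring

theorem contDualQHahn_inversion (hq0 : q ≠ 0) (hq : ∀ k : ℕ, 0 < k → q ^ k ≠ 1) (a b c θ : ℂ)
    (n : ℕ) (ha : a ≠ 0) (hD : qPochs [a * b, a * c] q n ≠ 0) :
    qPochs [a * expI θ, a * expI (-θ)] q n = ∑ m ∈ Finset.range (n + 1),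
        (qBinom q n m * q ^ (m.choose 2) * (-a) ^ m
          * qPochs [a * b * q ^ m, a * c * q ^ m] q (n - m))
        * contDualQHahn q a b c m θ := by
  refine inversion_of_eq_qJacobiSum hq0 hq (zero_mul_pow_ne_one q n)
    (contDualQHahn_eq hq0 a b c θ) hD fun m hm => ?_
  rw [qPochs_split _ q hm, qJacobiCoeff_zero, neg_pow a]
  simp only [List.map_cons, List.map_nil]
  field_simp

theorem contQHahn_inversion (hq0 : q ≠ 0) (hq : ∀ k : ℕ, 0 < k → q ^ k ≠ 1) (φ a b c d θ : ℂ)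
    (n : ℕ) (ha : a ≠ 0) (hD : qPochs [a * b * expI (2 * φ), a * c, a * d] q n ≠ 0)
    (hA : ∀ k : ℕ, k + 1 < 2 * n → a * b * c * d * q ^ k ≠ 1) :
    qPochs [a * expI (θ + 2 * φ), a * expI (-θ)] q n = ∑ m ∈ Finset.range (n + 1),
        (qBinom q n m * q ^ (m.choose 2) * (-(a * expI φ)) ^ m
          * (qPochs [a * b * expI (2 * φ) * q ^ m, a * c * q ^ m, a * d * q ^ m] q (n - m)
            / (qPoch (a * b * c * d * q ^ ((m : ℤ) - 1)) q m
              * qPoch (a * b * c * d * q ^ (2 * m)) q (n - m))))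
        * contQHahn q φ a b c d m θ := by
  refine inversion_of_eq_qJacobiSum hq0 hq (div_mul_pow_ne_one hq0 hA)
    (contQHahn_eq hq0 φ a b c d θ) hD fun m hm => ?_
  rw [qPochs_split _ q hm, qJacobiCoeff_div_self hq0, neg_pow (a * expI φ)]
  simp only [List.map_cons, List.map_nil]
  have he := expI_ne_zero φ
  field_simp

theorem bigQJacobi_inversion (hq0 : q ≠ 0) (hq : ∀ k : ℕ, 0 < k → q ^ k ≠ 1) (a b c x : ℂ) (n : ℕ)
    (hD : qPochs [a * q, c * q] q n ≠ 0) (hA : ∀ k : ℕ, 2 ≤ k → k ≤ 2 * n → a * b * q ^ k ≠ 1) :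
    qPoch x q n = ∑ m ∈ Finset.range (n + 1),
        ((-1) ^ m * qBinom q n m * q ^ (m.choose 2)
          * (qPochs [a * q, c * q] q n
            / (qPoch (a * b * q ^ (2 * m + 2)) q (n - m) * qPoch (a * b * q ^ (m + 1)) q m)))
        * bigQJacobi q a b c m x := by
  refine inversion_of_eq_qJacobiSum hq0 hq (mul_mul_pow_ne_one hA)
    (bigQJacobi_eq hq0 a b c x) hD fun m hm => ?_
  rw [qJacobiCoeff_mul_self]
  ring

theorem qHahn_inversion (hq0 : q ≠ 0) (hq : ∀ k : ℕ, 0 < k → q ^ k ≠ 1) (α β y : ℂ) (N n : ℕ)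
    (hN : n ≤ N) (hα : qPoch (α * q) q n ≠ 0)
    (hA : ∀ k : ℕ, 2 ≤ k → k ≤ 2 * n → α * β * q ^ k ≠ 1) :
    qPoch y q n = ∑ m ∈ Finset.range (n + 1),
        (qBinom q n m * q ^ (m.choose 2)
          * (qPochs [q ^ (-(N : ℤ)), α * q] q n * (-1) ^ m
            / (qPoch (α * β * q ^ (m + 1)) q m * qPoch (α * β * q ^ (2 * m + 2)) q (n - m))))
        * qHahn q α β N m y := by
  have hD : qPochs [α * q, q ^ (-(N : ℤ))] q n ≠ 0 := by
    rw [qPochs_cons, qPochs_cons, qPochs_nil, mul_one]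
    exact mul_ne_zero hα (qPoch_neg_ne_zero hq0 hq hN)
  refine inversion_of_eq_qJacobiSum hq0 hq (mul_mul_pow_ne_one hA)
    (qHahn_eq hq0 α β y N) hD fun m hm => ?_
  rw [qJacobiCoeff_mul_self]
  simp only [qPochs_cons, qPochs_nil]
  ring

theorem dualQHahn_inversion (hq0 : q ≠ 0) (hq : ∀ k : ℕ, 0 < k → q ^ k ≠ 1) (γ δ x : ℂ) (N n : ℕ)
    (hN : n ≤ N) (hγ : qPoch (γ * q) q n ≠ 0) :
    qPochs [q ^ (-x), γ * δ * q ^ (x + 1)] q n = ∑ m ∈ Finset.range (n + 1),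
        (qPochs [γ * q, q ^ (-(N : ℤ))] q n * (-1) ^ m * qBinom q n m * q ^ (m.choose 2))
        * dualQHahn q γ δ N m x := by
  have hD : qPochs [γ * q, q ^ (-(N : ℤ))] q n ≠ 0 := by
    rw [qPochs_cons, qPochs_cons, qPochs_nil, mul_one]
    exact mul_ne_zero hγ (qPoch_neg_ne_zero hq0 hq hN)
  refine inversion_of_eq_qJacobiSum hq0 hq (zero_mul_pow_ne_one q n)
    (dualQHahn_eq hq0 γ δ x N) hD fun m hm => ?_
  rw [qJacobiCoeff_zero]
  ring

theorem alSalamChihara_inversion (hq0 : q ≠ 0) (hq : ∀ k : ℕ, 0 < k → q ^ k ≠ 1) (a b θ : ℂ)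
    (n : ℕ) (ha : a ≠ 0) (hab : qPoch (a * b) q n ≠ 0) :
    qPochs [a * expI θ, a * expI (-θ)] q n = ∑ m ∈ Finset.range (n + 1),
        ((-a) ^ m * qPoch (a * b * q ^ m) q (n - m) * qBinom q n m * q ^ (m.choose 2))
        * alSalamChihara q a b m θ := by
  have hD : qPochs [a * b] q n ≠ 0 := by rwa [qPochs_cons, qPochs_nil, mul_one]
  refine inversion_of_eq_qJacobiSum hq0 hq (zero_mul_pow_ne_one q n)
    (alSalamChihara_eq hq0 a b θ) hD fun m hm => ?_
  rw [qPochs_split _ q hm, qJacobiCoeff_zero, neg_pow a]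
  simp only [List.map_cons, List.map_nil]
  simp only [qPochs_cons, qPochs_nil]
  field_simp

theorem qMeixnerPollaczek_inversion (hq0 : q ≠ 0) (hq : ∀ k : ℕ, 0 < k → q ^ k ≠ 1) (φ a θ : ℂ)
    (n : ℕ) (ha : a ≠ 0) (ha2 : qPoch (a ^ 2) q n ≠ 0) :
    qPochs [a * expI (θ + 2 * φ), a * expI (-θ)] q n = ∑ m ∈ Finset.range (n + 1),
        (qPoch (a ^ 2 * q ^ m) q (n - m) * qPoch q q m * (-(a * expI φ)) ^ m
          * qBinom q n m * q ^ (m.choose 2))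
        * qMeixnerPollaczek q φ a m θ := by
  have hD : qPochs [a ^ 2] q n ≠ 0 := by rwa [qPochs_cons, qPochs_nil, mul_one]
  refine inversion_of_eq_qJacobiSum hq0 hq (zero_mul_pow_ne_one q n)
    (qMeixnerPollaczek_eq hq0 φ a θ) hD fun m hm => ?_
  rw [qPochs_split _ q hm, qJacobiCoeff_zero, neg_pow (a * expI φ)]
  simp only [List.map_cons, List.map_nil]
  simp only [qPochs_cons, qPochs_nil]
  have he := expI_ne_zero φ
  have hm1 := qPoch_self_ne_zero hq m
  field_simp

theorem contQJacobi_inversion (hq0 : q ≠ 0) (hq : ∀ k : ℕ, 0 < k → q ^ k ≠ 1) (α β θ : ℂ) (n : ℕ)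
    (hD : qPochs [q ^ (α + 1), -q ^ ((α + β + 1) / 2), -q ^ ((α + β + 2) / 2)] q n ≠ 0)
    (hA : ∀ k : ℕ, 2 ≤ k → k ≤ 2 * n → q ^ (α + β + k) ≠ 1) :
    qPochs [q ^ (α / 2 + 1 / 4) * expI θ, q ^ (α / 2 + 1 / 4) * expI (-θ)] q n
        = ∑ m ∈ Finset.range (n + 1),
        (qPochs [-q ^ ((α + β + 1) / 2), -q ^ ((α + β + 2) / 2)] q n * qBinom q n m
          * ((-1) ^ m * qPoch q q m * qPoch (q ^ (α + m + 1)) q (n - m)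
            / (qPoch (q ^ (m + α + β + 1)) q m * qPoch (q ^ (2 * m + α + β + 2)) q (n - m)))
          * q ^ (m.choose 2))
        * contQJacobi q α β m θ := by
  refine inversion_of_eq_qJacobiSum hq0 hq (A := q ^ (α + β + 1))
    (fun k hk hk2 => ?_)
    (contQJacobi_eq hq0 α β θ) hD fun m hm => ?_
  · rw [← cpow_add_natCast hq0]
    convert hA (k + 1) (by omega) (by omega) using 2
    push_cast
    ring
  rw [qJacobiCoeff]
  simp only [qPochs_cons, qPochs_nil]
  have hm1 := qPoch_self_ne_zero hq m
  rw [qPoch_split (q ^ (α + 1)) q hm, ← cpow_add_natCast hq0, ← cpow_add_natCast hq0,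
    ← cpow_add_natCast hq0, show α + 1 + m = α + m + 1 by ring,
    show α + β + 1 + m = m + α + β + 1 by ring,
    show α + β + 1 + (2 * m + 1 : ℕ) = 2 * m + α + β + 2 by push_cast; ring]
  field_simp

theorem rogers_inversion (hq0 : q ≠ 0) (hq : ∀ k : ℕ, 0 < k → q ^ k ≠ 1) (β θ : ℂ) (n : ℕ)
    (hβ : β ≠ 0) (hA : ∀ k : ℕ, k < 2 * n → β ^ 2 * q ^ k ≠ 1) :
    qPochs [β ^ (1 / 2 : ℂ) * expI θ, β ^ (1 / 2 : ℂ) * expI (-θ)] q n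
        = ∑ m ∈ Finset.range (n + 1),
        (qBinom q n m * q ^ (m.choose 2)
          * (qPochs [β * q ^ (1 / 2 : ℂ), -β, -(β * q ^ (1 / 2 : ℂ))] q n
            / (qPoch (β ^ 2 * q ^ m) q m * qPoch (β ^ 2) q m))
          * ((-β ^ (1 / 2 : ℂ)) ^ m * qPoch q q m / qPoch (β ^ 2 * q ^ (2 * m + 1)) q (n - m)))
        * rogers q β m θ := by
  have hs : (q ^ (1 / 2 : ℂ)) ^ 2 = q := by rw [← Complex.cpow_mul_nat]; simp
  -- A zero of one of the three factors squares to a relation `β² q ^ i = 1` excluded by `hA`.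
  have hD : qPochs [β * q ^ (1 / 2 : ℂ), -β, -(β * q ^ (1 / 2 : ℂ))] q n ≠ 0 := by
    simp only [qPochs_cons, qPochs_nil, mul_one, mul_ne_zero_iff, qPoch_ne_zero_iff]
    refine ⟨fun k hk h => hA (2 * k + 1) (by omega) ?_, fun k hk h => hA (2 * k) (by omega) ?_,
      fun k hk h => hA (2 * k + 1) (by omega) ?_⟩
    · calc _ = (β * q ^ (1 / 2 : ℂ) * q ^ k) ^ 2 := by rw [mul_pow, mul_pow, hs]; ring
        _ = 1 := by rw [h, one_pow]
    · calc _ = (-β * q ^ k) ^ 2 := by ring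
        _ = 1 := by rw [h, one_pow]
    · calc _ = (-(β * q ^ (1 / 2 : ℂ)) * q ^ k) ^ 2 := by
            rw [mul_pow, neg_sq, mul_pow, hs]; ring
        _ = 1 := by rw [h, one_pow]
  refine inversion_of_eq_qJacobiSum hq0 hq (fun k _ hk => hA k hk)
    (rogers_eq hq0 β θ) hD fun m hm => ?_
  rw [qJacobiCoeff, neg_pow (β ^ (1 / 2 : ℂ))]
  have hm1 := qPoch_self_ne_zero hq m
  have hm2 : qPoch (β ^ 2) q m ≠ 0 := qPoch_ne_zero_iff.2 fun k hk => hA k (by omega)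
  have hm3 : (β ^ (1 / 2 : ℂ)) ^ m * β ^ (-(m : ℂ) / 2) = 1 := by
    rw [← Complex.cpow_mul_nat, ← Complex.cpow_add _ _ hβ,
      show 1 / 2 * (m : ℂ) + -m / 2 = 0 by ring, Complex.cpow_zero]
  generalize β ^ (-(m : ℂ) / 2) = e at hm3 ⊢
  field_simp
  linear_combination (qBinom q n m / qPoch (β ^ 2 * q ^ m) q m
    / qPoch (β ^ 2 * q ^ (2 * m + 1)) q (n - m)) * hm3

theorem contQLegendre_inversion (hq0 : q ≠ 0) (hq : ∀ k : ℕ, 0 < k → q ^ k ≠ 1) (θ : ℂ) (n : ℕ) :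
    qPochs [q ^ (1 / 4 : ℂ) * expI θ, q ^ (1 / 4 : ℂ) * expI (-θ)] q n
        = ∑ m ∈ Finset.range (n + 1),
        (qBinom q n m
          * (qPochs [q, -q ^ (1 / 2 : ℂ), -q] q n
            / (qPoch (q ^ (m + 1)) q m * qPoch (q ^ (2 * m + 2)) q (n - m)))
          * (-1) ^ m * q ^ (m.choose 2))
        * contQLegendre q m θ := by
  have hs : (q ^ (1 / 2 : ℂ)) ^ 2 = q := by rw [← Complex.cpow_mul_nat]; simp
  -- A zero of one of the last two factors squares to `q ^ i = 1` with `i > 0`.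
  have hD : qPochs [q, -q ^ (1 / 2 : ℂ), -q] q n ≠ 0 := by
    simp only [qPochs_cons, qPochs_nil, mul_one, mul_ne_zero_iff, qPoch_ne_zero_iff]
    refine ⟨fun k hk => self_mul_pow_ne_one hq k, fun k hk h => hq (2 * k + 1) (by omega) ?_,
      fun k hk h => hq (2 * k + 2) (by omega) ?_⟩
    · calc _ = (-q ^ (1 / 2 : ℂ) * q ^ k) ^ 2 := by rw [mul_pow, neg_sq, hs]; ring
        _ = 1 := by rw [h, one_pow]
    · calc _ = (-q * q ^ k) ^ 2 := by ring
        _ = 1 := by rw [h, one_pow]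
  refine inversion_of_eq_qJacobiSum hq0 hq (fun k _ _ => self_mul_pow_ne_one hq k)
    (contQLegendre_eq hq0 θ) hD fun m hm => ?_
  rw [qJacobiCoeff, ← pow_succ', ← pow_succ']
  ring

theorem bigQLaguerre_inversion (hq0 : q ≠ 0) (hq : ∀ k : ℕ, 0 < k → q ^ k ≠ 1) (a b x : ℂ) (n : ℕ)
    (hD : qPochs [a * q, b * q] q n ≠ 0) :
    qPoch x q n = ∑ m ∈ Finset.range (n + 1),
        (qPochs [a * q, b * q] q n * (-1) ^ m * qBinom q n m * q ^ (m.choose 2))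
        * bigQLaguerre q a b m x := by
  refine inversion_of_eq_qJacobiSum hq0 hq (zero_mul_pow_ne_one q n)
    (bigQLaguerre_eq hq0 a b x) hD fun m hm => ?_
  rw [qJacobiCoeff_zero]
  ring

theorem littleQJacobi_inversion (hq0 : q ≠ 0) (hq : ∀ k : ℕ, 0 < k → q ^ k ≠ 1) (a b x : ℂ)
    (n : ℕ) (ha : qPoch (a * q) q n ≠ 0) (hA : ∀ k : ℕ, 2 ≤ k → k ≤ 2 * n → a * b * q ^ k ≠ 1) :
    x ^ n = ∑ m ∈ Finset.range (n + 1),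
        (qBinom q n m
          * ((-1) ^ m * qPoch (a * q) q n
            / (qPoch (a * b * q ^ (m + 1)) q m * qPoch (a * b * q ^ (2 * m + 2)) q (n - m)))
          * q ^ (m.choose 2))
        * littleQJacobi q a b m x := by
  have hD : qPochs [a * q] q n ≠ 0 := by rwa [qPochs_cons, qPochs_nil, mul_one]
  refine inversion_of_eq_qJacobiSum hq0 hq (mul_mul_pow_ne_one hA)
    (littleQJacobi_eq hq0 a b x) hD fun m hm => ?_
  rw [qJacobiCoeff_mul_self]
  simp only [qPochs_cons, qPochs_nil]
  ring

theorem littleQLegendre_inversion (hq0 : q ≠ 0) (hq : ∀ k : ℕ, 0 < k → q ^ k ≠ 1) (x : ℂ) (n : ℕ) :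
    x ^ n = ∑ m ∈ Finset.range (n + 1),
        (qBinom q n m
          * (q ^ (m.choose 2) * (-1) ^ m * qPoch q q n
            / (qPoch (q ^ (m + 1)) q m * qPoch (q ^ (2 * m + 2)) q (n - m))))
        * littleQLegendre q m x := by
  have hD : qPochs [q] q n ≠ 0 := by
    rw [qPochs_cons, qPochs_nil, mul_one]
    exact qPoch_self_ne_zero hq n
  refine inversion_of_eq_qJacobiSum hq0 hq (fun k _ _ => self_mul_pow_ne_one hq k)
    (littleQLegendre_eq hq0 x) hD fun m hm => ?_
  rw [qJacobiCoeff, ← pow_succ', ← pow_succ']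
  simp only [qPochs_cons, qPochs_nil]
  ring

theorem qMeixner_inversion (hq0 : q ≠ 0) (hq : ∀ k : ℕ, 0 < k → q ^ k ≠ 1) (b c y : ℂ) (n : ℕ)
    (hc : c ≠ 0) (hb : qPoch (b * q) q n ≠ 0) :
    qPoch y q n = ∑ m ∈ Finset.range (n + 1),
        (qPoch (b * q) q n * (-1) ^ (m + n) * c ^ n * qBinom q n m
          * q ^ (((m.choose 2 : ℕ) : ℤ) - m * n + m - n))
        * qMeixner q b c m y := by
  refine inversion_of_eq_qMeixnerSum hq0 hq (qPoch (b * q) q n / (-(q / c)) ^ n)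
    (qMeixner_eq hq0 b c y) ?_ fun m hm => ?_
  · rw [qPochs_cons, qPochs_nil, neg_pow, div_pow]
    field_simp
  · rw [qMeixnerCoeff]
    rw [show (((m.choose 2 : ℕ) : ℤ) - m * n + m - n) = ((m.choose 2 : ℕ) : ℤ) - m * n + m + -n by
      ring, zpow_add₀ hq0 _ (-(n : ℤ)), zpow_neg q (n : ℤ), zpow_natCast q n]
    rw [neg_pow (q / c), div_pow, pow_add]
    have h := neg_one_pow_mul_self n
    field_simp
    linear_combination qBinom q n m * h

theorem quantumQKrawtchouk_inversion (hq0 : q ≠ 0) (hq : ∀ k : ℕ, 0 < k → q ^ k ≠ 1) (p y : ℂ)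
    (N n : ℕ) (hN : n ≤ N) (hp : p ≠ 0) :
    qPoch y q n = ∑ m ∈ Finset.range (n + 1),
        (p ^ (-(n : ℤ)) * qPoch (q ^ (-(N : ℤ))) q n * (-1) ^ m * qBinom q n m
          * q ^ (((m.choose 2 : ℕ) : ℤ) - m * n + m - n))
        * quantumQKrawtchouk q p N m y := by
  refine inversion_of_eq_qMeixnerSum hq0 hq (qPoch (q ^ (-(N : ℤ))) q n / (p * q) ^ n)
    (quantumQKrawtchouk_eq hq0 p y N) ?_ fun m hm => ?_
  · have h := qPoch_neg_ne_zero hq0 hq hN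
    rw [qPochs_cons, qPochs_nil]
    field_simp
  · rw [qMeixnerCoeff]
    rw [show (((m.choose 2 : ℕ) : ℤ) - m * n + m - n) = ((m.choose 2 : ℕ) : ℤ) - m * n + m + -n by
      ring, zpow_add₀ hq0 _ (-(n : ℤ)), zpow_neg q (n : ℤ), zpow_natCast q n]
    rw [mul_pow p q n, zpow_neg p, zpow_natCast p]
    field_simp

theorem qKrawtchouk_inversion (hq0 : q ≠ 0) (hq : ∀ k : ℕ, 0 < k → q ^ k ≠ 1) (p y : ℂ) (N n : ℕ)
    (hN : n ≤ N) (hA : ∀ k : ℕ, 1 ≤ k → k < 2 * n → -p * q ^ k ≠ 1) :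
    qPoch y q n = ∑ m ∈ Finset.range (n + 1),
        ((-1) ^ m * qBinom q n m * q ^ (m.choose 2)
          * (qPoch (q ^ (-(N : ℤ))) q n
            / (qPoch (-p * q ^ m) q m * qPoch (-p * q ^ (2 * m + 1)) q (n - m))))
        * qKrawtchouk q p N m y := by
  have hD : qPochs [q ^ (-(N : ℤ))] q n ≠ 0 := by
    rw [qPochs_cons, qPochs_nil, mul_one]
    exact qPoch_neg_ne_zero hq0 hq hN
  refine inversion_of_eq_qJacobiSum hq0 hq hA
    (qKrawtchouk_eq hq0 p y N) hD fun m hm => ?_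
  rw [qJacobiCoeff]
  simp only [qPochs_cons, qPochs_nil]
  ring

theorem affineQKrawtchouk_inversion (hq0 : q ≠ 0) (hq : ∀ k : ℕ, 0 < k → q ^ k ≠ 1) (p y : ℂ)
    (N n : ℕ) (hN : n ≤ N) (hp : qPoch (p * q) q n ≠ 0) :
    qPoch y q n = ∑ m ∈ Finset.range (n + 1),
        (qPochs [p * q, q ^ (-(N : ℤ))] q n * (-1) ^ m * qBinom q n m * q ^ (m.choose 2))
        * affineQKrawtchouk q p N m y := by
  have hD : qPochs [p * q, q ^ (-(N : ℤ))] q n ≠ 0 := by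
    rw [qPochs_cons, qPochs_cons, qPochs_nil, mul_one]
    exact mul_ne_zero hp (qPoch_neg_ne_zero hq0 hq hN)
  refine inversion_of_eq_qJacobiSum hq0 hq (zero_mul_pow_ne_one q n)
    (affineQKrawtchouk_eq hq0 p y N) hD fun m hm => ?_
  rw [qJacobiCoeff_zero]
  ring

theorem dualQKrawtchouk_inversion (hq0 : q ≠ 0) (hq : ∀ k : ℕ, 0 < k → q ^ k ≠ 1) (c x : ℂ)
    (N n : ℕ) (hN : n ≤ N) :
    qPochs [q ^ (-x), c * q ^ (x - N)] q n = ∑ m ∈ Finset.range (n + 1),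
        (qPoch (q ^ (-(N : ℤ))) q n * (-1) ^ m * qBinom q n m * q ^ (m.choose 2))
        * dualQKrawtchouk q c N m x := by
  have hD : qPochs [q ^ (-(N : ℤ))] q n ≠ 0 := by
    rw [qPochs_cons, qPochs_nil, mul_one]
    exact qPoch_neg_ne_zero hq0 hq hN
  refine inversion_of_eq_qJacobiSum hq0 hq (zero_mul_pow_ne_one q n)
    (dualQKrawtchouk_eq hq0 c x N) hD fun m hm => ?_
  rw [qJacobiCoeff_zero]
  simp only [qPochs_cons, qPochs_nil]
  ring

theorem contBigQHermite_inversion (hq0 : q ≠ 0) (hq : ∀ k : ℕ, 0 < k → q ^ k ≠ 1) (a θ : ℂ)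
    (n : ℕ) (ha : a ≠ 0) :
    qPochs [a * expI θ, a * expI (-θ)] q n = ∑ m ∈ Finset.range (n + 1),
        ((-a) ^ m * qBinom q n m * q ^ (m.choose 2))
        * contBigQHermite q a m θ := by
  refine inversion_of_eq_qJacobiSum hq0 hq (zero_mul_pow_ne_one q n)
    (contBigQHermite_eq hq0 a θ) (by simp [qPochs_nil]) fun m hm => ?_
  rw [qJacobiCoeff_zero, qPochs_nil, neg_pow a]
  field_simp

theorem contQLaguerre_inversion (hq0 : q ≠ 0) (hq : ∀ k : ℕ, 0 < k → q ^ k ≠ 1) (α θ : ℂ) (n : ℕ)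
    (hα : qPoch (q ^ (α + 1)) q n ≠ 0) :
    qPochs [q ^ (α / 2 + 1 / 4) * expI θ, q ^ (α / 2 + 1 / 4) * expI (-θ)] q n
        = ∑ m ∈ Finset.range (n + 1),
        ((-1) ^ m * qBinom q n m * q ^ (m.choose 2) * qPoch q q m
          * qPoch (q ^ (m + α + 1)) q (n - m))
        * contQLaguerre q α m θ := by
  have hD : qPochs [q ^ (α + 1)] q n ≠ 0 := by rwa [qPochs_cons, qPochs_nil, mul_one]
  refine inversion_of_eq_qJacobiSum hq0 hq (zero_mul_pow_ne_one q n)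
    (contQLaguerre_eq hq0 α θ) hD fun m hm => ?_
  rw [qPochs_split _ q hm, qJacobiCoeff_zero]
  simp only [List.map_cons, List.map_nil]
  simp only [qPochs_cons, qPochs_nil]
  have hm1 := qPoch_self_ne_zero hq m
  rw [← cpow_add_natCast hq0, show α + 1 + m = m + α + 1 by ring]
  field_simp

theorem littleQLaguerre_inversion (hq0 : q ≠ 0) (hq : ∀ k : ℕ, 0 < k → q ^ k ≠ 1) (a x : ℂ)
    (n : ℕ) (ha : qPoch (a * q) q n ≠ 0) :
    x ^ n = ∑ m ∈ Finset.range (n + 1),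
        (qPoch (a * q) q n * (-1) ^ m * qBinom q n m * q ^ (m.choose 2))
        * littleQLaguerre q a m x := by
  have hD : qPochs [a * q] q n ≠ 0 := by rwa [qPochs_cons, qPochs_nil, mul_one]
  refine inversion_of_eq_qJacobiSum hq0 hq (zero_mul_pow_ne_one q n)
    (littleQLaguerre_eq hq0 a x) hD fun m hm => ?_
  rw [qJacobiCoeff_zero]
  simp only [qPochs_cons, qPochs_nil]
  ring

theorem qLaguerre_inversion (hq0 : q ≠ 0) (hq : ∀ k : ℕ, 0 < k → q ^ k ≠ 1) (α x : ℂ) (n : ℕ)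
    (hα : qPoch (q ^ (α + 1)) q n ≠ 0) :
    x ^ n = ∑ m ∈ Finset.range (n + 1),
        (q ^ (-(n : ℂ) * (α + m))
          * q ^ (((m.choose 2 : ℕ) : ℤ) - ((n.choose 2 : ℕ) : ℤ) + m - n)
          * (-1) ^ m * qPoch q q m * qPoch (q ^ (α + m + 1)) q (n - m) * qBinom q n m)
        * qLaguerre q α m x := by
  refine inversion_of_eq_qMeixnerSum hq0 hq
    (qPoch (q ^ (α + 1)) q n / ((q ^ (α + 1)) ^ n * q ^ n.choose 2))
    (qLaguerre_eq hq0 α x) ?_ fun m hm => ?_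
  · rw [qPochs_cons, qPochs_nil]
    have h : q ^ (α + 1) ≠ 0 := by simp [Complex.cpow_eq_zero_iff, hq0]
    field_simp
  · rw [qMeixnerCoeff]
    have hm1 := qPoch_self_ne_zero hq m
    have h : q ^ (α + 1) ≠ 0 := by simp [Complex.cpow_eq_zero_iff, hq0]
    -- The complex powers combine to a power of `q` with integer exponent.
    have e1 : q ^ (-(n : ℂ) * (α + m)) * (q ^ (α + 1)) ^ n = q ^ ((n : ℤ) - m * n) := by
      rw [← Complex.cpow_nat_mul, ← Complex.cpow_add _ _ hq0, ← Complex.cpow_intCast]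
      congr 1
      push_cast
      ring
    have e2 : q ^ (((m.choose 2 : ℕ) : ℤ) - m * n + m)
        = q ^ (((m.choose 2 : ℕ) : ℤ) - ((n.choose 2 : ℕ) : ℤ) + m - n) * q ^ n.choose 2
          * q ^ ((n : ℤ) - m * n) := by
      rw [← zpow_natCast q (n.choose 2), ← zpow_add₀ hq0, ← zpow_add₀ hq0]
      congr 1
      ring
    rw [qPoch_split (q ^ (α + 1)) q hm, ← cpow_add_natCast hq0,
      show α + 1 + m = α + m + 1 by ring, e2, ← e1]
    field_simp

theorem altQCharlier_inversion (hq0 : q ≠ 0) (hq : ∀ k : ℕ, 0 < k → q ^ k ≠ 1) (a x : ℂ) (n : ℕ)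
    (hA : ∀ k : ℕ, 1 ≤ k → k < 2 * n → -a * q ^ k ≠ 1) :
    x ^ n = ∑ m ∈ Finset.range (n + 1),
        (qBinom q n m
          * ((-1) ^ m * q ^ (m.choose 2)
            / (qPoch (-a * q ^ m) q m * qPoch (-a * q ^ (2 * m + 1)) q (n - m))))
        * altQCharlier q a m x := by
  refine inversion_of_eq_qJacobiSum hq0 hq hA
    (altQCharlier_eq hq0 a x) (by simp [qPochs_nil]) fun m hm => ?_
  rw [qJacobiCoeff, qPochs_nil]
  ring

theorem qCharlier_inversion (hq0 : q ≠ 0) (hq : ∀ k : ℕ, 0 < k → q ^ k ≠ 1) (a y : ℂ) (n : ℕ)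
    (ha : a ≠ 0) :
    qPoch y q n = ∑ m ∈ Finset.range (n + 1),
        ((-1) ^ (m + n) * a ^ n * qBinom q n m
          * q ^ (((m.choose 2 : ℕ) : ℤ) - n * m + m - n))
        * qCharlier q a m y := by
  refine inversion_of_eq_qMeixnerSum hq0 hq (1 / (-(q / a)) ^ n)
    (qCharlier_eq hq0 a y) ?_ fun m hm => ?_
  · rw [qPochs_nil, neg_pow, div_pow]
    field_simp
  · rw [qMeixnerCoeff]
    rw [mul_comm (m : ℤ) n, show (((m.choose 2 : ℕ) : ℤ) - n * m + m - n)
      = ((m.choose 2 : ℕ) : ℤ) - n * m + m + -n by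
      ring, zpow_add₀ hq0 _ (-(n : ℤ)), zpow_neg q (n : ℤ), zpow_natCast q n]
    rw [neg_pow (q / a), div_pow, pow_add]
    have h := neg_one_pow_mul_self n
    field_simp
    linear_combination qBinom q n m * h

theorem alSalamCarlitzI_inversion (hq0 : q ≠ 0) (hq : ∀ k : ℕ, 0 < k → q ^ k ≠ 1) (a x : ℂ)
    (n : ℕ) (ha : a ≠ 0) (hx : x ≠ 0) :
    x ^ n * qPoch x⁻¹ q n = ∑ m ∈ Finset.range (n + 1),
        (a ^ (n - m) * qBinom q n m) * alSalamCarlitzI q a m x := by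
  refine inversion_of_eq_qJacobiSum_zero hq0 hq (a ^ n)
    (alSalamCarlitzI_eq hq0 a x) ?_ fun m hm => ?_
  · rw [inv_pow]
    field_simp
  · rw [qJacobiCoeff_zero]
    rw [neg_pow a, ← pow_sub_mul_pow a hm]
    ring

theorem alSalamCarlitzII_inversion (hq0 : q ≠ 0) (hq : ∀ k : ℕ, 0 < k → q ^ k ≠ 1) (a x : ℂ)
    (n : ℕ) (ha : a ≠ 0) :
    qPoch x q n = ∑ m ∈ Finset.range (n + 1),
        (a ^ (n - m) * q ^ (n.choose 2) * q ^ (((m : ℤ) - n) * m) * (-1) ^ n * qBinom q n m)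
        * alSalamCarlitzII q a m x := by
  refine inversion_of_eq_qMeixnerSum hq0 hq ((-a) ^ n * q ^ n.choose 2)
    (alSalamCarlitzII_eq hq0 a x) ?_ fun m hm => ?_
  · have h : (-a) ^ n ≠ 0 := pow_ne_zero _ (neg_ne_zero.2 ha)
    rw [← inv_neg, inv_pow]
    field_simp
  · rw [qMeixnerCoeff]
    have hz : q ^ (((m : ℤ) - n) * m)
        = q ^ (((m.choose 2 : ℕ) : ℤ) - m * n + m) * q ^ m.choose 2 := by
      rw [mul_comm, zpow_mul_sub_eq hq0, ← pow_choose_two_mul_self, zpow_add₀ hq0, zpow_sub₀ hq0,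
        ← Nat.cast_mul, zpow_natCast, zpow_natCast, zpow_natCast, mul_comm n m]
      ring
    rw [hz]
    rw [neg_pow a, neg_pow a, ← pow_sub_mul_pow a hm]
    field_simp

theorem contQHermite_inversion (hq0 : q ≠ 0) (hq : ∀ k : ℕ, 0 < k → q ^ k ≠ 1) (θ : ℂ) (n : ℕ) :
    expI (-2 * n * θ) = ∑ m ∈ Finset.range (n + 1),
        (expI (-m * θ) * q ^ ((m : ℤ) * (1 - n)) * (-1) ^ (n + m)
          * q ^ (n.choose 2) * q ^ (m.choose 2) * qBinom q n m)
        * contQHermite q m θ := by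
  refine inversion_of_eq_qMeixnerSum hq0 hq ((-1) ^ n * q ^ n.choose 2)
    (contQHermite_eq hq0 θ) ?_ fun m hm => ?_
  · have h := neg_one_pow_mul_self n
    rw [show -2 * (n : ℂ) * θ = n * (-2 * θ) by ring, expI_nat_mul]
    generalize expI (-2 * θ) = e
    field_simp
    linear_combination (-e ^ n) * h
  · rw [qMeixnerCoeff]
    rw [show -(m : ℂ) * θ = m * -θ by ring, expI_nat_mul, expI_nat_mul, pow_add]
    have h : expI (-θ) ^ m * expI θ ^ m = 1 := by
      rw [← mul_pow, mul_comm, expI_mul_expI_neg, one_pow]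
    have hz : q ^ (((m.choose 2 : ℕ) : ℤ) - m * n + m)
        = q ^ ((m : ℤ) * (1 - n)) * q ^ m.choose 2 := by
      rw [← zpow_natCast q (m.choose 2), ← zpow_add₀ hq0]
      congr 1
      ring
    rw [hz]
    linear_combination (q ^ ((m : ℤ) * (1 - n)) * ((-1) ^ n * (-1) ^ m) * q ^ n.choose 2
      * q ^ m.choose 2 * qBinom q n m) * h

theorem stieltjesWigert_inversion (hq0 : q ≠ 0) (hq : ∀ k : ℕ, 0 < k → q ^ k ≠ 1) (x : ℂ) (n : ℕ) :
    x ^ n = ∑ m ∈ Finset.range (n + 1),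
        (qPoch q q m * (-1) ^ m
          * q ^ (((m.choose 2 : ℕ) : ℤ) - ((n.choose 2 : ℕ) : ℤ) - n * m + m - n)
          * qBinom q n m)
        * stieltjesWigert q m x := by
  refine inversion_of_eq_qMeixnerSum hq0 hq (1 / (q ^ n.choose 2 * q ^ n))
    (stieltjesWigert_eq hq0 x) ?_ fun m hm => ?_
  · field_simp
  · rw [qMeixnerCoeff]
    have hm1 := qPoch_self_ne_zero hq m
    rw [show ((m.choose 2 : ℕ) : ℤ) - ((n.choose 2 : ℕ) : ℤ) - n * m + m - n
      = ((m.choose 2 : ℕ) : ℤ) - m * n + m + (-(n.choose 2 : ℕ) + -(n : ℤ)) by ring,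
      zpow_add₀ hq0 _ (-((n.choose 2 : ℕ) : ℤ) + _), zpow_add₀ hq0 (-((n.choose 2 : ℕ) : ℤ)),
      zpow_neg,
      zpow_neg, zpow_natCast, zpow_natCast]
    field_simp

theorem discreteQHermiteI_inversion (hq0 : q ≠ 0) (hq : ∀ k : ℕ, 0 < k → q ^ k ≠ 1) (x : ℂ)
    (n : ℕ) (_hx : x ≠ 0) :
    x ^ n * qPoch x⁻¹ q n = ∑ m ∈ Finset.range (n + 1),
        ((-1) ^ (m + n) * qBinom q n m) * discreteQHermiteI q m x := by
  refine inversion_of_eq_qJacobiSum_zero hq0 hq ((-1) ^ n)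
    (discreteQHermiteI_eq hq0 x) ?_ fun m hm => ?_
  · rw [← mul_assoc, neg_one_pow_mul_self, one_mul]
  · rw [qJacobiCoeff_zero]
    ring

theorem discreteQHermiteII_inversion (hq0 : q ≠ 0) (hq : ∀ k : ℕ, 0 < k → q ^ k ≠ 1) (x : ℂ)
    (n : ℕ) :
    qPoch (Complex.I * x) q n = ∑ m ∈ Finset.range (n + 1),
        ((-Complex.I) ^ m * q ^ (((m : ℤ) - n) * m) * q ^ (n.choose 2) * qBinom q n m)
        * discreteQHermiteII q m x := by
  refine inversion_of_eq_qMeixnerSum hq0 hq (q ^ n.choose 2)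
    (discreteQHermiteII_eq hq0 x) ?_ fun m hm => ?_
  · field_simp
  · rw [qMeixnerCoeff]
    have hz : q ^ (((m : ℤ) - n) * m)
        = q ^ (((m.choose 2 : ℕ) : ℤ) - m * n + m) * q ^ m.choose 2 := by
      rw [mul_comm, zpow_mul_sub_eq hq0, ← pow_choose_two_mul_self, zpow_add₀ hq0, zpow_sub₀ hq0,
        ← Nat.cast_mul, zpow_natCast, zpow_natCast, zpow_natCast, mul_comm n m]
      ring
    rw [hz]
    rw [neg_pow Complex.I]
    field_simp

/-! ### Connection formulas -/

theorem zpow_mul_sub_mul_pow (hq0 : q ≠ 0) {m n : ℕ} (hm : m ≤ n) :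
    q ^ ((m : ℤ) * (m - n)) * (q ^ m) ^ (n - m) = 1 := by
  rw [← pow_mul, ← zpow_natCast, ← zpow_add₀ hq0, Nat.cast_mul, Nat.cast_sub hm, ← mul_add,
    sub_add_sub_cancel', sub_self, mul_zero, zpow_zero]

theorem mul_zpow_add_sub_one (hq0 : q ≠ 0) (A : ℂ) (n m : ℕ) :
    A * q ^ ((n : ℤ) + m - 1) = A / q * q ^ (n + m) := by
  rw [← Nat.cast_add, mul_zpow_sub_one hq0]

theorem expI_mul_sub (φ : ℂ) (m n : ℕ) : expI (φ * (m - n)) = expI φ ^ m / expI φ ^ n := by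
  rw [← expI_nat_mul, ← expI_nat_mul, expI, expI, expI, ← Complex.exp_sub]
  congr 1
  ring

/-- The connection formula for two families with common numerator `B`, expressed through
`qJacobiSum`. -/
theorem connection_of_eq_qJacobiSum (hq0 : q ≠ 0) (hq : ∀ k : ℕ, 0 < k → q ^ k ≠ 1) {A A' : ℂ}
    {n : ℕ} (hA' : ∀ k : ℕ, 1 ≤ k → k < 2 * n → A' * q ^ k ≠ 1) {B Q w' c H : ℕ → ℂ} {P w : ℂ}
    {bs bs' : List ℂ} (hP : P = w * qJacobiSum q A (fun k => B k / qPochs bs q k) n)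
    (hQ : ∀ m, Q m = w' m * qJacobiSum q A' (fun k => B k / qPochs bs' q k) m)
    (hlen : bs.length = bs'.length) (hbs' : qPochs bs' q n ≠ 0)
    (hH : ∀ m, H m = qHyp (q ^ ((m : ℤ) - n) :: A * q ^ (n + m) :: bs'.map (· * q ^ m))
      (A' * q ^ (2 * m + 1) :: bs.map (· * q ^ m)) q q)
    (hc : ∀ m ≤ n, c m * w' m = w * (q ^ ((m : ℤ) * (m - n)) * qBinom q n m
      * (qPoch (A * q ^ n) q m * qPochs bs' q m / (qPoch (A' * q ^ m) q m * qPochs bs q m)))) :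
    P = ∑ m ∈ Finset.range (n + 1), c m * H m * Q m := by
  rw [hP, qJacobiSum_connection_qHyp hq0 hq A hA' B bs hlen hbs', Finset.mul_sum]
  refine Finset.sum_congr rfl fun m hm => ?_
  rw [hQ, ← hH]
  linear_combination (-H m * qJacobiSum q A' (fun k => B k / qPochs bs' q k) m)
    * hc m (Nat.lt_succ_iff.1 (Finset.mem_range.1 hm))

/-- `connection_of_eq_qJacobiSum` in the degenerate case `A = A' = 0`. -/
theorem connection_of_eq_qJacobiSum_zero (hq0 : q ≠ 0) (hq : ∀ k : ℕ, 0 < k → q ^ k ≠ 1)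
    {n : ℕ} {B Q w' c H : ℕ → ℂ} {P w : ℂ}
    {bs bs' : List ℂ} (hP : P = w * qJacobiSum q 0 (fun k => B k / qPochs bs q k) n)
    (hQ : ∀ m, Q m = w' m * qJacobiSum q 0 (fun k => B k / qPochs bs' q k) m)
    (hlen : bs.length = bs'.length) (hbs' : qPochs bs' q n ≠ 0)
    (hH : ∀ m, H m = qHyp (q ^ ((m : ℤ) - n) :: bs'.map (· * q ^ m)) (bs.map (· * q ^ m)) q q)
    (hc : ∀ m ≤ n, c m * w' m = w * (q ^ ((m : ℤ) * (m - n)) * qBinom q n m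
      * (qPochs bs' q m / qPochs bs q m))) :
    P = ∑ m ∈ Finset.range (n + 1), c m * H m * Q m := by
  rw [hP, qJacobiSum_zero_connection_qHyp hq0 hq n B bs hlen hbs', Finset.mul_sum]
  refine Finset.sum_congr rfl fun m hm => ?_
  rw [hQ, ← hH]
  linear_combination (-H m * qJacobiSum q 0 (fun k => B k / qPochs bs' q k) m)
    * hc m (Nat.lt_succ_iff.1 (Finset.mem_range.1 hm))

/-- The connection formula for two families with common numerator `B`, expressed through
`qMeixnerSum`. -/
theorem connection_of_eq_qMeixnerSum (hq0 : q ≠ 0) (hq : ∀ k : ℕ, 0 < k → q ^ k ≠ 1)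
    {n : ℕ} {B Q w' c H : ℕ → ℂ} {P w ζ ζ' : ℂ} (hζ' : ζ' ≠ 0)
    {bs bs' : List ℂ} (hP : P = w * qMeixnerSum q (fun k => ζ ^ k * B k / qPochs bs q k) n)
    (hQ : ∀ m, Q m = w' m * qMeixnerSum q (fun k => ζ' ^ k * B k / qPochs bs' q k) m)
    (hlen : bs.length = bs'.length) (hbs' : qPochs bs' q n ≠ 0)
    (hH : ∀ m ≤ n, H m = qHyp (q ^ ((m : ℤ) - n) :: bs'.map (· * q ^ m)) (bs.map (· * q ^ m)) q
      (ζ / ζ' * q ^ (n - m)))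
    (hc : ∀ m ≤ n, c m * w' m = w * (qBinom q n m
      * ((ζ / ζ') ^ m * (qPochs bs' q m / qPochs bs q m)))) :
    P = ∑ m ∈ Finset.range (n + 1), c m * H m * Q m := by
  rw [hP, qMeixnerSum_connection_qHyp hq0 hq n B ζ hζ' bs hlen hbs', Finset.mul_sum]
  refine Finset.sum_congr rfl fun m hm => ?_
  have hm := Nat.lt_succ_iff.1 (Finset.mem_range.1 hm)
  rw [hQ, ← hH m hm]
  linear_combination (-H m * qMeixnerSum q (fun k => ζ' ^ k * B k / qPochs bs' q k) m) * hc m hm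

/-- If the coefficient sequences of two `qMeixnerSum`s have termwise ratio `t ^ k`, the connection
coefficients are evaluated by the `q`-binomial theorem. -/
theorem connection_of_eq_qMeixnerSum_geometric (hq0 : q ≠ 0)
    (hq : ∀ k : ℕ, 0 < k → q ^ k ≠ 1) {n : ℕ} {u v Q w' c : ℕ → ℂ} {P w : ℂ} (t : ℂ)
    (hP : P = w * qMeixnerSum q u n) (hQ : ∀ m, Q m = w' m * qMeixnerSum q v m)
    (huv : ∀ k, u k = t ^ k * v k)
    (hc : ∀ m ≤ n, c m * w' m = w * (qBinom q n m * (t ^ m * qPoch t q (n - m)))) :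
    P = ∑ m ∈ Finset.range (n + 1), c m * Q m := by
  rw [hP, qMeixnerSum_connection hq0 hq (r := fun k => t ^ k) fun k _ => huv k, Finset.mul_sum]
  refine Finset.sum_congr rfl fun m hm => ?_
  have hm := Nat.lt_succ_iff.1 (Finset.mem_range.1 hm)
  have h := sum_qPoch_neg_mul_pow hq0 hq (n - m) (q ^ (n - m) * t)
  have e : q ^ (n - m) * t * q ^ (-((n - m : ℕ) : ℤ)) = t := by
    rw [zpow_neg, zpow_natCast]
    field_simp
  rw [e] at h
  have hs : ∑ j ∈ Finset.range (n - m + 1), qPoch (q ^ ((m : ℤ) - n)) q j / qPoch q q j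
        * ((q ^ (n - m)) ^ j * t ^ (m + j)) = t ^ m * qPoch t q (n - m) := by
    rw [← h, zpow_sub_eq_zpow_neg hm, Finset.mul_sum]
    exact Finset.sum_congr rfl fun j _ => by ring
  rw [hQ, hs, ← mul_assoc w, ← mul_assoc (c m), hc m hm]

/-- The `q`-Chu–Vandermonde sum with the numerator written as a `q`-shifted factorial. -/
theorem sum_qChuVandermonde' (hq0 : q ≠ 0) (hq : ∀ k : ℕ, 0 < k → q ^ k ≠ 1) {m n : ℕ}
    (hm : m ≤ n) {B C : ℂ} (hB : B ≠ 0) (hC : qPoch C q (n - m) ≠ 0) :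
    ∑ j ∈ Finset.range (n - m + 1),
        qPoch (q ^ ((m : ℤ) - n)) q j / qPoch q q j * (qPoch B q j / qPoch C q j * q ^ j)
      = B ^ (n - m) * qPoch (C / B) q (n - m) / qPoch C q (n - m) := by
  have h (N : ℕ) : ∏ i ∈ Finset.range N, (B - C * q ^ i) = B ^ N * qPoch (C / B) q N := by
    rw [qPoch, ← Finset.card_range N, ← Finset.prod_const, Finset.card_range,
      ← Finset.prod_mul_distrib]
    refine Finset.prod_congr rfl fun i _ => ?_
    field_simp
  rw [zpow_sub_eq_zpow_neg hm, sum_qChuVandermonde hq0 hq _ _ _ hC, h]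

/-- Connection of two `qJacobiSum`s with `A = 0` whose denominators are `(b; q)_k` and
`(b'; q)_k`; the coefficients are evaluated by the `q`-Chu–Vandermonde sum. -/
theorem connection_of_eq_qJacobiSum_single (hq0 : q ≠ 0) (hq : ∀ k : ℕ, 0 < k → q ^ k ≠ 1)
    {n : ℕ} {B Q w' c : ℕ → ℂ} {P w b b' : ℂ} (hb'0 : b' ≠ 0)
    (hP : P = w * qJacobiSum q 0 (fun k => B k / qPochs [b] q k) n)
    (hQ : ∀ m, Q m = w' m * qJacobiSum q 0 (fun k => B k / qPochs [b'] q k) m)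
    (hb : qPoch b q n ≠ 0) (hb' : qPoch b' q n ≠ 0)
    (hc : ∀ m ≤ n, c m * w' m = w * (qBinom q n m * b' ^ (n - m) * qPoch (b / b') q (n - m)
      * qPoch b' q m / qPoch b q n)) :
    P = ∑ m ∈ Finset.range (n + 1), c m * Q m := by
  rw [hP, qJacobiSum_connection hq0 hq 0 (zero_mul_pow_ne_one q n)
    (r := fun k => qPoch b' q k / qPoch b q k) (v := fun k => B k / qPochs [b'] q k)
    fun k hk => by
      have := qPoch_ne_zero_of_le hb' hk
      simp only [qPochs_cons, qPochs_nil]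
      field_simp, Finset.mul_sum]
  refine Finset.sum_congr rfl fun m hm => ?_
  have hm := Nat.lt_succ_iff.1 (Finset.mem_range.1 hm)
  have hb1 := hb
  rw [qPoch_split b q hm] at hb1
  have h := sum_qChuVandermonde' hq0 hq hm (mul_ne_zero hb'0 (pow_ne_zero m hq0))
    (right_ne_zero_of_mul hb1)
  rw [mul_div_mul_right _ _ (pow_ne_zero m hq0)] at h
  have e : q ^ ((m : ℤ) * (m - n)) * (q ^ m) ^ (n - m) = 1 := zpow_mul_sub_mul_pow hq0 hm
  have hs : ∑ j ∈ Finset.range (n - m + 1), qPoch (q ^ ((m : ℤ) - n)) q j / qPoch q q j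
        * (qPoch (0 * q ^ (n + m)) q j / qPoch (0 * q ^ (2 * m + 1)) q j * q ^ j
          * (qPoch b' q (m + j) / qPoch b q (m + j)))
      = qPoch b' q m / qPoch b q m * ((b' * q ^ m) ^ (n - m) * qPoch (b / b') q (n - m)
        / qPoch (b * q ^ m) q (n - m)) := by
    rw [← h, Finset.mul_sum]
    refine Finset.sum_congr rfl fun j _ => ?_
    rw [zero_mul, zero_mul, qPoch_zero_left, qPoch_add, qPoch_add]
    ring
  rw [hQ, ← mul_assoc w, ← mul_assoc (c m), hc m hm, hs, zero_mul, zero_mul, qPoch_zero_left,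
    qPoch_split b q hm, mul_pow]
  linear_combination (w * qBinom q n m * b' ^ (n - m) * qPoch (b / b') q (n - m)
    * qPoch b' q m / (qPoch b q m * qPoch (b * q ^ m) q (n - m))
    * qJacobiSum q 0 (fun k => B k / qPochs [b'] q k) m) * e

theorem askeyWilson_connection (hq0 : q ≠ 0) (hq : ∀ k : ℕ, 0 < k → q ^ k ≠ 1)
    (a b c d β γ δ θ : ℂ) (n : ℕ) (ha : a ≠ 0) (_hD : qPochs [a * b, a * c, a * d] q n ≠ 0)
    (hD' : qPochs [a * β, a * γ, a * δ] q n ≠ 0)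
    (hA' : ∀ k : ℕ, k + 1 < 2 * n → a * β * γ * δ * q ^ k ≠ 1) :
    askeyWilson q a b c d n θ = ∑ m ∈ Finset.range (n + 1),
        (a ^ ((m : ℤ) - n) * q ^ ((m : ℤ) * (m - n)) / qPoch q q (n - m)
          * (qPochs [a * b, a * c, a * d, q] q n
              * qPoch (a * b * c * d * q ^ ((n : ℤ) - 1)) q m
            / (qPochs [a * b, a * c, a * d, q] q m
              * qPoch (a * β * γ * δ * q ^ ((m : ℤ) - 1)) q m))
          * qHyp [q ^ ((m : ℤ) - n), a * β * q ^ m, a * γ * q ^ m, a * δ * q ^ m,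
                a * b * c * d * q ^ ((n : ℤ) + m - 1)]
              [a * b * q ^ m, a * c * q ^ m, a * d * q ^ m, a * β * γ * δ * q ^ (2 * m)] q q)
        * askeyWilson q a β γ δ m θ := by
  refine connection_of_eq_qJacobiSum hq0 hq (div_mul_pow_ne_one hq0 hA')
    (askeyWilson_eq hq0 a b c d θ n)
    (askeyWilson_eq hq0 a β γ δ θ) rfl hD' (fun m => qHyp_congr rfl rfl fun k => ?_) fun m hm => ?_
  · simp only [qPochs_cons, qPochs_nil, List.map_cons, List.map_nil]
    rw [mul_zpow_add_sub_one hq0, pow_succ', ← mul_assoc (_ / q), div_mul_cancel₀ _ hq0]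
    ring
  · simp only [qPochs_cons, qPochs_nil, mul_one, qBinom]
    rw [zpow_sub₀ ha, zpow_natCast, zpow_natCast, mul_zpow_sub_one hq0, mul_zpow_sub_one hq0]
    -- The normalization of the second family contributes a factor `a ^ m / a ^ m` on the left.
    have h := div_self (pow_ne_zero m ha)
    refine Eq.trans ?_ ((congrArg (_ * ·) h).trans (mul_one _))
    ring

theorem qRacah_connection (hq0 : q ≠ 0) (hq : ∀ k : ℕ, 0 < k → q ^ k ≠ 1) (α β γ δ a b c d x : ℂ)
    (n : ℕ) (h : γ * δ = c * d) (_hD : qPochs [α * q, β * δ * q, γ * q] q n ≠ 0)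
    (hD' : qPochs [a * q, b * d * q, c * q] q n ≠ 0)
    (hA' : ∀ k : ℕ, 2 ≤ k → k ≤ 2 * n → a * b * q ^ k ≠ 1) :
    qRacah q α β γ δ n x = ∑ m ∈ Finset.range (n + 1),
        (q ^ ((m : ℤ) * (m - n)) * qPoch q q n
            * qPochs [α * β * q ^ (n + 1), a * q, b * d * q, c * q] q m
          / (qPoch q q m * qPoch q q (n - m)
            * qPochs [α * q, β * δ * q, γ * q, a * b * q ^ (m + 1)] q m)
          * qHyp [q ^ ((m : ℤ) - n), α * β * q ^ (m + n + 1), a * q ^ (m + 1),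
                b * d * q ^ (m + 1), c * q ^ (m + 1)]
              [α * q ^ (m + 1), β * δ * q ^ (m + 1), a * b * q ^ (2 * m + 2), γ * q ^ (m + 1)] q q)
        * qRacah q a b c d m x := by
  -- The condition `γ δ = c d` makes the two expansion bases agree.
  have hP := qRacah_eq hq0 α β γ δ x n
  rw [h] at hP
  refine connection_of_eq_qJacobiSum hq0 hq (mul_mul_pow_ne_one hA') (hP)
    (qRacah_eq hq0 a b c d x) rfl hD' (fun m => qHyp_congr rfl rfl fun k => ?_) fun m hm => ?_
  · simp only [qPochs_cons, qPochs_nil, List.map_cons, List.map_nil]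
    rw [show α * β * q * q ^ (n + m) = α * β * q ^ (m + n + 1) by ring,
      show a * b * q * q ^ (2 * m + 1) = a * b * q ^ (2 * m + 2) by ring]
    have e (X : ℂ) : X * q * q ^ m = X * q ^ (m + 1) := by ring
    simp only [e]
    ring
  · simp only [qPochs_cons, qPochs_nil, mul_one, qBinom]
    have e (X : ℂ) : X * q * q ^ m = X * q ^ (m + 1) := by ring
    rw [e, mul_assoc (α * β), ← pow_succ']
    ring

theorem contDualQHahn_connection (hq0 : q ≠ 0) (hq : ∀ k : ℕ, 0 < k → q ^ k ≠ 1) (a b c β γ θ : ℂ)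
    (n : ℕ) (ha : a ≠ 0) (hD : qPochs [a * b, a * c] q n ≠ 0)
    (hD' : qPochs [a * β, a * γ] q n ≠ 0) :
    contDualQHahn q a b c n θ = ∑ m ∈ Finset.range (n + 1),
        (a ^ ((m : ℤ) - n) * qPoch q q n * q ^ ((m : ℤ) * (m - n))
            * qPochs [a * b * q ^ m, a * c * q ^ m] q (n - m)
          / (qPoch q q (n - m) * qPoch q q m)
          * qHyp [q ^ ((m : ℤ) - n), a * β * q ^ m, a * γ * q ^ m]
              [a * b * q ^ m, a * c * q ^ m] q q)
        * contDualQHahn q a β γ m θ := by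
  refine connection_of_eq_qJacobiSum_zero hq0 hq (contDualQHahn_eq hq0 a b c θ n)
    (contDualQHahn_eq hq0 a β γ θ) rfl hD' (fun m => qHyp_congr rfl rfl fun k => ?_) fun m hm => ?_
  · rfl
  · simp only [qPochs_cons, qPochs_nil, mul_one, qBinom]
    have hm1 := qPochs_split [a * b, a * c] q hm
    have hm2 := qPochs_ne_zero_of_le hD hm
    simp only [qPochs_cons, qPochs_nil, mul_one, List.map_cons, List.map_nil] at hm1 hm2
    rw [hm1, zpow_sub₀ ha, zpow_natCast, zpow_natCast]
    have h1 := left_ne_zero_of_mul hm2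
    have h2 := right_ne_zero_of_mul hm2
    field_simp

theorem contQHahn_connection (hq0 : q ≠ 0) (hq : ∀ k : ℕ, 0 < k → q ^ k ≠ 1)
    (φ a b c d β γ δ θ : ℂ) (n : ℕ) (ha : a ≠ 0)
    (_hD : qPochs [a * b * expI (2 * φ), a * c, a * d] q n ≠ 0)
    (hD' : qPochs [a * β * expI (2 * φ), a * γ, a * δ] q n ≠ 0)
    (hA' : ∀ k : ℕ, k + 1 < 2 * n → a * β * γ * δ * q ^ k ≠ 1) :
    contQHahn q φ a b c d n θ = ∑ m ∈ Finset.range (n + 1),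
        (q ^ ((m : ℤ) * (m - n)) * qPoch q q n
            * qPochs [a * b * expI (2 * φ), a * c, a * d] q n
            * qPoch (a * b * c * d * q ^ ((n : ℤ) - 1)) q m
            * a ^ ((m : ℤ) - n) * expI (φ * (m - n))
          / (qPoch q q (n - m) * qPoch q q m
            * qPochs [a * b * expI (2 * φ), a * c, a * d] q m
            * qPoch (a * β * γ * δ * q ^ ((m : ℤ) - 1)) q m)
          * qHyp [q ^ ((m : ℤ) - n), a * b * c * d * q ^ ((m : ℤ) + n - 1),
                a * β * expI (2 * φ) * q ^ m, a * γ * q ^ m, a * δ * q ^ m]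
              [a * b * expI (2 * φ) * q ^ m, a * c * q ^ m, a * d * q ^ m,
                a * β * γ * δ * q ^ (2 * m)] q q)
        * contQHahn q φ a β γ δ m θ := by
  refine connection_of_eq_qJacobiSum hq0 hq (div_mul_pow_ne_one hq0 hA')
    (contQHahn_eq hq0 φ a b c d θ n)
    (contQHahn_eq hq0 φ a β γ δ θ) rfl hD' (fun m => qHyp_congr rfl rfl fun k => ?_) fun m hm => ?_
  · simp only [qPochs_cons, qPochs_nil, List.map_cons, List.map_nil]
    rw [add_comm (m : ℤ), mul_zpow_add_sub_one hq0, pow_succ', ← mul_assoc (_ / q),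
      div_mul_cancel₀ _ hq0]
    ring
  · simp only [qPochs_cons, qPochs_nil, mul_one, qBinom]
    rw [zpow_sub₀ ha, zpow_natCast, zpow_natCast, mul_zpow_sub_one hq0, mul_zpow_sub_one hq0,
      expI_mul_sub]
    -- The normalization of the second family contributes the quotient in `h` on the left.
    have h := div_self (pow_ne_zero m (mul_ne_zero ha (expI_ne_zero φ)))
    refine Eq.trans ?_ ((congrArg (_ * ·) h).trans (mul_one _))
    ring

theorem bigQJacobi_connection (hq0 : q ≠ 0) (hq : ∀ k : ℕ, 0 < k → q ^ k ≠ 1) (a b c α β γ x : ℂ)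
    (n : ℕ) (_hD : qPochs [a * q, c * q] q n ≠ 0) (hD' : qPochs [α * q, γ * q] q n ≠ 0)
    (hA' : ∀ k : ℕ, 2 ≤ k → k ≤ 2 * n → α * β * q ^ k ≠ 1) :
    bigQJacobi q a b c n x = ∑ m ∈ Finset.range (n + 1),
        (q ^ ((m : ℤ) * (m - n)) * qPoch q q n
            * qPochs [a * b * q ^ (n + 1), α * q, γ * q] q m
          / (qPoch q q m * qPoch q q (n - m) * qPochs [a * q, c * q, α * β * q ^ (m + 1)] q m)
          * qHyp [q ^ ((m : ℤ) - n), a * b * q ^ (m + n + 1), α * q ^ (m + 1), γ * q ^ (m + 1)]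
              [a * q ^ (m + 1), c * q ^ (m + 1), α * β * q ^ (2 * m + 2)] q q)
        * bigQJacobi q α β γ m x := by
  refine connection_of_eq_qJacobiSum hq0 hq (mul_mul_pow_ne_one hA') (bigQJacobi_eq hq0 a b c x n)
    (bigQJacobi_eq hq0 α β γ x) rfl hD' (fun m => qHyp_congr rfl rfl fun k => ?_) fun m hm => ?_
  · simp only [qPochs_cons, qPochs_nil, List.map_cons, List.map_nil]
    rw [show a * b * q * q ^ (n + m) = a * b * q ^ (m + n + 1) by ring,
      show α * β * q * q ^ (2 * m + 1) = α * β * q ^ (2 * m + 2) by ring]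
    have e (X : ℂ) : X * q * q ^ m = X * q ^ (m + 1) := by ring
    simp only [e]
    ring
  · simp only [qPochs_cons, qPochs_nil, mul_one, qBinom]
    have e (X : ℂ) : X * q * q ^ m = X * q ^ (m + 1) := by ring
    rw [e, mul_assoc (a * b), ← pow_succ']
    ring

theorem qHahn_connection (hq0 : q ≠ 0) (hq : ∀ k : ℕ, 0 < k → q ^ k ≠ 1) (α β α₁ β₁ y : ℂ)
    (N N₁ n : ℕ) (_hN : n ≤ N) (hN₁ : n ≤ N₁) (_hα : qPoch (α * q) q n ≠ 0)
    (hα₁ : qPoch (α₁ * q) q n ≠ 0) (hA' : ∀ k : ℕ, 2 ≤ k → k ≤ 2 * n → α₁ * β₁ * q ^ k ≠ 1) :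
    qHahn q α β N n y = ∑ m ∈ Finset.range (n + 1),
        (q ^ ((m : ℤ) * (m - n))
            * qPochs [α * β * q ^ (n + 1), q ^ (-(N₁ : ℤ)), α₁ * q] q m * qPoch q q n
          / (qPoch q q m * qPoch q q (n - m)
            * qPochs [α * q, q ^ (-(N : ℤ)), α₁ * β₁ * q ^ (m + 1)] q m)
          * qHyp [q ^ ((m : ℤ) - n), α * β * q ^ (n + m + 1), q ^ ((m : ℤ) - N₁), α₁ * q ^ (1 + m)]
              [α * q ^ (m + 1), q ^ ((m : ℤ) - N), α₁ * β₁ * q ^ (2 * m + 2)] q q)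
        * qHahn q α₁ β₁ N₁ m y := by
  have hD : qPochs [α₁ * q, q ^ (-(N₁ : ℤ))] q n ≠ 0 := by
    rw [qPochs_cons, qPochs_cons, qPochs_nil, mul_one]
    exact mul_ne_zero hα₁ (qPoch_neg_ne_zero hq0 hq hN₁)
  refine connection_of_eq_qJacobiSum hq0 hq (mul_mul_pow_ne_one hA') (qHahn_eq hq0 α β y N n)
    (qHahn_eq hq0 α₁ β₁ y N₁) rfl hD (fun m => qHyp_congr rfl rfl fun k => ?_) fun m hm => ?_
  · simp only [qPochs_cons, qPochs_nil, List.map_cons, List.map_nil]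
    rw [show α * β * q * q ^ (n + m) = α * β * q ^ (n + m + 1) by ring,
      show α₁ * β₁ * q * q ^ (2 * m + 1) = α₁ * β₁ * q ^ (2 * m + 2) by ring, zpow_neg_mul_pow hq0,
      zpow_neg_mul_pow hq0, add_comm 1 m]
    have e (X : ℂ) : X * q * q ^ m = X * q ^ (m + 1) := by ring
    simp only [e]
    ring
  · simp only [qPochs_cons, qPochs_nil, mul_one, qBinom]
    have e (X : ℂ) : X * q * q ^ m = X * q ^ (m + 1) := by ring
    rw [e, mul_assoc (α * β), ← pow_succ']
    ring

theorem dualQHahn_connection (hq0 : q ≠ 0) (hq : ∀ k : ℕ, 0 < k → q ^ k ≠ 1) (γ δ γ₁ δ₁ x : ℂ)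
    (N N₁ n : ℕ) (_hN : n ≤ N) (hN₁ : n ≤ N₁) (h : γ * δ = γ₁ * δ₁) (_hγ : qPoch (γ * q) q n ≠ 0)
    (hγ₁ : qPoch (γ₁ * q) q n ≠ 0) :
    dualQHahn q γ δ N n x = ∑ m ∈ Finset.range (n + 1),
        (q ^ ((m : ℤ) * (m - n)) * qPoch q q n * qPochs [γ₁ * q, q ^ (-(N₁ : ℤ))] q m
          / (qPoch q q m * qPoch q q (n - m) * qPochs [γ * q, q ^ (-(N : ℤ))] q m)
          * qHyp [q ^ ((m : ℤ) - n), γ₁ * q ^ (m + 1), q ^ ((m : ℤ) - N₁)]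
              [γ * q ^ (m + 1), q ^ ((m : ℤ) - N)] q q)
        * dualQHahn q γ₁ δ₁ N₁ m x := by
  have hD : qPochs [γ₁ * q, q ^ (-(N₁ : ℤ))] q n ≠ 0 := by
    rw [qPochs_cons, qPochs_cons, qPochs_nil, mul_one]
    exact mul_ne_zero hγ₁ (qPoch_neg_ne_zero hq0 hq hN₁)
  -- The condition `γ δ = γ₁ δ₁` makes the two expansion bases agree.
  have hP := dualQHahn_eq hq0 γ δ x N n
  rw [h] at hP
  refine connection_of_eq_qJacobiSum_zero hq0 hq (hP)
    (dualQHahn_eq hq0 γ₁ δ₁ x N₁) rfl hD (fun m => qHyp_congr rfl rfl fun k => ?_) fun m hm => ?_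
  · simp only [qPochs_cons, qPochs_nil, List.map_cons, List.map_nil]
    have e (X : ℂ) : X * q * q ^ m = X * q ^ (m + 1) := by ring
    simp only [e, zpow_neg_mul_pow hq0]
  · simp only [qPochs_cons, qPochs_nil, mul_one, qBinom]
    ring

theorem alSalamChihara_connection (hq0 : q ≠ 0) (hq : ∀ k : ℕ, 0 < k → q ^ k ≠ 1) (a b β θ : ℂ)
    (n : ℕ) (ha : a ≠ 0) (hβ : β ≠ 0) (hb : qPoch (a * b) q n ≠ 0) (hb' : qPoch (a * β) q n ≠ 0) :
    alSalamChihara q a b n θ = ∑ m ∈ Finset.range (n + 1),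
        (qPoch q q n * β ^ (n - m) * qPoch (b / β) q (n - m)
          / (qPoch q q m * qPoch q q (n - m)))
        * alSalamChihara q a β m θ := by
  refine connection_of_eq_qJacobiSum_single hq0 hq (mul_ne_zero ha hβ)
    (alSalamChihara_eq hq0 a b θ n) (alSalamChihara_eq hq0 a β θ) hb hb' fun m hm => ?_
  rw [mul_div_mul_left _ _ ha, qBinom, mul_pow, ← pow_sub_mul_pow a hm]
  generalize qPoch (a * b) q n = X at hb ⊢
  field_simp

theorem contQJacobi_connection (hq0 : q ≠ 0) (hq : ∀ k : ℕ, 0 < k → q ^ k ≠ 1) (α β β₁ ν ν₁ θ : ℂ)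
    (n : ℕ) (hν : ν = α + β + 1) (hν₁ : ν₁ = α + β₁ + 1)
    (hD : qPochs [q ^ (α + 1), -q ^ (ν / 2), -q ^ ((ν + 1) / 2)] q n ≠ 0)
    (hD' : qPochs [-q ^ (ν₁ / 2), -q ^ ((ν₁ + 1) / 2)] q n ≠ 0)
    (hA' : ∀ k : ℕ, 1 ≤ k → k < 2 * n → q ^ (ν₁ + k) ≠ 1) :
    contQJacobi q α β n θ = ∑ m ∈ Finset.range (n + 1),
        (q ^ ((m : ℤ) * (m - n)) * qPoch (q ^ (α + 1)) q n
            * qPochs [q ^ (ν + n), -q ^ (ν₁ / 2), -q ^ ((ν₁ + 1) / 2)] q m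
          / (qPoch q q (n - m) * qPoch (q ^ (ν₁ + m)) q m
            * qPochs [q ^ (α + 1), -q ^ (ν / 2), -q ^ ((ν + 1) / 2)] q m)
          * qHyp [q ^ ((m : ℤ) - n), q ^ (m + n + ν), -q ^ (ν₁ / 2 + m), -q ^ ((ν₁ + 1) / 2 + m),
                q ^ (α + m + 1)]
              [q ^ (m + α + 1), -q ^ (ν / 2 + m), -q ^ ((ν + 1) / 2 + m),
                q ^ (2 * m + ν₁ + 1)] q q)
        * contQJacobi q α β₁ m θ := by
  have hP := contQJacobi_eq hq0 α β θ n
  rw [show α + β + 2 = ν + 1 by rw [hν]; ring, ← hν] at hP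
  have hQ := contQJacobi_eq hq0 α β₁ θ
  rw [show α + β₁ + 2 = ν₁ + 1 by rw [hν₁]; ring, ← hν₁] at hQ
  have hD₁ : qPochs [q ^ (α + 1), -q ^ (ν₁ / 2), -q ^ ((ν₁ + 1) / 2)] q n ≠ 0 := by
    rw [qPochs_cons] at hD ⊢
    exact mul_ne_zero (left_ne_zero_of_mul hD) hD'
  refine connection_of_eq_qJacobiSum hq0 hq 
    (A' := q ^ ν₁) (fun k hk hk2 => ?_) (hP)
    (hQ) rfl hD₁ (fun m => qHyp_congr rfl rfl fun k => ?_) fun m hm => ?_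
  · rw [← cpow_add_natCast hq0]
    exact hA' k hk hk2
  · simp only [qPochs_cons, qPochs_nil, List.map_cons, List.map_nil]
    have e1 : (m : ℂ) + n + ν = ν + (n + m : ℕ) := by push_cast; ring
    have e2 : 2 * (m : ℂ) + ν₁ + 1 = ν₁ + (2 * m + 1 : ℕ) := by push_cast; ring
    have e3 : α + m + 1 = α + 1 + m := by ring
    have e4 : m + α + 1 = α + 1 + m := by ring
    rw [e1, e2, e3, e4]
    simp only [cpow_add_natCast hq0, neg_mul]
    ring
  · simp only [qPochs_cons, qPochs_nil, mul_one, qBinom]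
    have hm1 := qPoch_self_ne_zero hq m
    have hm2 := qPoch_self_ne_zero hq n
    have hm3 : qPoch (q ^ (α + 1)) q m ≠ 0 := by
      have := qPochs_ne_zero_of_le hD hm
      rw [qPochs_cons] at this
      exact left_ne_zero_of_mul this
    rw [cpow_add_natCast hq0, cpow_add_natCast hq0]
    field_simp

theorem bigQLaguerre_connection (hq0 : q ≠ 0) (hq : ∀ k : ℕ, 0 < k → q ^ k ≠ 1) (a b α β x : ℂ)
    (n : ℕ) (_hD : qPochs [a * q, b * q] q n ≠ 0) (hD' : qPochs [α * q, β * q] q n ≠ 0) :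
    bigQLaguerre q a b n x = ∑ m ∈ Finset.range (n + 1),
        (q ^ ((m : ℤ) * (m - n)) * qPoch q q n * qPochs [α * q, β * q] q m
          / (qPoch q q m * qPoch q q (n - m) * qPochs [a * q, b * q] q m)
          * qHyp [q ^ ((m : ℤ) - n), α * q ^ (m + 1), β * q ^ (m + 1)]
              [a * q ^ (m + 1), b * q ^ (m + 1)] q q)
        * bigQLaguerre q α β m x := by
  refine connection_of_eq_qJacobiSum_zero hq0 hq (bigQLaguerre_eq hq0 a b x n)
    (bigQLaguerre_eq hq0 α β x) rfl hD' (fun m => qHyp_congr rfl rfl fun k => ?_) fun m hm => ?_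
  · simp only [qPochs_cons, qPochs_nil, List.map_cons, List.map_nil]
    have e (X : ℂ) : X * q * q ^ m = X * q ^ (m + 1) := by ring
    simp only [e]
  · simp only [qPochs_cons, qPochs_nil, mul_one, qBinom]
    ring

theorem littleQJacobi_connection (hq0 : q ≠ 0) (hq : ∀ k : ℕ, 0 < k → q ^ k ≠ 1) (a b α β x : ℂ)
    (n : ℕ) (_ha : qPoch (a * q) q n ≠ 0) (hα : qPoch (α * q) q n ≠ 0)
    (hA' : ∀ k : ℕ, 2 ≤ k → k ≤ 2 * n → α * β * q ^ k ≠ 1) :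
    littleQJacobi q a b n x = ∑ m ∈ Finset.range (n + 1),
        (q ^ ((m : ℤ) * (m - n)) * qPoch q q n * qPochs [a * b * q ^ (n + 1), α * q] q m
          / (qPoch q q m * qPoch q q (n - m) * qPochs [a * q, α * β * q ^ (m + 1)] q m)
          * qHyp [q ^ ((m : ℤ) - n), a * b * q ^ (m + n + 1), α * q ^ (m + 1)]
              [a * q ^ (m + 1), α * β * q ^ (2 * m + 2)] q q)
        * littleQJacobi q α β m x := by
  have hD : qPochs [α * q] q n ≠ 0 := by rwa [qPochs_cons, qPochs_nil, mul_one]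
  refine connection_of_eq_qJacobiSum hq0 hq (mul_mul_pow_ne_one hA') (littleQJacobi_eq hq0 a b x n)
    (littleQJacobi_eq hq0 α β x) rfl hD (fun m => qHyp_congr rfl rfl fun k => ?_) fun m hm => ?_
  · simp only [qPochs_cons, qPochs_nil, List.map_cons, List.map_nil]
    rw [show a * b * q * q ^ (n + m) = a * b * q ^ (m + n + 1) by ring,
      show α * β * q * q ^ (2 * m + 1) = α * β * q ^ (2 * m + 2) by ring]
    have e (X : ℂ) : X * q * q ^ m = X * q ^ (m + 1) := by ring
    simp only [e]
    ring
  · simp only [qPochs_cons, qPochs_nil, mul_one, qBinom]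
    have e (X : ℂ) : X * q * q ^ m = X * q ^ (m + 1) := by ring
    rw [e, mul_assoc (a * b), ← pow_succ']
    ring

theorem qMeixner_connection (hq0 : q ≠ 0) (hq : ∀ k : ℕ, 0 < k → q ^ k ≠ 1) (b c β γ y : ℂ)
    (n : ℕ) (hc : c ≠ 0) (hγ : γ ≠ 0) (_hb : qPoch (b * q) q n ≠ 0) (hβ : qPoch (β * q) q n ≠ 0) :
    qMeixner q b c n y = ∑ m ∈ Finset.range (n + 1),
        ((γ / c) ^ m
          * (qPoch q q n * qPoch (β * q) q m
            / (qPoch q q m * qPoch q q (n - m) * qPoch (b * q) q m))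
          * qHyp [q ^ ((m : ℤ) - n), β * q ^ (m + 1)] [b * q ^ (m + 1)] q (γ / c * q ^ (n - m)))
        * qMeixner q β γ m y := by
  have hD : qPochs [β * q] q n ≠ 0 := by rwa [qPochs_cons, qPochs_nil, mul_one]
  have e : -(q / c) / -(q / γ) = γ / c := by field_simp
  refine connection_of_eq_qMeixnerSum hq0 hq (neg_ne_zero.2 (div_ne_zero hq0 hγ))
    (qMeixner_eq hq0 b c y n)
    (qMeixner_eq hq0 β γ y) rfl hD (fun m hm => ?_) fun m hm => ?_
  · rw [e]
    refine qHyp_congr rfl rfl fun k => ?_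
    simp only [List.map_cons, List.map_nil, mul_assoc, ← pow_succ']
  · simp only [qPochs_cons, qPochs_nil, mul_one, qBinom]
    rw [e]
    ring

theorem quantumQKrawtchouk_connection (hq0 : q ≠ 0) (hq : ∀ k : ℕ, 0 < k → q ^ k ≠ 1) (p p₁ y : ℂ)
    (N N₁ n : ℕ) (_hN : n ≤ N) (hN₁ : n ≤ N₁) (hp₁ : p₁ ≠ 0) :
    quantumQKrawtchouk q p N n y = ∑ m ∈ Finset.range (n + 1),
        (qPoch q q n * qPoch (q ^ (-(N₁ : ℤ))) q m
            / (qPoch q q m * qPoch q q (n - m) * qPoch (q ^ (-(N : ℤ))) q m)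
          * (p / p₁) ^ m
          * qHyp [q ^ ((m : ℤ) - n), q ^ ((m : ℤ) - N₁)] [q ^ ((m : ℤ) - N)] q
              (p / p₁ * q ^ (n - m)))
        * quantumQKrawtchouk q p₁ N₁ m y := by
  have hD : qPochs [q ^ (-(N₁ : ℤ))] q n ≠ 0 := by
    rw [qPochs_cons, qPochs_nil, mul_one]
    exact qPoch_neg_ne_zero hq0 hq hN₁
  refine connection_of_eq_qMeixnerSum hq0 hq (mul_ne_zero hp₁ hq0)
    (quantumQKrawtchouk_eq hq0 p y N n)
    (quantumQKrawtchouk_eq hq0 p₁ y N₁) rfl hD (fun m hm => ?_) fun m hm => ?_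
  · rw [mul_div_mul_right _ _ hq0]
    refine qHyp_congr rfl rfl fun k => ?_
    simp only [List.map_cons, List.map_nil, zpow_neg_mul_pow hq0]
  · simp only [qPochs_cons, qPochs_nil, mul_one, qBinom]
    rw [mul_div_mul_right _ _ hq0]
    ring

theorem qKrawtchouk_connection (hq0 : q ≠ 0) (hq : ∀ k : ℕ, 0 < k → q ^ k ≠ 1) (p p₁ y : ℂ)
    (N N₁ n : ℕ) (_hN : n ≤ N) (hN₁ : n ≤ N₁) (hA' : ∀ k : ℕ, 1 ≤ k → k < 2 * n → -p₁ * q ^ k ≠ 1) :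
    qKrawtchouk q p N n y = ∑ m ∈ Finset.range (n + 1),
        (q ^ ((m : ℤ) * (m - n)) * (qPoch q q n / (qPoch q q m * qPoch q q (n - m)))
          * (qPochs [-p * q ^ n, q ^ (-(N₁ : ℤ))] q m / qPochs [-p₁ * q ^ m, q ^ (-(N : ℤ))] q m)
          * qHyp [q ^ ((m : ℤ) - n), -p * q ^ (m + n), q ^ ((m : ℤ) - N₁)]
              [q ^ ((m : ℤ) - N), -p₁ * q ^ (2 * m + 1)] q q)
        * qKrawtchouk q p₁ N₁ m y := by
  have hD : qPochs [q ^ (-(N₁ : ℤ))] q n ≠ 0 := by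
    rw [qPochs_cons, qPochs_nil, mul_one]
    exact qPoch_neg_ne_zero hq0 hq hN₁
  refine connection_of_eq_qJacobiSum hq0 hq hA' (qKrawtchouk_eq hq0 p y N n)
    (qKrawtchouk_eq hq0 p₁ y N₁) rfl hD (fun m => qHyp_congr rfl rfl fun k => ?_) fun m hm => ?_
  · simp only [qPochs_cons, qPochs_nil, List.map_cons, List.map_nil]
    rw [zpow_neg_mul_pow hq0, zpow_neg_mul_pow hq0, add_comm m n]
    ring
  · simp only [qPochs_cons, qPochs_nil, mul_one, qBinom]
    ring

theorem littleQLaguerre_connection (hq0 : q ≠ 0) (hq : ∀ k : ℕ, 0 < k → q ^ k ≠ 1) (a α x : ℂ)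
    (n : ℕ) (hα0 : α ≠ 0) (ha : qPoch (a * q) q n ≠ 0) (hα : qPoch (α * q) q n ≠ 0) :
    littleQLaguerre q a n x = ∑ m ∈ Finset.range (n + 1),
        ((α * q) ^ (n - m) * (qPoch q q n / (qPoch q q m * qPoch q q (n - m)))
          * (qPoch (α * q) q m / qPoch (a * q) q n) * qPoch (a / α) q (n - m))
        * littleQLaguerre q α m x := by
  refine connection_of_eq_qJacobiSum_single hq0 hq (mul_ne_zero hα0 hq0)
    (littleQLaguerre_eq hq0 a x n) (littleQLaguerre_eq hq0 α x) ha hα fun m hm => ?_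
  rw [mul_div_mul_right _ _ hq0, qBinom]
  ring

theorem qLaguerre_connection (hq0 : q ≠ 0) (hq : ∀ k : ℕ, 0 < k → q ^ k ≠ 1) (α β x : ℂ) (n : ℕ)
    (hα : qPoch (q ^ (α + 1)) q n ≠ 0) (hβ : qPoch (q ^ (β + 1)) q n ≠ 0) :
    qLaguerre q α n x = ∑ m ∈ Finset.range (n + 1),
        (q ^ (m * (α - β)) * qPoch (q ^ (α + m + 1)) q (n - m) / qPoch q q (n - m)
          * qHyp [q ^ ((m : ℤ) - n), q ^ (β + m + 1)] [q ^ (α + m + 1)] q (q ^ (n - m + α - β)))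
        * qLaguerre q β m x := by
  have hD : qPochs [q ^ (β + 1)] q n ≠ 0 := by rwa [qPochs_cons, qPochs_nil, mul_one]
  have hβ0 : q ^ (β + 1) ≠ 0 := by simp [Complex.cpow_eq_zero_iff, hq0]
  have e : q ^ (α + 1) / q ^ (β + 1) = q ^ (α - β) := by
    rw [← Complex.cpow_sub _ _ hq0]
    congr 1
    ring
  refine connection_of_eq_qMeixnerSum hq0 hq hβ0 (qLaguerre_eq hq0 α x n)
    (qLaguerre_eq hq0 β x) rfl hD (fun m hm => ?_) fun m hm => ?_
  · have e1 : (n : ℂ) - m + α - β = α - β + (n - m : ℕ) := by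
      rw [Nat.cast_sub hm]
      ring
    rw [e, e1, cpow_add_natCast hq0]
    refine qHyp_congr rfl rfl fun k => ?_
    simp only [List.map_cons, List.map_nil, ← cpow_add_natCast hq0, add_right_comm]
  · simp only [qPochs_cons, qPochs_nil, mul_one, qBinom]
    have hm1 := qPoch_self_ne_zero hq m
    have hm2 := qPoch_self_ne_zero hq n
    have hm3 := qPoch_ne_zero_of_le hα hm
    have hm4 := qPoch_ne_zero_of_le hβ hm
    rw [e, qPoch_split (q ^ (α + 1)) q hm, ← cpow_add_natCast hq0, Complex.cpow_nat_mul,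
      add_right_comm α 1]
    field_simp

theorem altQCharlier_connection (hq0 : q ≠ 0) (hq : ∀ k : ℕ, 0 < k → q ^ k ≠ 1) (a α x : ℂ)
    (n : ℕ) (ha : a ≠ 0) (hα : ∀ k : ℕ, k ≤ 2 * n → 1 + α * q ^ k ≠ 0) :
    altQCharlier q a n x = ∑ m ∈ Finset.range (n + 1),
        (qPoch q q n * qPoch (-a * q ^ n) q m
            / (qPoch q q m * qPoch q q (n - m) * qPoch (-α * q ^ m) q n)
          * ((1 + α * q ^ (2 * m)) / (1 + α * q ^ (m + n)))
          * qPoch (α / a * q ^ ((m : ℤ) - n + 1)) q (n - m) * (-a * q ^ n) ^ (n - m))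
        * altQCharlier q α m x := by
  have hA : ∀ k : ℕ, 1 ≤ k → k < 2 * n → -α * q ^ k ≠ 1 := fun k _ hk h =>
    hα k hk.le (by linear_combination -h)
  -- The two families share the sequence `u_k = x ^ k`, and only the parameter `A` changes.
  rw [altQCharlier_eq hq0, one_mul, qJacobiSum_connection hq0 hq (-a) hA (r := fun _ => 1)
    (v := fun k => x ^ k / qPochs [] q k) fun k _ => (one_mul _).symm]
  refine Finset.sum_congr rfl fun m hm => ?_
  have hm := Nat.lt_succ_iff.1 (Finset.mem_range.1 hm)
  have hC : qPoch (-α * q ^ (2 * m + 1)) q (n - m) ≠ 0 := qPoch_mul_pow_ne_zero hA (by omega)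
  have h := sum_qChuVandermonde' hq0 hq hm (B := -a * q ^ (n + m))
    (mul_ne_zero (neg_ne_zero.2 ha) (pow_ne_zero _ hq0)) hC
  have e1 : -α * q ^ (2 * m + 1) / (-a * q ^ (n + m)) = α / a * q ^ ((m : ℤ) - n + 1) := by
    rw [zpow_add_one₀ hq0, zpow_sub₀ hq0, zpow_natCast, zpow_natCast]
    field_simp
    ring
  have e2 := zpow_mul_sub_mul_pow hq0 hm
  -- Both sides are `(-α q ^ m; q)_{n + 1}`, split after `n` and after `m` factors.
  have e3 : qPoch (-α * q ^ m) q n * (1 + α * q ^ (m + n)) = qPoch (-α * q ^ m) q m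
      * ((1 + α * q ^ (2 * m)) * qPoch (-α * q ^ (2 * m + 1)) q (n - m)) := by
    have h1 := qPoch_split (-α * q ^ m) q (n := n + 1) (show m ≤ n + 1 by omega)
    rw [show n + 1 - m = n - m + 1 by omega, qPoch_succ, qPoch_succ',
      show 1 - -α * q ^ m * q ^ n = 1 + α * q ^ (m + n) by ring,
      show 1 - -α * q ^ m * q ^ m = 1 + α * q ^ (2 * m) by ring,
      show -α * q ^ m * q ^ m * q = -α * q ^ (2 * m + 1) by ring] at h1
    exact h1
  have h1 := hα (m + n) (by omega)
  have h2 := hα (2 * m) (by omega)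
  have h3 : qPoch (-α * q ^ m) q m ≠ 0 := qPoch_mul_pow_ne_zero hA (by omega)
  have h4 : qPoch (-α * q ^ m) q n ≠ 0 := left_ne_zero_of_mul
    (e3 ▸ mul_ne_zero h3 (mul_ne_zero h2 hC))
  have e4 : (1 + α * q ^ (2 * m)) / (1 + α * q ^ (m + n)) / qPoch (-α * q ^ m) q n
      = 1 / (qPoch (-α * q ^ m) q m * qPoch (-α * q ^ (2 * m + 1)) q (n - m)) := by
    rw [div_div, mul_comm (1 + _), e3]
    field_simp
  rw [e1] at h
  simp only [mul_one]
  rw [h, altQCharlier_eq hq0, one_mul, qBinom, pow_add, ← mul_assoc (-a), mul_pow _ (q ^ m)]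
  generalize (1 + α * q ^ (2 * m)) / (1 + α * q ^ (m + n)) = X at e4 ⊢
  linear_combination (qPoch q q n / (qPoch q q m * qPoch q q (n - m)) * qPoch (-a * q ^ n) q m
    * qPoch (α / a * q ^ ((m : ℤ) - n + 1)) q (n - m) * (-a * q ^ n) ^ (n - m)
    / (qPoch (-α * q ^ m) q m * qPoch (-α * q ^ (2 * m + 1)) q (n - m))
    * qJacobiSum q (-α) (fun k => x ^ k / qPochs [] q k) m) * e2
    - (qPoch q q n / (qPoch q q m * qPoch q q (n - m)) * qPoch (-a * q ^ n) q m
    * qPoch (α / a * q ^ ((m : ℤ) - n + 1)) q (n - m) * (-a * q ^ n) ^ (n - m)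
    * qJacobiSum q (-α) (fun k => x ^ k / qPochs [] q k) m) * e4

theorem qCharlier_connection (hq0 : q ≠ 0) (hq : ∀ k : ℕ, 0 < k → q ^ k ≠ 1) (a α y : ℂ) (n : ℕ)
    (ha : a ≠ 0) (hα : α ≠ 0) :
    qCharlier q a n y = ∑ m ∈ Finset.range (n + 1),
        (qPoch q q n / (qPoch q q m * qPoch q q (n - m))
          * qPoch (α / a) q (n - m) * (α / a) ^ m)
        * qCharlier q α m y := by
  refine connection_of_eq_qMeixnerSum_geometric hq0 hq (α / a) (qCharlier_eq hq0 a y n)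
    (qCharlier_eq hq0 α y) (fun k => ?_) fun m hm => ?_
  · rw [← mul_div_assoc, ← mul_assoc, ← mul_pow]
    congr 3
    field_simp
  · rw [qBinom]
    ring

theorem alSalamCarlitzI_connection (hq0 : q ≠ 0) (hq : ∀ k : ℕ, 0 < k → q ^ k ≠ 1) (a α x : ℂ)
    (n : ℕ) (ha : a ≠ 0) (hα : α ≠ 0) (_hx : x ≠ 0) :
    alSalamCarlitzI q a n x = ∑ m ∈ Finset.range (n + 1),
        (qPoch q q n / (qPoch q q m * qPoch q q (n - m)) * (-a) ^ (n - m)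
          * q ^ (((n.choose 2 : ℕ) : ℤ) + ((m.choose 2 : ℕ) : ℤ) + m - n * m)
          * qPoch (α / a * q ^ ((m : ℤ) - n + 1)) q (n - m))
        * alSalamCarlitzI q α m x := by
  rw [alSalamCarlitzI_eq hq0, qJacobiSum_connection hq0 hq 0 (zero_mul_pow_ne_one q n)
    (r := fun k => (α / a) ^ k) (v := fun k => α⁻¹ ^ k * (x ^ k * qPoch x⁻¹ q k)) fun k _ => by
      rw [show a⁻¹ = α / a * α⁻¹ by field_simp, mul_pow, mul_assoc], Finset.mul_sum]
  refine Finset.sum_congr rfl fun m hm => ?_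
  have hm := Nat.lt_succ_iff.1 (Finset.mem_range.1 hm)
  have h := sum_qPoch_neg_mul_pow hq0 hq (n - m) (α / a * q)
  rw [← zpow_sub_eq_zpow_neg hm, mul_assoc, ← zpow_one_add₀ hq0, add_comm 1] at h
  have hs : ∑ j ∈ Finset.range (n - m + 1), qPoch (q ^ ((m : ℤ) - n)) q j / qPoch q q j
        * (qPoch (0 * q ^ (n + m)) q j / qPoch (0 * q ^ (2 * m + 1)) q j * q ^ j
          * (α / a) ^ (m + j))
      = (α / a) ^ m * qPoch (α / a * q ^ ((m : ℤ) - n + 1)) q (n - m) := by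
    rw [← h, Finset.mul_sum]
    refine Finset.sum_congr rfl fun j _ => ?_
    rw [zero_mul, zero_mul, qPoch_zero_left]
    ring
  have e : q ^ (((n.choose 2 : ℕ) : ℤ) + ((m.choose 2 : ℕ) : ℤ) + m - n * m) * q ^ m.choose 2
      = q ^ n.choose 2 * q ^ ((m : ℤ) * (m - n)) := by
    rw [zpow_mul_sub_eq hq0, ← pow_choose_two_mul_self, zpow_sub₀ hq0, zpow_add₀ hq0,
      zpow_add₀ hq0, ← Nat.cast_mul, zpow_natCast, zpow_natCast, zpow_natCast, zpow_natCast]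
    ring
  have e' : (-a) ^ m * (α / a) ^ m = (-α) ^ m := by
    rw [← mul_pow]
    congr 1
    field_simp
  rw [hs, alSalamCarlitzI_eq hq0, qBinom, zero_mul, zero_mul, qPoch_zero_left, ← e',
    ← pow_sub_mul_pow (-a) hm]
  linear_combination (-(-a) ^ (n - m) * (-a) ^ m * (α / a) ^ m
    * (qPoch q q n / (qPoch q q m * qPoch q q (n - m)))
    * qPoch (α / a * q ^ ((m : ℤ) - n + 1)) q (n - m)
    * qJacobiSum q 0 (fun k => α⁻¹ ^ k * (x ^ k * qPoch x⁻¹ q k)) m) * e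

theorem alSalamCarlitzII_connection (hq0 : q ≠ 0) (hq : ∀ k : ℕ, 0 < k → q ^ k ≠ 1) (a α x : ℂ)
    (n : ℕ) (ha : a ≠ 0) (hα : α ≠ 0) :
    alSalamCarlitzII q a n x = ∑ m ∈ Finset.range (n + 1),
        (qPoch q q n / (qPoch q q m * qPoch q q (n - m)) * (-a) ^ (n - m)
          * q ^ (((m.choose 2 : ℕ) : ℤ) - ((n.choose 2 : ℕ) : ℤ))
          * qPoch (α / a) q (n - m))
        * alSalamCarlitzII q α m x := by
  refine connection_of_eq_qMeixnerSum_geometric hq0 hq (α / a) (alSalamCarlitzII_eq hq0 a x n)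
    (alSalamCarlitzII_eq hq0 α x) (fun k => ?_) fun m hm => ?_
  · rw [← mul_assoc, ← mul_div_assoc, ← mul_pow]
    congr 3
    field_simp
  · have e' : (-a) ^ m * (α / a) ^ m = (-α) ^ m := by
      rw [← mul_pow]
      congr 1
      field_simp
    rw [qBinom, zpow_sub₀ hq0, zpow_natCast, zpow_natCast, ← e', ← pow_sub_mul_pow (-a) hm]
    field_simp

end QSeries

theorem mainTheorem8 (q : ℂ) (hq0 : q ≠ 0) (hq : ∀ k : ℕ, 0 < k → q ^ k ≠ 1) :
    -- INVERSION COEFFICIENTS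
    -- Askey–Wilson
    (∀ (a b c d θ : ℂ) (n : ℕ), a ≠ 0 → qPochs [a * b, a * c, a * d] q n ≠ 0 →
      (∀ k : ℕ, k + 1 < 2 * n → a * b * c * d * q ^ k ≠ 1) →
      qPochs [a * expI θ, a * expI (-θ)] q n = ∑ m ∈ Finset.range (n + 1),
        (qBinom q n m * q ^ (m.choose 2) * (-a) ^ m
          * (qPochs [a * b * q ^ m, a * c * q ^ m, a * d * q ^ m] q (n - m)
            / (qPoch (a * b * c * d * q ^ ((m : ℤ) - 1)) q m
              * qPoch (a * b * c * d * q ^ (2 * m)) q (n - m))))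
        * askeyWilson q a b c d m θ) ∧
    -- q-Racah
    (∀ (α β γ δ x : ℂ) (n : ℕ), qPochs [α * q, β * δ * q, γ * q] q n ≠ 0 →
      (∀ k : ℕ, 2 ≤ k → k ≤ 2 * n → α * β * q ^ k ≠ 1) →
      qPochs [q ^ (-x), γ * δ * q ^ (x + 1)] q n = ∑ m ∈ Finset.range (n + 1),
        ((-1) ^ m * qBinom q n m * q ^ (m.choose 2)
          * (qPochs [α * q, β * δ * q, γ * q] q n
            / (qPoch (α * β * q ^ (m + 1)) q m * qPoch (α * β * q ^ (2 * m + 2)) q (n - m))))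
        * qRacah q α β γ δ m x) ∧
    -- continuous dual q-Hahn
    (∀ (a b c θ : ℂ) (n : ℕ), a ≠ 0 → qPochs [a * b, a * c] q n ≠ 0 →
      qPochs [a * expI θ, a * expI (-θ)] q n = ∑ m ∈ Finset.range (n + 1),
        (qBinom q n m * q ^ (m.choose 2) * (-a) ^ m
          * qPochs [a * b * q ^ m, a * c * q ^ m] q (n - m))
        * contDualQHahn q a b c m θ) ∧
    -- continuous q-Hahn
    (∀ (φ a b c d θ : ℂ) (n : ℕ), a ≠ 0 →
      qPochs [a * b * expI (2 * φ), a * c, a * d] q n ≠ 0 →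
      (∀ k : ℕ, k + 1 < 2 * n → a * b * c * d * q ^ k ≠ 1) →
      qPochs [a * expI (θ + 2 * φ), a * expI (-θ)] q n = ∑ m ∈ Finset.range (n + 1),
        (qBinom q n m * q ^ (m.choose 2) * (-(a * expI φ)) ^ m
          * (qPochs [a * b * expI (2 * φ) * q ^ m, a * c * q ^ m, a * d * q ^ m] q (n - m)
            / (qPoch (a * b * c * d * q ^ ((m : ℤ) - 1)) q m
              * qPoch (a * b * c * d * q ^ (2 * m)) q (n - m))))
        * contQHahn q φ a b c d m θ) ∧
    -- big q-Jacobi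
    (∀ (a b c x : ℂ) (n : ℕ), qPochs [a * q, c * q] q n ≠ 0 →
      (∀ k : ℕ, 2 ≤ k → k ≤ 2 * n → a * b * q ^ k ≠ 1) →
      qPoch x q n = ∑ m ∈ Finset.range (n + 1),
        ((-1) ^ m * qBinom q n m * q ^ (m.choose 2)
          * (qPochs [a * q, c * q] q n
            / (qPoch (a * b * q ^ (2 * m + 2)) q (n - m) * qPoch (a * b * q ^ (m + 1)) q m)))
        * bigQJacobi q a b c m x) ∧
    -- q-Hahn
    (∀ (α β y : ℂ) (N n : ℕ), n ≤ N → qPoch (α * q) q n ≠ 0 →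
      (∀ k : ℕ, 2 ≤ k → k ≤ 2 * n → α * β * q ^ k ≠ 1) →
      qPoch y q n = ∑ m ∈ Finset.range (n + 1),
        (qBinom q n m * q ^ (m.choose 2)
          * (qPochs [q ^ (-(N : ℤ)), α * q] q n * (-1) ^ m
            / (qPoch (α * β * q ^ (m + 1)) q m * qPoch (α * β * q ^ (2 * m + 2)) q (n - m))))
        * qHahn q α β N m y) ∧
    -- dual q-Hahn
    (∀ (γ δ x : ℂ) (N n : ℕ), n ≤ N → qPoch (γ * q) q n ≠ 0 →
      qPochs [q ^ (-x), γ * δ * q ^ (x + 1)] q n = ∑ m ∈ Finset.range (n + 1),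
        (qPochs [γ * q, q ^ (-(N : ℤ))] q n * (-1) ^ m * qBinom q n m * q ^ (m.choose 2))
        * dualQHahn q γ δ N m x) ∧
    -- Al-Salam–Chihara
    (∀ (a b θ : ℂ) (n : ℕ), a ≠ 0 → qPoch (a * b) q n ≠ 0 →
      qPochs [a * expI θ, a * expI (-θ)] q n = ∑ m ∈ Finset.range (n + 1),
        ((-a) ^ m * qPoch (a * b * q ^ m) q (n - m) * qBinom q n m * q ^ (m.choose 2))
        * alSalamChihara q a b m θ) ∧
    -- q-Meixner–Pollaczek
    (∀ (φ a θ : ℂ) (n : ℕ), a ≠ 0 → qPoch (a ^ 2) q n ≠ 0 →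
      qPochs [a * expI (θ + 2 * φ), a * expI (-θ)] q n = ∑ m ∈ Finset.range (n + 1),
        (qPoch (a ^ 2 * q ^ m) q (n - m) * qPoch q q m * (-(a * expI φ)) ^ m
          * qBinom q n m * q ^ (m.choose 2))
        * qMeixnerPollaczek q φ a m θ) ∧
    -- continuous q-Jacobi
    (∀ (α β θ : ℂ) (n : ℕ),
      qPochs [q ^ (α + 1), -q ^ ((α + β + 1) / 2), -q ^ ((α + β + 2) / 2)] q n ≠ 0 →
      (∀ k : ℕ, 2 ≤ k → k ≤ 2 * n → q ^ (α + β + k) ≠ 1) →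
      qPochs [q ^ (α / 2 + 1 / 4) * expI θ, q ^ (α / 2 + 1 / 4) * expI (-θ)] q n
        = ∑ m ∈ Finset.range (n + 1),
        (qPochs [-q ^ ((α + β + 1) / 2), -q ^ ((α + β + 2) / 2)] q n * qBinom q n m
          * ((-1) ^ m * qPoch q q m * qPoch (q ^ (α + m + 1)) q (n - m)
            / (qPoch (q ^ (m + α + β + 1)) q m * qPoch (q ^ (2 * m + α + β + 2)) q (n - m)))
          * q ^ (m.choose 2))
        * contQJacobi q α β m θ) ∧
    -- continuous q-ultraspherical (Rogers)
    (∀ (β θ : ℂ) (n : ℕ), β ≠ 0 → (∀ k : ℕ, k < 2 * n → β ^ 2 * q ^ k ≠ 1) →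
      qPochs [β ^ (1 / 2 : ℂ) * expI θ, β ^ (1 / 2 : ℂ) * expI (-θ)] q n
        = ∑ m ∈ Finset.range (n + 1),
        (qBinom q n m * q ^ (m.choose 2)
          * (qPochs [β * q ^ (1 / 2 : ℂ), -β, -(β * q ^ (1 / 2 : ℂ))] q n
            / (qPoch (β ^ 2 * q ^ m) q m * qPoch (β ^ 2) q m))
          * ((-β ^ (1 / 2 : ℂ)) ^ m * qPoch q q m / qPoch (β ^ 2 * q ^ (2 * m + 1)) q (n - m)))
        * rogers q β m θ) ∧
    -- continuous q-Legendre
    (∀ (θ : ℂ) (n : ℕ),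
      qPochs [q ^ (1 / 4 : ℂ) * expI θ, q ^ (1 / 4 : ℂ) * expI (-θ)] q n
        = ∑ m ∈ Finset.range (n + 1),
        (qBinom q n m
          * (qPochs [q, -q ^ (1 / 2 : ℂ), -q] q n
            / (qPoch (q ^ (m + 1)) q m * qPoch (q ^ (2 * m + 2)) q (n - m)))
          * (-1) ^ m * q ^ (m.choose 2))
        * contQLegendre q m θ) ∧
    -- big q-Laguerre
    (∀ (a b x : ℂ) (n : ℕ), qPochs [a * q, b * q] q n ≠ 0 →
      qPoch x q n = ∑ m ∈ Finset.range (n + 1),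
        (qPochs [a * q, b * q] q n * (-1) ^ m * qBinom q n m * q ^ (m.choose 2))
        * bigQLaguerre q a b m x) ∧
    -- little q-Jacobi
    (∀ (a b x : ℂ) (n : ℕ), qPoch (a * q) q n ≠ 0 →
      (∀ k : ℕ, 2 ≤ k → k ≤ 2 * n → a * b * q ^ k ≠ 1) →
      x ^ n = ∑ m ∈ Finset.range (n + 1),
        (qBinom q n m
          * ((-1) ^ m * qPoch (a * q) q n
            / (qPoch (a * b * q ^ (m + 1)) q m * qPoch (a * b * q ^ (2 * m + 2)) q (n - m)))
          * q ^ (m.choose 2))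
        * littleQJacobi q a b m x) ∧
    -- little q-Legendre
    (∀ (x : ℂ) (n : ℕ),
      x ^ n = ∑ m ∈ Finset.range (n + 1),
        (qBinom q n m
          * (q ^ (m.choose 2) * (-1) ^ m * qPoch q q n
            / (qPoch (q ^ (m + 1)) q m * qPoch (q ^ (2 * m + 2)) q (n - m))))
        * littleQLegendre q m x) ∧
    -- q-Meixner
    (∀ (b c y : ℂ) (n : ℕ), c ≠ 0 → qPoch (b * q) q n ≠ 0 →
      qPoch y q n = ∑ m ∈ Finset.range (n + 1),
        (qPoch (b * q) q n * (-1) ^ (m + n) * c ^ n * qBinom q n m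
          * q ^ (((m.choose 2 : ℕ) : ℤ) - m * n + m - n))
        * qMeixner q b c m y) ∧
    -- quantum q-Krawtchouk
    (∀ (p y : ℂ) (N n : ℕ), n ≤ N → p ≠ 0 →
      qPoch y q n = ∑ m ∈ Finset.range (n + 1),
        (p ^ (-(n : ℤ)) * qPoch (q ^ (-(N : ℤ))) q n * (-1) ^ m * qBinom q n m
          * q ^ (((m.choose 2 : ℕ) : ℤ) - m * n + m - n))
        * quantumQKrawtchouk q p N m y) ∧
    -- q-Krawtchouk
    (∀ (p y : ℂ) (N n : ℕ), n ≤ N → (∀ k : ℕ, 1 ≤ k → k < 2 * n → -p * q ^ k ≠ 1) →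
      qPoch y q n = ∑ m ∈ Finset.range (n + 1),
        ((-1) ^ m * qBinom q n m * q ^ (m.choose 2)
          * (qPoch (q ^ (-(N : ℤ))) q n
            / (qPoch (-p * q ^ m) q m * qPoch (-p * q ^ (2 * m + 1)) q (n - m))))
        * qKrawtchouk q p N m y) ∧
    -- affine q-Krawtchouk
    (∀ (p y : ℂ) (N n : ℕ), n ≤ N → qPoch (p * q) q n ≠ 0 →
      qPoch y q n = ∑ m ∈ Finset.range (n + 1),
        (qPochs [p * q, q ^ (-(N : ℤ))] q n * (-1) ^ m * qBinom q n m * q ^ (m.choose 2))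
        * affineQKrawtchouk q p N m y) ∧
    -- dual q-Krawtchouk
    (∀ (c x : ℂ) (N n : ℕ), n ≤ N →
      qPochs [q ^ (-x), c * q ^ (x - N)] q n = ∑ m ∈ Finset.range (n + 1),
        (qPoch (q ^ (-(N : ℤ))) q n * (-1) ^ m * qBinom q n m * q ^ (m.choose 2))
        * dualQKrawtchouk q c N m x) ∧
    -- continuous big q-Hermite
    (∀ (a θ : ℂ) (n : ℕ), a ≠ 0 →
      qPochs [a * expI θ, a * expI (-θ)] q n = ∑ m ∈ Finset.range (n + 1),
        ((-a) ^ m * qBinom q n m * q ^ (m.choose 2))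
        * contBigQHermite q a m θ) ∧
    -- continuous q-Laguerre
    (∀ (α θ : ℂ) (n : ℕ), qPoch (q ^ (α + 1)) q n ≠ 0 →
      qPochs [q ^ (α / 2 + 1 / 4) * expI θ, q ^ (α / 2 + 1 / 4) * expI (-θ)] q n
        = ∑ m ∈ Finset.range (n + 1),
        ((-1) ^ m * qBinom q n m * q ^ (m.choose 2) * qPoch q q m
          * qPoch (q ^ (m + α + 1)) q (n - m))
        * contQLaguerre q α m θ) ∧
    -- little q-Laguerre (Wall)
    (∀ (a x : ℂ) (n : ℕ), qPoch (a * q) q n ≠ 0 →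
      x ^ n = ∑ m ∈ Finset.range (n + 1),
        (qPoch (a * q) q n * (-1) ^ m * qBinom q n m * q ^ (m.choose 2))
        * littleQLaguerre q a m x) ∧
    -- q-Laguerre
    (∀ (α x : ℂ) (n : ℕ), qPoch (q ^ (α + 1)) q n ≠ 0 →
      x ^ n = ∑ m ∈ Finset.range (n + 1),
        (q ^ (-(n : ℂ) * (α + m))
          * q ^ (((m.choose 2 : ℕ) : ℤ) - ((n.choose 2 : ℕ) : ℤ) + m - n)
          * (-1) ^ m * qPoch q q m * qPoch (q ^ (α + m + 1)) q (n - m) * qBinom q n m)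
        * qLaguerre q α m x) ∧
    -- alternative q-Charlier
    (∀ (a x : ℂ) (n : ℕ), (∀ k : ℕ, 1 ≤ k → k < 2 * n → -a * q ^ k ≠ 1) →
      x ^ n = ∑ m ∈ Finset.range (n + 1),
        (qBinom q n m
          * ((-1) ^ m * q ^ (m.choose 2)
            / (qPoch (-a * q ^ m) q m * qPoch (-a * q ^ (2 * m + 1)) q (n - m))))
        * altQCharlier q a m x) ∧
    -- q-Charlier
    (∀ (a y : ℂ) (n : ℕ), a ≠ 0 →
      qPoch y q n = ∑ m ∈ Finset.range (n + 1),
        ((-1) ^ (m + n) * a ^ n * qBinom q n m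
          * q ^ (((m.choose 2 : ℕ) : ℤ) - n * m + m - n))
        * qCharlier q a m y) ∧
    -- Al-Salam–Carlitz I
    (∀ (a x : ℂ) (n : ℕ), a ≠ 0 → x ≠ 0 →
      x ^ n * qPoch x⁻¹ q n = ∑ m ∈ Finset.range (n + 1),
        (a ^ (n - m) * qBinom q n m) * alSalamCarlitzI q a m x) ∧
    -- Al-Salam–Carlitz II
    (∀ (a x : ℂ) (n : ℕ), a ≠ 0 →
      qPoch x q n = ∑ m ∈ Finset.range (n + 1),
        (a ^ (n - m) * q ^ (n.choose 2) * q ^ (((m : ℤ) - n) * m) * (-1) ^ n * qBinom q n m)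
        * alSalamCarlitzII q a m x) ∧
    -- continuous q-Hermite
    (∀ (θ : ℂ) (n : ℕ),
      expI (-2 * n * θ) = ∑ m ∈ Finset.range (n + 1),
        (expI (-m * θ) * q ^ ((m : ℤ) * (1 - n)) * (-1) ^ (n + m)
          * q ^ (n.choose 2) * q ^ (m.choose 2) * qBinom q n m)
        * contQHermite q m θ) ∧
    -- Stieltjes–Wigert
    (∀ (x : ℂ) (n : ℕ),
      x ^ n = ∑ m ∈ Finset.range (n + 1),
        (qPoch q q m * (-1) ^ m
          * q ^ (((m.choose 2 : ℕ) : ℤ) - ((n.choose 2 : ℕ) : ℤ) - n * m + m - n)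
          * qBinom q n m)
        * stieltjesWigert q m x) ∧
    -- discrete q-Hermite I
    (∀ (x : ℂ) (n : ℕ), x ≠ 0 →
      x ^ n * qPoch x⁻¹ q n = ∑ m ∈ Finset.range (n + 1),
        ((-1) ^ (m + n) * qBinom q n m) * discreteQHermiteI q m x) ∧
    -- discrete q-Hermite II
    (∀ (x : ℂ) (n : ℕ),
      qPoch (Complex.I * x) q n = ∑ m ∈ Finset.range (n + 1),
        ((-Complex.I) ^ m * q ^ (((m : ℤ) - n) * m) * q ^ (n.choose 2) * qBinom q n m)
        * discreteQHermiteII q m x) ∧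
    -- CONNECTION COEFFICIENTS
    -- Askey–Wilson
    (∀ (a b c d β γ δ θ : ℂ) (n : ℕ), a ≠ 0 →
      qPochs [a * b, a * c, a * d] q n ≠ 0 → qPochs [a * β, a * γ, a * δ] q n ≠ 0 →
      (∀ k : ℕ, k + 1 < 2 * n → a * β * γ * δ * q ^ k ≠ 1) →
      askeyWilson q a b c d n θ = ∑ m ∈ Finset.range (n + 1),
        (a ^ ((m : ℤ) - n) * q ^ ((m : ℤ) * (m - n)) / qPoch q q (n - m)
          * (qPochs [a * b, a * c, a * d, q] q n
              * qPoch (a * b * c * d * q ^ ((n : ℤ) - 1)) q m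
            / (qPochs [a * b, a * c, a * d, q] q m
              * qPoch (a * β * γ * δ * q ^ ((m : ℤ) - 1)) q m))
          * qHyp [q ^ ((m : ℤ) - n), a * β * q ^ m, a * γ * q ^ m, a * δ * q ^ m,
                a * b * c * d * q ^ ((n : ℤ) + m - 1)]
              [a * b * q ^ m, a * c * q ^ m, a * d * q ^ m, a * β * γ * δ * q ^ (2 * m)] q q)
        * askeyWilson q a β γ δ m θ) ∧
    -- q-Racah
    (∀ (α β γ δ a b c d x : ℂ) (n : ℕ), γ * δ = c * d →
      qPochs [α * q, β * δ * q, γ * q] q n ≠ 0 → qPochs [a * q, b * d * q, c * q] q n ≠ 0 →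
      (∀ k : ℕ, 2 ≤ k → k ≤ 2 * n → a * b * q ^ k ≠ 1) →
      qRacah q α β γ δ n x = ∑ m ∈ Finset.range (n + 1),
        (q ^ ((m : ℤ) * (m - n)) * qPoch q q n
            * qPochs [α * β * q ^ (n + 1), a * q, b * d * q, c * q] q m
          / (qPoch q q m * qPoch q q (n - m)
            * qPochs [α * q, β * δ * q, γ * q, a * b * q ^ (m + 1)] q m)
          * qHyp [q ^ ((m : ℤ) - n), α * β * q ^ (m + n + 1), a * q ^ (m + 1),
                b * d * q ^ (m + 1), c * q ^ (m + 1)]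
              [α * q ^ (m + 1), β * δ * q ^ (m + 1), a * b * q ^ (2 * m + 2), γ * q ^ (m + 1)] q q)
        * qRacah q a b c d m x) ∧
    -- continuous dual q-Hahn
    (∀ (a b c β γ θ : ℂ) (n : ℕ), a ≠ 0 →
      qPochs [a * b, a * c] q n ≠ 0 → qPochs [a * β, a * γ] q n ≠ 0 →
      contDualQHahn q a b c n θ = ∑ m ∈ Finset.range (n + 1),
        (a ^ ((m : ℤ) - n) * qPoch q q n * q ^ ((m : ℤ) * (m - n))
            * qPochs [a * b * q ^ m, a * c * q ^ m] q (n - m)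
          / (qPoch q q (n - m) * qPoch q q m)
          * qHyp [q ^ ((m : ℤ) - n), a * β * q ^ m, a * γ * q ^ m]
              [a * b * q ^ m, a * c * q ^ m] q q)
        * contDualQHahn q a β γ m θ) ∧
    -- continuous q-Hahn
    (∀ (φ a b c d β γ δ θ : ℂ) (n : ℕ), a ≠ 0 →
      qPochs [a * b * expI (2 * φ), a * c, a * d] q n ≠ 0 →
      qPochs [a * β * expI (2 * φ), a * γ, a * δ] q n ≠ 0 →
      (∀ k : ℕ, k + 1 < 2 * n → a * β * γ * δ * q ^ k ≠ 1) →
      contQHahn q φ a b c d n θ = ∑ m ∈ Finset.range (n + 1),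
        (q ^ ((m : ℤ) * (m - n)) * qPoch q q n
            * qPochs [a * b * expI (2 * φ), a * c, a * d] q n
            * qPoch (a * b * c * d * q ^ ((n : ℤ) - 1)) q m
            * a ^ ((m : ℤ) - n) * expI (φ * (m - n))
          / (qPoch q q (n - m) * qPoch q q m
            * qPochs [a * b * expI (2 * φ), a * c, a * d] q m
            * qPoch (a * β * γ * δ * q ^ ((m : ℤ) - 1)) q m)
          * qHyp [q ^ ((m : ℤ) - n), a * b * c * d * q ^ ((m : ℤ) + n - 1),
                a * β * expI (2 * φ) * q ^ m, a * γ * q ^ m, a * δ * q ^ m]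
              [a * b * expI (2 * φ) * q ^ m, a * c * q ^ m, a * d * q ^ m,
                a * β * γ * δ * q ^ (2 * m)] q q)
        * contQHahn q φ a β γ δ m θ) ∧
    -- big q-Jacobi
    (∀ (a b c α β γ x : ℂ) (n : ℕ),
      qPochs [a * q, c * q] q n ≠ 0 → qPochs [α * q, γ * q] q n ≠ 0 →
      (∀ k : ℕ, 2 ≤ k → k ≤ 2 * n → α * β * q ^ k ≠ 1) →
      bigQJacobi q a b c n x = ∑ m ∈ Finset.range (n + 1),
        (q ^ ((m : ℤ) * (m - n)) * qPoch q q n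
            * qPochs [a * b * q ^ (n + 1), α * q, γ * q] q m
          / (qPoch q q m * qPoch q q (n - m) * qPochs [a * q, c * q, α * β * q ^ (m + 1)] q m)
          * qHyp [q ^ ((m : ℤ) - n), a * b * q ^ (m + n + 1), α * q ^ (m + 1), γ * q ^ (m + 1)]
              [a * q ^ (m + 1), c * q ^ (m + 1), α * β * q ^ (2 * m + 2)] q q)
        * bigQJacobi q α β γ m x) ∧
    -- q-Hahn
    (∀ (α β α₁ β₁ y : ℂ) (N N₁ n : ℕ), n ≤ N → n ≤ N₁ →
      qPoch (α * q) q n ≠ 0 → qPoch (α₁ * q) q n ≠ 0 →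
      (∀ k : ℕ, 2 ≤ k → k ≤ 2 * n → α₁ * β₁ * q ^ k ≠ 1) →
      qHahn q α β N n y = ∑ m ∈ Finset.range (n + 1),
        (q ^ ((m : ℤ) * (m - n))
            * qPochs [α * β * q ^ (n + 1), q ^ (-(N₁ : ℤ)), α₁ * q] q m * qPoch q q n
          / (qPoch q q m * qPoch q q (n - m)
            * qPochs [α * q, q ^ (-(N : ℤ)), α₁ * β₁ * q ^ (m + 1)] q m)
          * qHyp [q ^ ((m : ℤ) - n), α * β * q ^ (n + m + 1), q ^ ((m : ℤ) - N₁), α₁ * q ^ (1 + m)]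
              [α * q ^ (m + 1), q ^ ((m : ℤ) - N), α₁ * β₁ * q ^ (2 * m + 2)] q q)
        * qHahn q α₁ β₁ N₁ m y) ∧
    -- dual q-Hahn
    (∀ (γ δ γ₁ δ₁ x : ℂ) (N N₁ n : ℕ), n ≤ N → n ≤ N₁ → γ * δ = γ₁ * δ₁ →
      qPoch (γ * q) q n ≠ 0 → qPoch (γ₁ * q) q n ≠ 0 →
      dualQHahn q γ δ N n x = ∑ m ∈ Finset.range (n + 1),
        (q ^ ((m : ℤ) * (m - n)) * qPoch q q n * qPochs [γ₁ * q, q ^ (-(N₁ : ℤ))] q m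
          / (qPoch q q m * qPoch q q (n - m) * qPochs [γ * q, q ^ (-(N : ℤ))] q m)
          * qHyp [q ^ ((m : ℤ) - n), γ₁ * q ^ (m + 1), q ^ ((m : ℤ) - N₁)]
              [γ * q ^ (m + 1), q ^ ((m : ℤ) - N)] q q)
        * dualQHahn q γ₁ δ₁ N₁ m x) ∧
    -- Al-Salam–Chihara
    (∀ (a b β θ : ℂ) (n : ℕ), a ≠ 0 → β ≠ 0 → qPoch (a * b) q n ≠ 0 → qPoch (a * β) q n ≠ 0 →
      alSalamChihara q a b n θ = ∑ m ∈ Finset.range (n + 1),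
        (qPoch q q n * β ^ (n - m) * qPoch (b / β) q (n - m)
          / (qPoch q q m * qPoch q q (n - m)))
        * alSalamChihara q a β m θ) ∧
    -- continuous q-Jacobi
    (∀ (α β β₁ ν ν₁ θ : ℂ) (n : ℕ), ν = α + β + 1 → ν₁ = α + β₁ + 1 →
      qPochs [q ^ (α + 1), -q ^ (ν / 2), -q ^ ((ν + 1) / 2)] q n ≠ 0 →
      qPochs [-q ^ (ν₁ / 2), -q ^ ((ν₁ + 1) / 2)] q n ≠ 0 →
      (∀ k : ℕ, 1 ≤ k → k < 2 * n → q ^ (ν₁ + k) ≠ 1) →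
      contQJacobi q α β n θ = ∑ m ∈ Finset.range (n + 1),
        (q ^ ((m : ℤ) * (m - n)) * qPoch (q ^ (α + 1)) q n
            * qPochs [q ^ (ν + n), -q ^ (ν₁ / 2), -q ^ ((ν₁ + 1) / 2)] q m
          / (qPoch q q (n - m) * qPoch (q ^ (ν₁ + m)) q m
            * qPochs [q ^ (α + 1), -q ^ (ν / 2), -q ^ ((ν + 1) / 2)] q m)
          * qHyp [q ^ ((m : ℤ) - n), q ^ (m + n + ν), -q ^ (ν₁ / 2 + m), -q ^ ((ν₁ + 1) / 2 + m),
                q ^ (α + m + 1)]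
              [q ^ (m + α + 1), -q ^ (ν / 2 + m), -q ^ ((ν + 1) / 2 + m),
                q ^ (2 * m + ν₁ + 1)] q q)
        * contQJacobi q α β₁ m θ) ∧
    -- big q-Laguerre
    (∀ (a b α β x : ℂ) (n : ℕ),
      qPochs [a * q, b * q] q n ≠ 0 → qPochs [α * q, β * q] q n ≠ 0 →
      bigQLaguerre q a b n x = ∑ m ∈ Finset.range (n + 1),
        (q ^ ((m : ℤ) * (m - n)) * qPoch q q n * qPochs [α * q, β * q] q m
          / (qPoch q q m * qPoch q q (n - m) * qPochs [a * q, b * q] q m)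
          * qHyp [q ^ ((m : ℤ) - n), α * q ^ (m + 1), β * q ^ (m + 1)]
              [a * q ^ (m + 1), b * q ^ (m + 1)] q q)
        * bigQLaguerre q α β m x) ∧
    -- little q-Jacobi
    (∀ (a b α β x : ℂ) (n : ℕ), qPoch (a * q) q n ≠ 0 → qPoch (α * q) q n ≠ 0 →
      (∀ k : ℕ, 2 ≤ k → k ≤ 2 * n → α * β * q ^ k ≠ 1) →
      littleQJacobi q a b n x = ∑ m ∈ Finset.range (n + 1),
        (q ^ ((m : ℤ) * (m - n)) * qPoch q q n * qPochs [a * b * q ^ (n + 1), α * q] q m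
          / (qPoch q q m * qPoch q q (n - m) * qPochs [a * q, α * β * q ^ (m + 1)] q m)
          * qHyp [q ^ ((m : ℤ) - n), a * b * q ^ (m + n + 1), α * q ^ (m + 1)]
              [a * q ^ (m + 1), α * β * q ^ (2 * m + 2)] q q)
        * littleQJacobi q α β m x) ∧
    -- q-Meixner
    (∀ (b c β γ y : ℂ) (n : ℕ), c ≠ 0 → γ ≠ 0 → qPoch (b * q) q n ≠ 0 → qPoch (β * q) q n ≠ 0 →
      qMeixner q b c n y = ∑ m ∈ Finset.range (n + 1),
        ((γ / c) ^ m
          * (qPoch q q n * qPoch (β * q) q m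
            / (qPoch q q m * qPoch q q (n - m) * qPoch (b * q) q m))
          * qHyp [q ^ ((m : ℤ) - n), β * q ^ (m + 1)] [b * q ^ (m + 1)] q (γ / c * q ^ (n - m)))
        * qMeixner q β γ m y) ∧
    -- quantum q-Krawtchouk
    (∀ (p p₁ y : ℂ) (N N₁ n : ℕ), n ≤ N → n ≤ N₁ → p₁ ≠ 0 →
      quantumQKrawtchouk q p N n y = ∑ m ∈ Finset.range (n + 1),
        (qPoch q q n * qPoch (q ^ (-(N₁ : ℤ))) q m
            / (qPoch q q m * qPoch q q (n - m) * qPoch (q ^ (-(N : ℤ))) q m)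
          * (p / p₁) ^ m
          * qHyp [q ^ ((m : ℤ) - n), q ^ ((m : ℤ) - N₁)] [q ^ ((m : ℤ) - N)] q
              (p / p₁ * q ^ (n - m)))
        * quantumQKrawtchouk q p₁ N₁ m y) ∧
    -- q-Krawtchouk
    (∀ (p p₁ y : ℂ) (N N₁ n : ℕ), n ≤ N → n ≤ N₁ →
      (∀ k : ℕ, 1 ≤ k → k < 2 * n → -p₁ * q ^ k ≠ 1) →
      qKrawtchouk q p N n y = ∑ m ∈ Finset.range (n + 1),
        (q ^ ((m : ℤ) * (m - n)) * (qPoch q q n / (qPoch q q m * qPoch q q (n - m)))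
          * (qPochs [-p * q ^ n, q ^ (-(N₁ : ℤ))] q m / qPochs [-p₁ * q ^ m, q ^ (-(N : ℤ))] q m)
          * qHyp [q ^ ((m : ℤ) - n), -p * q ^ (m + n), q ^ ((m : ℤ) - N₁)]
              [q ^ ((m : ℤ) - N), -p₁ * q ^ (2 * m + 1)] q q)
        * qKrawtchouk q p₁ N₁ m y) ∧
    -- little q-Laguerre (Wall)
    (∀ (a α x : ℂ) (n : ℕ), α ≠ 0 → qPoch (a * q) q n ≠ 0 → qPoch (α * q) q n ≠ 0 →
      littleQLaguerre q a n x = ∑ m ∈ Finset.range (n + 1),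
        ((α * q) ^ (n - m) * (qPoch q q n / (qPoch q q m * qPoch q q (n - m)))
          * (qPoch (α * q) q m / qPoch (a * q) q n) * qPoch (a / α) q (n - m))
        * littleQLaguerre q α m x) ∧
    -- q-Laguerre
    (∀ (α β x : ℂ) (n : ℕ), qPoch (q ^ (α + 1)) q n ≠ 0 → qPoch (q ^ (β + 1)) q n ≠ 0 →
      qLaguerre q α n x = ∑ m ∈ Finset.range (n + 1),
        (q ^ (m * (α - β)) * qPoch (q ^ (α + m + 1)) q (n - m) / qPoch q q (n - m)
          * qHyp [q ^ ((m : ℤ) - n), q ^ (β + m + 1)] [q ^ (α + m + 1)] q (q ^ (n - m + α - β)))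
        * qLaguerre q β m x) ∧
    -- alternative q-Charlier
    (∀ (a α x : ℂ) (n : ℕ), a ≠ 0 → (∀ k : ℕ, k ≤ 2 * n → 1 + α * q ^ k ≠ 0) →
      altQCharlier q a n x = ∑ m ∈ Finset.range (n + 1),
        (qPoch q q n * qPoch (-a * q ^ n) q m
            / (qPoch q q m * qPoch q q (n - m) * qPoch (-α * q ^ m) q n)
          * ((1 + α * q ^ (2 * m)) / (1 + α * q ^ (m + n)))
          * qPoch (α / a * q ^ ((m : ℤ) - n + 1)) q (n - m) * (-a * q ^ n) ^ (n - m))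
        * altQCharlier q α m x) ∧
    -- q-Charlier
    (∀ (a α y : ℂ) (n : ℕ), a ≠ 0 → α ≠ 0 →
      qCharlier q a n y = ∑ m ∈ Finset.range (n + 1),
        (qPoch q q n / (qPoch q q m * qPoch q q (n - m))
          * qPoch (α / a) q (n - m) * (α / a) ^ m)
        * qCharlier q α m y) ∧
    -- Al-Salam–Carlitz I
    (∀ (a α x : ℂ) (n : ℕ), a ≠ 0 → α ≠ 0 → x ≠ 0 →
      alSalamCarlitzI q a n x = ∑ m ∈ Finset.range (n + 1),
        (qPoch q q n / (qPoch q q m * qPoch q q (n - m)) * (-a) ^ (n - m)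
          * q ^ (((n.choose 2 : ℕ) : ℤ) + ((m.choose 2 : ℕ) : ℤ) + m - n * m)
          * qPoch (α / a * q ^ ((m : ℤ) - n + 1)) q (n - m))
        * alSalamCarlitzI q α m x) ∧
    -- Al-Salam–Carlitz II
    (∀ (a α x : ℂ) (n : ℕ), a ≠ 0 → α ≠ 0 →
      alSalamCarlitzII q a n x = ∑ m ∈ Finset.range (n + 1),
        (qPoch q q n / (qPoch q q m * qPoch q q (n - m)) * (-a) ^ (n - m)
          * q ^ (((m.choose 2 : ℕ) : ℤ) - ((n.choose 2 : ℕ) : ℤ))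
          * qPoch (α / a) q (n - m))
        * alSalamCarlitzII q α m x) := by
  exact ⟨askeyWilson_inversion hq0 hq, qRacah_inversion hq0 hq, contDualQHahn_inversion hq0 hq,
    contQHahn_inversion hq0 hq, bigQJacobi_inversion hq0 hq, qHahn_inversion hq0 hq,
    dualQHahn_inversion hq0 hq, alSalamChihara_inversion hq0 hq,
    qMeixnerPollaczek_inversion hq0 hq, contQJacobi_inversion hq0 hq, rogers_inversion hq0 hq,
    contQLegendre_inversion hq0 hq, bigQLaguerre_inversion hq0 hq, littleQJacobi_inversion hq0 hq,
    littleQLegendre_inversion hq0 hq, qMeixner_inversion hq0 hq,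
    quantumQKrawtchouk_inversion hq0 hq, qKrawtchouk_inversion hq0 hq,
    affineQKrawtchouk_inversion hq0 hq, dualQKrawtchouk_inversion hq0 hq,
    contBigQHermite_inversion hq0 hq, contQLaguerre_inversion hq0 hq,
    littleQLaguerre_inversion hq0 hq, qLaguerre_inversion hq0 hq, altQCharlier_inversion hq0 hq,
    qCharlier_inversion hq0 hq, alSalamCarlitzI_inversion hq0 hq,
    alSalamCarlitzII_inversion hq0 hq, contQHermite_inversion hq0 hq,
    stieltjesWigert_inversion hq0 hq, discreteQHermiteI_inversion hq0 hq,
    discreteQHermiteII_inversion hq0 hq, askeyWilson_connection hq0 hq, qRacah_connection hq0 hq,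
    contDualQHahn_connection hq0 hq, contQHahn_connection hq0 hq, bigQJacobi_connection hq0 hq,
    qHahn_connection hq0 hq, dualQHahn_connection hq0 hq, alSalamChihara_connection hq0 hq,
    contQJacobi_connection hq0 hq, bigQLaguerre_connection hq0 hq,
    littleQJacobi_connection hq0 hq, qMeixner_connection hq0 hq,
    quantumQKrawtchouk_connection hq0 hq, qKrawtchouk_connection hq0 hq,
    littleQLaguerre_connection hq0 hq, qLaguerre_connection hq0 hq,
    altQCharlier_connection hq0 hq, qCharlier_connection hq0 hq,
    alSalamCarlitzI_connection hq0 hq, alSalamCarlitzII_connection hq0 hq⟩
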